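/- Let $n\ge 2$, let $\mathbb R^n_+=\{(x',x_n): x'\in\mathbb R^{n-1},\ x_n>0\}$, and identify $\partial\mathbb R^n_+$ with $\mathbb R^{n-1}$. All functions are real-valued. Let $\dot W^{1,1}(\mathbb R^n_+)$ be the closure of $C_c^\infty(\overline{\mathbb R^n_+})$ in $L^1_{\mathrm{loc}}(\mathbb R^n_+)$ with respect to $\|\nabla\cdot\|_{L^1(\mathbb R^n_+)}$, that is, the set of all $u\in L^1_{\mathrm{loc}}(\mathbb R^n_+)$ with weak gradient $\nabla u\in L^1(\mathbb R^n_+;\mathbb R^n)$ for which there are $u_k\in C_c^\infty(\overline{\mathbb R^n_+})$ with $u_k\to u$ in $L^1_{\mathrm{loc}}(\mathbb R^n_+)$ and $\nabla u_k\to\nabla u$ in $L^1(\mathbb R^n_+;\mathbb R^n)$. (a) There is a unique linear operator $\gamma_{\mathbb R^{n-1}}\colon\dot W^{1,1}(\mathbb R^n_+)\to L^1(\mathbb R^{n-1})$, bounded in the sense that $\|\gamma_{\mathbb R^{n-1}}u\|_{L^1(\mathbb R^{n-1})}\le C\|\nabla u\|_{L^1(\mathbb R^n_+)}$ for some constant $C$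 and all $u$, such that $u_k(\cdot,0)\to\gamma_{\mathbb R^{n-1}}u$ in $L^1(\mathbb R^{n-1})$ whenever $u_k\in C_c^\infty(\overline{\mathbb R^n_+})$ and $\nabla u_k\to\nabla u$ in $L^1(\mathbb R^n_+;\mathbb R^n)$ (the trace operator). It satisfies $$\gamma_{\mathbb R^{n-1}}\big((\dot W^{1,1}\cap L^q)(\mathbb R^n_+)\big)=\begin{cases}L^1(\mathbb R^{n-1})&\text{if }\frac n{n-1}<q<\infty,\\ (L^1\cap L^\infty)(\mathbb R^{n-1})&\text{if }q=\infty.\end{cases}$$ (b) Let $\Omega\subset\mathbb R^n$ be open and bounded with Lipschitz boundary (near each boundary point and after an orthogonal change of coordinates, $\Omega$ is the region above the graph of a Lipschitz function of $n-1$ variables), and equip $\partial\Omega$ with the $(n-1)$-dimensional Hausdorff measure. There is a unique bounded linear operator $\gamma_{\partial\Omega}\colon W^{1,1}(\Omega)\to L^1(\partial\Omega)$ with $\gamma_{\partial\Omega}u=u|_{\partial\Omega}$ for all $u\in C(\overline\Omega)\cap W^{1,1}(\Omega)$ (the trace operator). It satisfies $$\gamma_{\partial\Omega}\big((W^{1,1}\cap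 L^q)(\Omega)\big)=\begin{cases}L^1(\partial\Omega)&\text{if }\frac n{n-1}<q<\infty,\\ L^\infty(\partial\Omega)&\text{if }q=\infty.\end{cases}$$ -/

import Mathlib

open MeasureTheory Set Filter Topology
open scoped ENNReal NNReal ContDiff

noncomputable section

namespace TraceL1

/-- Euclidean space `ℝⁿ` with its Euclidean norm. -/
abbrev Euc (n : ℕ) : Type := EuclideanSpace ℝ (Fin n)

/-- The point `(x', t) ∈ ℝ^{d+1}` for `x' ∈ ℝ^d` and `t ∈ ℝ`. -/
def withLast {d : ℕ} (x' : Euc d) (t : ℝ) : Euc (d + 1) :=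
  WithLp.toLp 2 (Fin.snoc (α := fun _ => ℝ) (fun i => x' i) t)

/-- The first `d` coordinates `x'` of a point `x = (x', x_{d+1}) ∈ ℝ^{d+1}`. -/
def firstCoords {d : ℕ} (x : Euc (d + 1)) : Euc d :=
  WithLp.toLp 2 (fun i => x (Fin.castSucc i))

/-- The open upper half-space of `ℝ^{d+1}`. -/
def halfSpace (d : ℕ) : Set (Euc (d + 1)) := {x | 0 < x (Fin.last d)}

/-- Lebesgue measure on the set `U`. -/
abbrev vol {n : ℕ} (U : Set (Euc n)) : Measure (Euc n) := volume.restrict U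

/-- `Ω ⊆ ℝ^{d+1}` has Lipschitz boundary: near each of its boundary points, after an orthogonal
change of coordinates, `Ω` is the set of points strictly above the graph of a Lipschitz function
of the first `d` coordinates. -/
def HasLipschitzBoundary {d : ℕ} (Ω : Set (Euc (d + 1))) : Prop :=
  ∀ x ∈ frontier Ω, ∃ (e : Euc (d + 1) ≃ₗᵢ[ℝ] Euc (d + 1)) (ψ : Euc d → ℝ) (K : ℝ≥0) (r : ℝ),
    LipschitzWith K ψ ∧ 0 < r ∧
      ∀ y ∈ Metric.ball x r, y ∈ Ω ↔ ψ (firstCoords (e y)) < (e y) (Fin.last d)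

/-- The surface measure `ℋ^d` on the boundary of `Ω ⊆ ℝ^{d+1}` (the Hausdorff measure normalized
so that it is Lebesgue measure on `ℝ^d`). -/
def surfaceMeasure {d : ℕ} (Ω : Set (Euc (d + 1))) : Measure (Euc (d + 1)) :=
  (Measure.euclideanHausdorffMeasure d).restrict (frontier Ω)

/-- Smooth compactly supported functions on `ℝⁿ`. -/
def IsSmoothCompact {n : ℕ} (φ : Euc n → ℝ) : Prop :=
  ContDiff ℝ ∞ φ ∧ HasCompactSupport φ

lemma IsSmoothCompact.integrable_smul {n : ℕ} {φ : Euc n → ℝ} (hφ : IsSmoothCompact φ)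
    {U : Set (Euc n)} {G : Euc n → Euc n} (hG : Integrable G (vol U)) :
    Integrable (fun x => φ x • G x) (vol U) := by
  obtain ⟨C, hC⟩ := hφ.2.exists_bound_of_continuous hφ.1.continuous
  exact hG.bdd_smul C hφ.1.continuous.aestronglyMeasurable
    (Eventually.of_forall hC)

lemma IsSmoothCompact.continuous_gradient {n : ℕ} {φ : Euc n → ℝ} (hφ : IsSmoothCompact φ) :
    Continuous (gradient φ) :=
  (InnerProductSpace.toDual ℝ (Euc n)).symm.continuous.comp
    (hφ.1.continuous_fderiv (by simp))

lemma IsSmoothCompact.integrable_smul_gradient {n : ℕ} {φ : Euc n → ℝ} (hφ : IsSmoothCompact φ)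
    {U : Set (Euc n)} {u : Euc n → ℝ} (hu : Integrable u (vol U)) :
    Integrable (fun x => u x • gradient φ x) (vol U) := by
  have hs : HasCompactSupport (gradient φ) :=
    (hφ.2.fderiv (𝕜 := ℝ)).comp_left (g := (InnerProductSpace.toDual ℝ (Euc n)).symm) (map_zero _)
  obtain ⟨C, hC⟩ := hs.exists_bound_of_continuous hφ.continuous_gradient
  exact hu.smul_bdd C hφ.continuous_gradient.aestronglyMeasurable
    (Eventually.of_forall hC)

/-- `G` is the weak gradient of `u` in the open set `U`:
`∫_U u ∇φ = - ∫_U φ G` for all test functions `φ ∈ C_c^∞(U)`. -/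
def HasWeakGradient {n : ℕ} (U : Set (Euc n)) (u : Euc n → ℝ) (G : Euc n → Euc n) : Prop :=
  ∀ φ : Euc n → ℝ, IsSmoothCompact φ → tsupport φ ⊆ U →
    ∫ x in U, u x • gradient φ x = - ∫ x in U, φ x • G x

/-- The Sobolev space `W^{1,1}(U)`, realized as the space of pairs `(u, ∇u)` where
`u ∈ L¹(U)` has the weak gradient `∇u ∈ L¹(U; ℝⁿ)`. The norm, inherited from the product, is
`max (‖u‖_{L¹}) (‖∇u‖_{L¹})`, which is equivalent to the usual one. -/
def W11 {n : ℕ} (U : Set (Euc n)) : Submodule ℝ (Lp ℝ 1 (vol U) × Lp (Euc n) 1 (vol U)) where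
  carrier := {w | HasWeakGradient U w.1 w.2}
  zero_mem' := by
    intro φ _ _
    have h1 : ∫ x in U, (0 : Lp ℝ 1 (vol U)) x • gradient φ x = 0 := by
      refine integral_eq_zero_of_ae ?_
      filter_upwards [Lp.coeFn_zero ℝ 1 (vol U)] with x hx
      rw [hx, Pi.zero_apply, zero_smul]; rfl
    have h2 : ∫ x in U, φ x • (0 : Lp (Euc n) 1 (vol U)) x = 0 := by
      refine integral_eq_zero_of_ae ?_
      filter_upwards [Lp.coeFn_zero (Euc n) 1 (vol U)] with x hx
      rw [hx, Pi.zero_apply, smul_zero]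
    change ∫ x in U, (0 : Lp ℝ 1 (vol U)) x • gradient φ x
      = - ∫ x in U, φ x • (0 : Lp (Euc n) 1 (vol U)) x
    rw [h1, h2, neg_zero]
  add_mem' := by
    intro a b ha hb φ hφ hs
    have h1 : ∫ x in U, (a.1 + b.1) x • gradient φ x
        = (∫ x in U, a.1 x • gradient φ x) + ∫ x in U, b.1 x • gradient φ x := by
      rw [← integral_add (hφ.integrable_smul_gradient (L1.integrable_coeFn a.1))
        (hφ.integrable_smul_gradient (L1.integrable_coeFn b.1))]
      refine integral_congr_ae ?_
      filter_upwards [Lp.coeFn_add a.1 b.1] with x hx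
      rw [hx, Pi.add_apply, add_smul]
    have h2 : ∫ x in U, φ x • (a.2 + b.2) x
        = (∫ x in U, φ x • a.2 x) + ∫ x in U, φ x • b.2 x := by
      rw [← integral_add (hφ.integrable_smul (L1.integrable_coeFn a.2))
        (hφ.integrable_smul (L1.integrable_coeFn b.2))]
      refine integral_congr_ae ?_
      filter_upwards [Lp.coeFn_add a.2 b.2] with x hx
      rw [hx, Pi.add_apply, smul_add]
    change ∫ x in U, (a.1 + b.1) x • gradient φ x = - ∫ x in U, φ x • (a.2 + b.2) x
    rw [h1, h2, ha φ hφ hs, hb φ hφ hs, neg_add]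
  smul_mem' := by
    intro c a ha φ hφ hs
    have h1 : ∫ x in U, (c • a.1) x • gradient φ x = c • ∫ x in U, a.1 x • gradient φ x := by
      rw [← integral_smul]
      refine integral_congr_ae ?_
      filter_upwards [Lp.coeFn_smul c a.1] with x hx
      rw [hx, Pi.smul_apply, smul_assoc]
    have h2 : ∫ x in U, φ x • (c • a.2) x = c • ∫ x in U, φ x • a.2 x := by
      rw [← integral_smul]
      refine integral_congr_ae ?_
      filter_upwards [Lp.coeFn_smul c a.2] with x hx
      rw [hx, Pi.smul_apply, smul_comm]
    change ∫ x in U, (c • a.1) x • gradient φ x = - ∫ x in U, φ x • (c • a.2) x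
    rw [h1, h2, ha φ hφ hs, smul_neg]

/-- The function underlying an element of `W^{1,1}(U)`. -/
def W11fun {n : ℕ} {U : Set (Euc n)} (w : W11 U) : Euc n → ℝ := w.1.1

/-- `γ` is the trace operator on `W^{1,1}(Ω)`: the bounded linear operator into `L¹(∂Ω)` that
restricts every function in `C(closure Ω) ∩ W^{1,1}(Ω)` to the boundary. -/
def IsTraceOperator {d : ℕ} {Ω : Set (Euc (d + 1))}
    (γ : W11 Ω →L[ℝ] Lp ℝ 1 (surfaceMeasure Ω)) : Prop :=
  ∀ (w : W11 Ω) (g : Euc (d + 1) → ℝ), ContinuousOn g (closure Ω) → W11fun w =ᵐ[vol Ω] g →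
    γ w =ᵐ[surfaceMeasure Ω] g

/-- The set `γ((W^{1,1} ∩ L^q)(Ω))`, as a set of functions on `∂Ω` closed under a.e. equality. -/
def traceSpace {d : ℕ} {Ω : Set (Euc (d + 1))}
    (γ : W11 Ω →L[ℝ] Lp ℝ 1 (surfaceMeasure Ω)) (q : ℝ≥0∞) : Set (Euc (d + 1) → ℝ) :=
  {f | ∃ w : W11 Ω, MemLp (W11fun w) q (vol Ω) ∧ γ w =ᵐ[surfaceMeasure Ω] f}

/-- The homogeneous Sobolev space `Ẇ^{1,1}` on the upper half-space `ℍ` of `ℝ^{d+1}`: the closure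
of (the restrictions to `ℍ` of) `C_c^∞` functions on the closed half-space with respect to the
norm `‖∇ · ‖_{L¹(ℍ)}`, taken in `L¹_loc(ℍ)`. It is realized as the space of pairs `(u, ∇u)` that
are limits, in `L¹_loc(ℍ) × L¹(ℍ; ℝ^{d+1})`, of pairs `(φ k, ∇ (φ k))`; the second component of
such a limit is the weak gradient of the first. -/
def HomW11 (d : ℕ) :
    Submodule ℝ ((Euc (d + 1) →ₘ[vol (halfSpace d)] ℝ) × Lp (Euc (d + 1)) 1 (vol (halfSpace d)))
    where
  carrier := {w | ∃ φ : ℕ → Euc (d + 1) → ℝ, (∀ k, IsSmoothCompact (φ k)) ∧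
    (∀ K : Set (Euc (d + 1)), IsCompact K → K ⊆ halfSpace d →
      Tendsto (fun k => eLpNorm (fun x => φ k x - w.1 x) 1 (vol K)) atTop (𝓝 0)) ∧
    Tendsto (fun k => eLpNorm (fun x => gradient (φ k) x - w.2 x) 1 (vol (halfSpace d)))
      atTop (𝓝 0)}
  zero_mem' := by
    refine ⟨fun _ _ => 0, fun k => ⟨contDiff_const, HasCompactSupport.zero⟩, ?_, ?_⟩
    · intro K _ hKs
      refine tendsto_const_nhds.congr fun k => ?_
      rw [eLpNorm_congr_ae (g := fun _ => (0 : ℝ))]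
      · simp
      · filter_upwards [ae_mono (Measure.restrict_mono hKs le_rfl)
          (AEEqFun.coeFn_zero (α := Euc (d + 1)) (β := ℝ) (μ := vol (halfSpace d)))] with x hx
        simp only [Prod.fst_zero, hx, Pi.zero_apply, sub_zero]
    · refine tendsto_const_nhds.congr fun k => ?_
      rw [eLpNorm_congr_ae (g := fun _ => (0 : Euc (d + 1)))]
      · simp
      · filter_upwards [Lp.coeFn_zero (Euc (d + 1)) 1 (vol (halfSpace d))] with x hx
        have h0 : gradient (fun _ : Euc (d + 1) => (0 : ℝ)) x = 0 := by simp [gradient]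
        rw [Prod.snd_zero, hx, h0, Pi.zero_apply, sub_zero]
  add_mem' := by
    rintro a b ⟨φ, hφ, hφ1, hφ2⟩ ⟨χ, hχ, hχ1, hχ2⟩
    refine ⟨fun k x => φ k x + χ k x,
      fun k => ⟨(hφ k).1.add (hχ k).1, (hφ k).2.add (hχ k).2⟩, ?_, ?_⟩
    · intro K hK hKs
      have hm := Measure.restrict_mono hKs (le_refl (volume : Measure (Euc (d + 1))))
      have h := (hφ1 K hK hKs).add (hχ1 K hK hKs)
      rw [add_zero] at h
      refine tendsto_of_tendsto_of_tendsto_of_le_of_le tendsto_const_nhds h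
        (fun _ => bot_le) fun k => ?_
      have hle := eLpNorm_add_le (μ := vol K) (p := 1)
        (f := fun x => φ k x - a.1 x) (g := fun x => χ k x - b.1 x)
        ((hφ k).1.continuous.aestronglyMeasurable.sub (a.1.aestronglyMeasurable.mono_measure hm))
        ((hχ k).1.continuous.aestronglyMeasurable.sub (b.1.aestronglyMeasurable.mono_measure hm))
        le_rfl
      refine le_trans (le_of_eq (eLpNorm_congr_ae ?_)) hle
      filter_upwards [ae_mono hm (AEEqFun.coeFn_add a.1 b.1)] with x hx
      simp only [Prod.fst_add, hx, Pi.add_apply]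
      ring
    · have h := hφ2.add hχ2
      rw [add_zero] at h
      refine tendsto_of_tendsto_of_tendsto_of_le_of_le tendsto_const_nhds h
        (fun _ => bot_le) fun k => ?_
      have hle := eLpNorm_add_le (μ := vol (halfSpace d)) (p := 1)
        (f := fun x => gradient (φ k) x - a.2 x) (g := fun x => gradient (χ k) x - b.2 x)
        ((hφ k).continuous_gradient.aestronglyMeasurable.sub (Lp.aestronglyMeasurable a.2))
        ((hχ k).continuous_gradient.aestronglyMeasurable.sub (Lp.aestronglyMeasurable b.2))
        le_rfl
      refine le_trans (le_of_eq (eLpNorm_congr_ae ?_)) hle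
      filter_upwards [Lp.coeFn_add a.2 b.2] with x hx
      have hg : gradient (fun x => φ k x + χ k x) x = gradient (φ k) x + gradient (χ k) x := by
        have e1 := ((hφ k).1.differentiable (by simp)) x
        have e2 := ((hχ k).1.differentiable (by simp)) x
        simp only [gradient]
        rw [fderiv_fun_add e1 e2, map_add]
      simp only [Prod.snd_add, hx, hg, Pi.add_apply]
      abel
  smul_mem' := by
    rintro c a ⟨φ, hφ, hφ1, hφ2⟩
    refine ⟨fun k x => c • φ k x,
      fun k => ⟨(hφ k).1.const_smul c, (hφ k).2.smul_left (f := fun _ => c)⟩, ?_, ?_⟩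
    · intro K hK hKs
      have hm := Measure.restrict_mono hKs (le_refl (volume : Measure (Euc (d + 1))))
      have h := ENNReal.Tendsto.const_mul (a := ‖c‖ₑ) (hφ1 K hK hKs) (Or.inr (by simp))
      rw [mul_zero] at h
      refine h.congr fun k => ?_
      rw [← eLpNorm_const_smul]
      refine eLpNorm_congr_ae ?_
      filter_upwards [ae_mono hm (AEEqFun.coeFn_smul c a.1)] with x hx
      simp only [Prod.smul_fst, hx, Pi.smul_apply, smul_sub]
    · have h := ENNReal.Tendsto.const_mul (a := ‖c‖ₑ) hφ2 (Or.inr (by simp))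
      rw [mul_zero] at h
      refine h.congr fun k => ?_
      rw [← eLpNorm_const_smul]
      refine eLpNorm_congr_ae ?_
      filter_upwards [Lp.coeFn_smul c a.2] with x hx
      have hg : gradient (fun x => c • φ k x) x = c • gradient (φ k) x := by
        have e1 := ((hφ k).1.differentiable (by simp)) x
        simp only [gradient]
        rw [fderiv_fun_const_smul e1]
        simp
      simp only [Prod.smul_snd, hx, hg, Pi.smul_apply, smul_sub]

/-- The function underlying an element of `Ẇ^{1,1}(ℍ)`. -/
def homW11fun {d : ℕ} (w : HomW11 d) : Euc (d + 1) → ℝ := w.1.1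

/-- The weak gradient of an element of `Ẇ^{1,1}(ℍ)`. -/
def homW11grad {d : ℕ} (w : HomW11 d) : Lp (Euc (d + 1)) 1 (vol (halfSpace d)) :=
  w.1.2

/-- `γ` is the trace operator on `Ẇ^{1,1}(ℍ)`: it is linear and bounded into `L¹(ℝ^d)`, and `γ u`
is the `L¹(ℝ^d)`-limit of `φ k (·, 0)` whenever the `φ k` are `C_c^∞` functions on the closed
half-space with `∇ (φ k) → ∇ u` in `L¹(ℍ)`. -/
def IsHalfSpaceTraceOperator {d : ℕ}
    (γ : HomW11 d →ₗ[ℝ] Lp ℝ 1 (volume : Measure (Euc d))) : Prop :=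
  (∃ C : ℝ, ∀ w, ‖γ w‖ ≤ C * ‖homW11grad w‖) ∧
  ∀ (w : HomW11 d) (φ : ℕ → Euc (d + 1) → ℝ), (∀ k, IsSmoothCompact (φ k)) →
    Tendsto (fun k => eLpNorm (fun x => gradient (φ k) x - homW11grad w x) 1 (vol (halfSpace d)))
      atTop (𝓝 0) →
    Tendsto (fun k => eLpNorm (fun x' => φ k (withLast x' 0) - γ w x') 1 volume) atTop (𝓝 0)

/-- The set `γ((Ẇ^{1,1} ∩ L^q)(ℍ))`, as a set of functions on `ℝ^d` closed under a.e. equality. -/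
def halfSpaceTraceSpace {d : ℕ} (γ : HomW11 d →ₗ[ℝ] Lp ℝ 1 (volume : Measure (Euc d)))
    (q : ℝ≥0∞) : Set (Euc d → ℝ) :=
  {f | ∃ w : HomW11 d, MemLp (homW11fun w) q (vol (halfSpace d)) ∧ γ w =ᵐ[volume] f}

end TraceL1

end

/-! The main point is the construction of extensions. An integrable f on the boundary is written as
a telescoping series of smooth functions h_k with summable L¹ norms, and each h_k is multiplied by a
cutoff equal to 1 on the boundary and supported in a layer of thickness ε_k. Integrating h over a
layer of thickness ε costs about ε times its boundary integral, while the cutoff has gradient of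
order 1/ε. Hence the gradient of the k-th term has L¹ norm at most C‖h_k‖ plus an error as small as
desired, and its L^q norm, q finite, tends to 0 as the layer shrinks. With ε_k small enough the
series converges in W^{1,1} and in L^q, and its trace telescopes to f; see
`HasLayerBound.exists_extension`. If f is bounded, its smooth approximants can be given a common
bound. Since the cutoffs decrease with k, Abel summation (`abs_sum_mul_sub_le`) gives that same
bound for all partial sums, so the series is bounded too. The geometry of the boundary enters
through `HasLayerBound` and `HasDenseRestrictions`, which are verified separately for the half-space
and for Lipschitz domains.

The trace operators come from the fundamental theorem of calculus along segments leaving the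
boundary, which yields a trace inequality for smooth functions, followed by extension by continuity.
In the half-space the gradient alone controls the trace, so the operator is defined on the closure
of the space of gradients. In a Lipschitz domain the inequality is proved in charts and summed by
compactness. Density of smooth functions comes from mollifying with kernels displaced so that values
on the closure of Ω are computed from points inside Ω (`exists_local_approx`). These approximants
keep sup bounds, and converge uniformly when the function is continuous up to the boundary, which
identifies its trace.

Traces of bounded functions are bounded. In the half-space, the trace over a set D is compared with
an average over a thin slab above D, with an error given by the gradient in a shrinking strip. In a
domain, the uniformly bounded approximants do it. The surface measure is handled without an area
formula, by comparing Hausdorff and Lebesgue measure through Lipschitz maps in both directions. -/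

namespace TraceL1

variable {d : ℕ}

/-! ### Splitting coordinates, graph coordinates and surface measure -/

lemma withLast_last (x : Euc d) (t : ℝ) : withLast x t (Fin.last d) = t := by
  simp [withLast]

lemma firstCoords_withLast (x : Euc d) (t : ℝ) : firstCoords (withLast x t) = x := by
  ext i
  simp [firstCoords, withLast]

lemma withLast_firstCoords (y : Euc (d + 1)) :
    withLast (firstCoords y) (y (Fin.last d)) = y := by
  ext i
  refine Fin.lastCases ?_ (fun j => ?_) i
  · simp [withLast]
  · simp [withLast, firstCoords]

lemma withLast_add (x y : Euc d) (s t : ℝ) :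
    withLast (x + y) (s + t) = withLast x s + withLast y t := by
  ext i
  refine Fin.lastCases ?_ (fun j => ?_) i <;> simp [withLast]

lemma withLast_sub (x y : Euc d) (s t : ℝ) :
    withLast (x - y) (s - t) = withLast x s - withLast y t := by
  ext i
  refine Fin.lastCases ?_ (fun j => ?_) i <;> simp [withLast]

lemma withLast_smul (c : ℝ) (x : Euc d) (t : ℝ) :
    withLast (c • x) (c * t) = c • withLast x t := by
  ext i
  refine Fin.lastCases ?_ (fun j => ?_) i <;> simp [withLast]

lemma norm_withLast_sq (x : Euc d) (t : ℝ) : ‖withLast x t‖ ^ 2 = ‖x‖ ^ 2 + t ^ 2 := by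
  rw [EuclideanSpace.norm_sq_eq, EuclideanSpace.norm_sq_eq, Fin.sum_univ_castSucc]
  simp [withLast]

lemma norm_withLast_le (x : Euc d) (t : ℝ) : ‖withLast x t‖ ≤ ‖x‖ + |t| := by
  refine abs_le_of_sq_le_sq' ?_ (by positivity) |>.2
  rw [norm_withLast_sq]
  nlinarith [norm_nonneg x, abs_nonneg t, sq_abs t, mul_nonneg (norm_nonneg x) (abs_nonneg t)]

lemma norm_firstCoords_le (y : Euc (d + 1)) : ‖firstCoords y‖ ≤ ‖y‖ := by
  refine abs_le_of_sq_le_sq' ?_ (by positivity) |>.2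
  conv_rhs => rw [← withLast_firstCoords y, norm_withLast_sq]
  nlinarith [sq_nonneg (y (Fin.last d))]

lemma abs_last_le (y : Euc (d + 1)) : |y (Fin.last d)| ≤ ‖y‖ := by
  refine abs_le_of_sq_le_sq' ?_ (by positivity) |>.2
  conv_rhs => rw [← withLast_firstCoords y, norm_withLast_sq]
  nlinarith [sq_nonneg ‖firstCoords y‖, sq_abs (y (Fin.last d))]

lemma firstCoords_sub (x y : Euc (d + 1)) : firstCoords (x - y) = firstCoords x - firstCoords y := by
  ext i
  simp [firstCoords]

lemma lipschitzWith_firstCoords : LipschitzWith 1 (firstCoords : Euc (d + 1) → Euc d) :=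
  LipschitzWith.of_dist_le_mul fun x y => by
    rw [dist_eq_norm, dist_eq_norm, ← firstCoords_sub, NNReal.coe_one, one_mul]
    exact norm_firstCoords_le _

lemma measurePreserving_withLast :
    MeasurePreserving (fun z : Euc d × ℝ => withLast z.1 z.2) := by
  have h1 : MeasurePreserving (fun z : Euc d × ℝ => ((WithLp.ofLp z.1 : Fin d → ℝ), z.2))
      (volume.prod volume) (volume.prod volume) :=
    (PiLp.volume_preserving_ofLp (Fin d)).prod (MeasurePreserving.id _)
  have h2 : MeasurePreserving (Prod.swap : (Fin d → ℝ) × ℝ → ℝ × (Fin d → ℝ))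
      (volume.prod volume) (volume.prod volume) := Measure.measurePreserving_swap
  have h3 := (volume_preserving_piFinSuccAbove (fun _ : Fin (d + 1) => ℝ) (Fin.last d)).symm
  have h4 := PiLp.volume_preserving_toLp (Fin (d + 1))
  convert! h4.comp (h3.comp (h2.comp h1)) using 1
  funext z
  simp only [withLast, Function.comp_apply, Prod.swap_prod_mk]
  congr 1
  symm
  exact Fin.insertNth_last' z.2 (WithLp.ofLp z.1)

/-- The coordinates `(x', t) ↦ e⁻¹ (x', ψ x' + t)` adapted to the graph of `ψ`. -/
noncomputable def graphMap (e : Euc (d + 1) ≃ₗᵢ[ℝ] Euc (d + 1)) (ψ : Euc d → ℝ) (x : Euc d) (t : ℝ) :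
    Euc (d + 1) :=
  e.symm (withLast x (ψ x + t))

/-- The direction `e⁻¹ e_{d+1}` in which `graphMap` moves as its last argument grows. -/
noncomputable def upDir (e : Euc (d + 1) ≃ₗᵢ[ℝ] Euc (d + 1)) : Euc (d + 1) :=
  e.symm (withLast 0 1)

section Graph

variable (e : Euc (d + 1) ≃ₗᵢ[ℝ] Euc (d + 1)) (ψ : Euc d → ℝ)

lemma norm_upDir : ‖upDir e‖ = 1 := by
  have h := norm_withLast_sq (0 : Euc d) 1
  rw [upDir, LinearIsometryEquiv.norm_map]
  simp only [norm_zero] at h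
  nlinarith [norm_nonneg (withLast (0 : Euc d) 1)]

lemma graphMap_eq (x : Euc d) (t : ℝ) : graphMap e ψ x t = graphMap e ψ x 0 + t • upDir e := by
  rw [graphMap, graphMap, upDir, ← map_smul, ← map_add, ← withLast_smul, ← withLast_add]
  simp

lemma graphMap_surj (y : Euc (d + 1)) :
    graphMap e ψ (firstCoords (e y)) (e y (Fin.last d) - ψ (firstCoords (e y))) = y := by
  rw [graphMap, add_sub_cancel, withLast_firstCoords, LinearIsometryEquiv.symm_apply_apply]

lemma firstCoords_graphMap (x : Euc d) (t : ℝ) : firstCoords (e (graphMap e ψ x t)) = x := by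
  rw [graphMap, LinearIsometryEquiv.apply_symm_apply, firstCoords_withLast]

lemma last_graphMap (x : Euc d) (t : ℝ) : e (graphMap e ψ x t) (Fin.last d) = ψ x + t := by
  rw [graphMap, LinearIsometryEquiv.apply_symm_apply, withLast_last]

variable {ψ}

/-- The shear (x, t) ↦ (x, ψ x + t) translates every fibre, and the remaining maps are a regrouping
of coordinates and an isometry. So no Jacobian appears, and continuity of ψ is enough to use Fubini
in graph coordinates. -/
lemma measurePreserving_graphMap (hψ : Continuous ψ) :
    MeasurePreserving (fun z : Euc d × ℝ => graphMap e ψ z.1 z.2) := by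
  have h1 : MeasurePreserving (fun z : Euc d × ℝ => (z.1, ψ z.1 + z.2))
      (volume.prod volume) (volume.prod volume) := by
    refine MeasurePreserving.skew_product (g := fun x t => ψ x + t) (MeasurePreserving.id _) ?_ ?_
    · exact ((hψ.measurable.comp measurable_fst).add measurable_snd)
    · exact Eventually.of_forall fun x => (measurePreserving_add_left volume (ψ x)).map_eq
  exact (e.symm.measurePreserving).comp (measurePreserving_withLast.comp h1)

lemma lipschitzWith_graphMap_zero {K : ℝ≥0} (hψ : LipschitzWith K ψ) :
    LipschitzWith (1 + K) (fun x => graphMap e ψ x 0) :=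
  LipschitzWith.of_dist_le_mul fun x y => by
    rw [graphMap, graphMap, LinearIsometryEquiv.dist_map, dist_eq_norm, ← withLast_sub]
    refine (norm_withLast_le _ _).trans ?_
    have := hψ.dist_le_mul x y
    rw [Real.dist_eq] at this
    rw [← dist_eq_norm, NNReal.coe_add, NNReal.coe_one, add_mul, one_mul]
    simpa using this

/-- Projecting to the first coordinates is 1-Lipschitz and undoes the parametrization of the graph.
Together with the reverse bound through the Lipschitz parametrization, this replaces the area
formula. -/
lemma volume_preimage_graphMap_le (ψ : Euc d → ℝ) (S : Set (Euc (d + 1))) :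
    volume ((fun x => graphMap e ψ x 0) ⁻¹' S) ≤ Measure.euclideanHausdorffMeasure d S := by
  have hl : LipschitzWith 1 (fun y => firstCoords (e y)) := by
    have := lipschitzWith_firstCoords.comp e.isometry.lipschitz
    rwa [one_mul] at this
  have hsub : (fun x => graphMap e ψ x 0) ⁻¹' S ⊆ (fun y => firstCoords (e y)) '' S :=
    fun x hx => ⟨_, hx, firstCoords_graphMap e ψ x 0⟩
  have h := hl.hausdorffMeasure_image_le (d := d) (by positivity) S
  rw [← EuclideanSpace.euclideanHausdorffMeasure_eq_volume]
  refine (measure_mono hsub).trans ?_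
  simp only [Measure.euclideanHausdorffMeasure_def, Measure.smul_apply]
  simp only [ENNReal.coe_one, ENNReal.one_rpow, one_mul] at h
  gcongr

/-- The parametrization x ↦ (x, ψ x) is (1 + K)-Lipschitz, and d-dimensional Hausdorff measure
scales by the d-th power of the Lipschitz constant. -/
lemma euclideanHausdorffMeasure_le_volume_preimage {K : ℝ≥0} (hψ : LipschitzWith K ψ)
    {S : Set (Euc (d + 1))} (hS : S ⊆ range fun x => graphMap e ψ x 0) :
    Measure.euclideanHausdorffMeasure d S ≤
      ((1 + K : ℝ≥0) : ℝ≥0∞) ^ d * volume ((fun x => graphMap e ψ x 0) ⁻¹' S) := by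
  have h := (lipschitzWith_graphMap_zero e hψ).hausdorffMeasure_image_le (d := d) (by positivity)
    ((fun x => graphMap e ψ x 0) ⁻¹' S)
  rw [image_preimage_eq_of_subset hS, ENNReal.rpow_natCast] at h
  rw [← EuclideanSpace.euclideanHausdorffMeasure_eq_volume]
  simp only [Measure.euclideanHausdorffMeasure_def, Measure.smul_apply]
  rw [mul_smul_comm]
  gcongr

lemma continuous_graphMap (hψ : Continuous ψ) : Continuous fun z : Euc d × ℝ => graphMap e ψ z.1 z.2 := by
  have h : Continuous fun z : Euc d × ℝ => withLast z.1 z.2 := by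
    unfold withLast
    refine (PiLp.continuous_toLp 2 _).comp (continuous_pi fun i => ?_)
    refine Fin.lastCases ?_ (fun j => ?_) i
    · simpa using continuous_snd
    · simp only [Fin.snoc_castSucc]
      fun_prop
  exact e.symm.continuous.comp
    (h.comp (continuous_fst.prodMk ((hψ.comp continuous_fst).add continuous_snd)))

lemma lintegral_graphMap_zero_le (hψ : Continuous ψ) {D : Set (Euc d)}
    {T : Set (Euc (d + 1))} (hDT : MapsTo (fun x => graphMap e ψ x 0) D T)
    {F : Euc (d + 1) → ℝ≥0∞} (hF : Measurable F) :
    ∫⁻ x in D, F (graphMap e ψ x 0) ≤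
      ∫⁻ y, F y ∂((Measure.euclideanHausdorffMeasure d).restrict T) := by
  have hm : Measurable fun x => graphMap e ψ x 0 :=
    ((continuous_graphMap e hψ).comp (continuous_id.prodMk continuous_const)).measurable
  rw [← lintegral_map hF hm]
  refine lintegral_mono' (Measure.le_iff.2 fun S hS => ?_) le_rfl
  rw [Measure.map_apply hm hS, Measure.restrict_apply (hm hS), Measure.restrict_apply hS]
  refine (measure_mono ?_).trans (volume_preimage_graphMap_le e ψ (S ∩ T))
  exact fun x hx => ⟨hx.1, hDT hx.2⟩

lemma lintegral_le_lintegral_graphMap_zero {K : ℝ≥0} (hψ : LipschitzWith K ψ) {D : Set (Euc d)}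
    {T : Set (Euc (d + 1))} (hT : T ⊆ range fun x => graphMap e ψ x 0)
    (hTD : (fun x => graphMap e ψ x 0) ⁻¹' T ⊆ D)
    {F : Euc (d + 1) → ℝ≥0∞} (hF : Measurable F) :
    ∫⁻ y, F y ∂((Measure.euclideanHausdorffMeasure d).restrict T) ≤
      ((1 + K : ℝ≥0) : ℝ≥0∞) ^ d * ∫⁻ x in D, F (graphMap e ψ x 0) := by
  have hm : Measurable fun x => graphMap e ψ x 0 :=
    (lipschitzWith_graphMap_zero e hψ).continuous.measurable
  rw [← lintegral_map hF hm, ← smul_eq_mul, ← lintegral_smul_measure]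
  refine lintegral_mono' (Measure.le_iff.2 fun S hS => ?_) le_rfl
  rw [Measure.smul_apply, Measure.map_apply hm hS, Measure.restrict_apply (hm hS),
    Measure.restrict_apply hS]
  refine (euclideanHausdorffMeasure_le_volume_preimage e hψ (inter_subset_right.trans hT)).trans ?_
  rw [smul_eq_mul]
  gcongr
  exact fun x hx => ⟨hx.1, hTD hx.2⟩

end Graph

/-! ### Integration along segments: the trace inequality and thin layers -/

lemma enorm_gradient {n : ℕ} (φ : Euc n → ℝ) (x : Euc n) : ‖gradient φ x‖ₑ = ‖fderiv ℝ φ x‖ₑ := by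
  rw [← toDual_gradient, LinearIsometryEquiv.enorm_map]

lemma norm_gradient {n : ℕ} (φ : Euc n → ℝ) (x : Euc n) : ‖gradient φ x‖ = ‖fderiv ℝ φ x‖ := by
  rw [← toDual_gradient, LinearIsometryEquiv.norm_map]

/-- The value of a `C¹` function at `p` is controlled by its mean over a segment
`p + (a, b] v` and by its gradient along `p + (0, b] v`. -/
lemma IsSmoothCompact.enorm_le_lintegral_segment {n : ℕ} {φ : Euc n → ℝ} (hφ : IsSmoothCompact φ)
    (p : Euc n) {v : Euc n} (hv : ‖v‖ = 1) {a b : ℝ} (ha : 0 ≤ a) :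
    ENNReal.ofReal (b - a) * ‖φ p‖ₑ ≤ (∫⁻ t in Ioc a b, ‖φ (p + t • v)‖ₑ) +
      ENNReal.ofReal (b - a) * ∫⁻ t in Ioc 0 b, ‖gradient φ (p + t • v)‖ₑ := by
  have hl : ∀ t : ℝ, HasDerivAt (fun t : ℝ => p + t • v) v t := fun t => by
    simpa using ((hasDerivAt_id t).smul_const v).const_add p
  have hder : ∀ t : ℝ, HasDerivAt (fun t : ℝ => φ (p + t • v)) (fderiv ℝ φ (p + t • v) v) t :=
    fun t => ((hφ.1.differentiable (by simp)) _).hasFDerivAt.comp_hasDerivAt t (hl t)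
  have hcont : Continuous fun t : ℝ => fderiv ℝ φ (p + t • v) v := by
    have := hφ.1.continuous_fderiv (by simp)
    fun_prop
  set I := ∫⁻ t in Ioc 0 b, ‖gradient φ (p + t • v)‖ₑ with hI
  have key : ∀ t ∈ Ioc a b, ‖φ p‖ₑ ≤ ‖φ (p + t • v)‖ₑ + I := by
    intro t ht
    have h1 := intervalIntegral.integral_eq_sub_of_hasDerivAt (a := 0) (b := t)
      (fun s _ => hder s) (hcont.intervalIntegrable _ _)
    have h2 : φ p = φ (p + t • v) - ∫ s in (0 : ℝ)..t, fderiv ℝ φ (p + s • v) v := by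
      rw [h1]; simp
    rw [h2]
    refine (enorm_sub_le).trans (add_le_add le_rfl ?_)
    rw [intervalIntegral.integral_of_le (ha.trans ht.1.le)]
    refine (enorm_integral_le_lintegral_enorm _).trans ?_
    refine (lintegral_mono_set (Ioc_subset_Ioc_right ht.2)).trans (lintegral_mono fun s => ?_)
    rw [enorm_gradient]
    have := (fderiv ℝ φ (p + s • v)).le_opNorm v
    rw [hv, mul_one] at this
    exact enorm_le_iff_norm_le.2 this
  have h3 : ∫⁻ t in Ioc a b, ‖φ p‖ₑ ≤ ∫⁻ t in Ioc a b, (‖φ (p + t • v)‖ₑ + I) :=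
    setLIntegral_mono' measurableSet_Ioc key
  rw [lintegral_add_right _ measurable_const] at h3
  simpa [Real.volume_Ioc, mul_comm] using h3

/-- Trace inequality in graph coordinates. -/
lemma IsSmoothCompact.lintegral_graphMap_zero_le {φ : Euc (d + 1) → ℝ} (hφ : IsSmoothCompact φ)
    (e : Euc (d + 1) ≃ₗᵢ[ℝ] Euc (d + 1)) {ψ : Euc d → ℝ} (hψ : Continuous ψ)
    {D : Set (Euc d)} {a b : ℝ} (ha : 0 ≤ a)
    {A₁ A₂ : Set (Euc (d + 1))} (hA₁ : MeasurableSet A₁) (hA₂ : MeasurableSet A₂)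
    (h₁ : ∀ x ∈ D, ∀ t ∈ Ioc a b, graphMap e ψ x t ∈ A₁)
    (h₂ : ∀ x ∈ D, ∀ t ∈ Ioc 0 b, graphMap e ψ x t ∈ A₂) :
    ENNReal.ofReal (b - a) * ∫⁻ x in D, ‖φ (graphMap e ψ x 0)‖ₑ ≤
      (∫⁻ y in A₁, ‖φ y‖ₑ) + ENNReal.ofReal (b - a) * ∫⁻ y in A₂, ‖gradient φ y‖ₑ := by
  have hc := continuous_graphMap e hψ
  have hmp := measurePreserving_graphMap e hψ
  have hφm : Measurable fun y => ‖φ y‖ₑ := hφ.1.continuous.measurable.enorm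
  have hgm : Measurable fun y => ‖gradient φ y‖ₑ := hφ.continuous_gradient.measurable.enorm
  -- Fubini in graph coordinates. Only an inequality is needed: the product of D and I lies in the
  -- preimage of A, so D may be an arbitrary set.
  have fub : ∀ {F : Euc (d + 1) → ℝ≥0∞} {A : Set (Euc (d + 1))} {I : Set ℝ}, Measurable F →
      MeasurableSet A → (∀ x ∈ D, ∀ t ∈ I, graphMap e ψ x t ∈ A) →
      ∫⁻ x in D, ∫⁻ t in I, F (graphMap e ψ x t) ≤ ∫⁻ y in A, F y := by
    intro F A I hF hA h
    rw [← hmp.setLIntegral_comp_preimage hA hF]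
    have hFm : Measurable fun z : Euc d × ℝ => F (graphMap e ψ z.1 z.2) := hF.comp hc.measurable
    have := lintegral_prod (μ := volume.restrict D) (ν := volume.restrict I) _ hFm.aemeasurable
    rw [← this, Measure.prod_restrict]
    exact lintegral_mono_set fun z hz => h _ hz.1 _ hz.2
  have hpt : ∀ x, ENNReal.ofReal (b - a) * ‖φ (graphMap e ψ x 0)‖ₑ ≤
      (∫⁻ t in Ioc a b, ‖φ (graphMap e ψ x t)‖ₑ) +
        ENNReal.ofReal (b - a) * ∫⁻ t in Ioc 0 b, ‖gradient φ (graphMap e ψ x t)‖ₑ := by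
    intro x
    have := hφ.enorm_le_lintegral_segment (b := b) (graphMap e ψ x 0) (norm_upDir e) ha
    simpa only [← graphMap_eq] using this
  have m1 : Measurable fun z : Euc d × ℝ => ‖φ (graphMap e ψ z.1 z.2)‖ₑ := hφm.comp hc.measurable
  rw [← lintegral_const_mul' _ _ ENNReal.ofReal_ne_top]
  refine (lintegral_mono hpt).trans ?_
  rw [lintegral_add_left (m1.lintegral_prod_right'), lintegral_const_mul' _ _ ENNReal.ofReal_ne_top]
  gcongr
  · exact fub hφm hA₁ h₁
  · exact fub hgm hA₂ h₂

/-- The integral of a function over a set lying in a thin layer above the graph is controlled by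
the integral over the graph. -/
lemma setLIntegral_le_of_layer (e : Euc (d + 1) ≃ₗᵢ[ℝ] Euc (d + 1)) {ψ : Euc d → ℝ}
    (hψ : Continuous ψ) {D : Set (Euc d)} (hD : MeasurableSet D) {L : ℝ}
    {A : Set (Euc (d + 1))} (hA : MeasurableSet A)
    (hAD : ∀ x t, graphMap e ψ x t ∈ A → x ∈ D ∧ t ∈ Ioc 0 L)
    {F : Euc (d + 1) → ℝ≥0∞} (hF : Measurable F) {τ : ℝ≥0∞}
    (hτ : ∀ x ∈ D, ∀ t ∈ Ioc 0 L, F (graphMap e ψ x t) ≤ F (graphMap e ψ x 0) + τ) :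
    ∫⁻ y in A, F y ≤ ENNReal.ofReal L * ((∫⁻ x in D, F (graphMap e ψ x 0)) + τ * volume D) := by
  have hc := continuous_graphMap e hψ
  have hFm : Measurable fun z : Euc d × ℝ => F (graphMap e ψ z.1 z.2) := hF.comp hc.measurable
  rw [← (measurePreserving_graphMap e hψ).setLIntegral_comp_preimage hA hF]
  calc ∫⁻ z in (fun z : Euc d × ℝ => graphMap e ψ z.1 z.2) ⁻¹' A, F (graphMap e ψ z.1 z.2)
      ≤ ∫⁻ z in D ×ˢ Ioc 0 L, F (graphMap e ψ z.1 z.2) :=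
        lintegral_mono_set fun z hz => hAD _ _ hz
    _ = ∫⁻ x in D, ∫⁻ t in Ioc 0 L, F (graphMap e ψ x t) := by
        have := lintegral_prod (μ := volume.restrict D) (ν := volume.restrict (Ioc 0 L)) _
          hFm.aemeasurable
        rw [← this, Measure.prod_restrict]; rfl
    _ ≤ ∫⁻ x in D, ENNReal.ofReal L * (F (graphMap e ψ x 0) + τ) := by
        refine setLIntegral_mono' hD fun x hx => ?_
        refine (setLIntegral_mono' measurableSet_Ioc (hτ x hx)).trans ?_
        simp [Real.volume_Ioc, mul_comm]
    _ = _ := by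
        rw [lintegral_const_mul' _ _ ENNReal.ofReal_ne_top, lintegral_add_right _ measurable_const]
        simp

end TraceL1

/-! ### Smooth compactly supported functions and cutoffs -/

namespace TraceL1

section SmoothCompact

variable {n : ℕ} {φ χ : Euc n → ℝ}

lemma IsSmoothCompact.zero : IsSmoothCompact (fun _ : Euc n => (0 : ℝ)) :=
  ⟨contDiff_const, HasCompactSupport.zero⟩

lemma IsSmoothCompact.add (hφ : IsSmoothCompact φ) (hχ : IsSmoothCompact χ) :
    IsSmoothCompact (φ + χ) :=
  ⟨hφ.1.add hχ.1, hφ.2.add hχ.2⟩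

lemma IsSmoothCompact.const_smul (hφ : IsSmoothCompact φ) (c : ℝ) : IsSmoothCompact (c • φ) :=
  ⟨hφ.1.const_smul c, hφ.2.smul_left (f := fun _ => c)⟩

lemma IsSmoothCompact.sub (hφ : IsSmoothCompact φ) (hχ : IsSmoothCompact χ) :
    IsSmoothCompact (φ - χ) :=
  ⟨hφ.1.sub hχ.1, hφ.2.sub hχ.2⟩

lemma IsSmoothCompact.mul_left (hφ : IsSmoothCompact φ) (hχ : ContDiff ℝ ∞ χ) :
    IsSmoothCompact (χ * φ) :=
  ⟨hχ.mul hφ.1, hφ.2.mul_left⟩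

lemma IsSmoothCompact.sum {ι : Type*} {s : Finset ι} {φ : ι → Euc n → ℝ}
    (hφ : ∀ i ∈ s, IsSmoothCompact (φ i)) : IsSmoothCompact (∑ i ∈ s, φ i) := by
  classical
  induction s using Finset.induction_on with
  | empty => exact IsSmoothCompact.zero
  | insert a s ha ih =>
    rw [Finset.sum_insert ha]
    exact (hφ a (by simp)).add (ih fun i hi => hφ i (by simp [hi]))

lemma IsSmoothCompact.differentiable (hφ : IsSmoothCompact φ) : Differentiable ℝ φ :=
  hφ.1.differentiable (by simp)

lemma IsSmoothCompact.hasCompactSupport_gradient (hφ : IsSmoothCompact φ) :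
    HasCompactSupport (gradient φ) :=
  (hφ.2.fderiv (𝕜 := ℝ)).comp_left (g := (InnerProductSpace.toDual ℝ (Euc n)).symm) (map_zero _)

lemma IsSmoothCompact.memLp (hφ : IsSmoothCompact φ) (p : ℝ≥0∞) (μ : Measure (Euc n))
    [IsFiniteMeasureOnCompacts μ] : MemLp φ p μ :=
  hφ.1.continuous.memLp_of_hasCompactSupport hφ.2

lemma IsSmoothCompact.memLp_gradient (hφ : IsSmoothCompact φ) (p : ℝ≥0∞) (μ : Measure (Euc n))
    [IsFiniteMeasureOnCompacts μ] : MemLp (gradient φ) p μ :=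
  hφ.continuous_gradient.memLp_of_hasCompactSupport hφ.hasCompactSupport_gradient

lemma gradient_add (hφ : Differentiable ℝ φ) (hχ : Differentiable ℝ χ) (x : Euc n) :
    gradient (φ + χ) x = gradient φ x + gradient χ x := by
  simp only [gradient]
  rw [fderiv_add (hφ x) (hχ x), map_add]

lemma gradient_sub (hφ : Differentiable ℝ φ) (hχ : Differentiable ℝ χ) (x : Euc n) :
    gradient (φ - χ) x = gradient φ x - gradient χ x := by
  simp only [gradient]
  rw [fderiv_sub (hφ x) (hχ x), map_sub]

lemma gradient_const_smul (hφ : Differentiable ℝ φ) (c : ℝ) (x : Euc n) :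
    gradient (c • φ) x = c • gradient φ x := by
  simp only [gradient]
  rw [fderiv_const_smul (hφ x)]
  simp

lemma gradient_mul (hφ : Differentiable ℝ φ) (hχ : Differentiable ℝ χ) (x : Euc n) :
    gradient (φ * χ) x = φ x • gradient χ x + χ x • gradient φ x := by
  simp only [gradient]
  rw [fderiv_mul (hφ x) (hχ x)]
  simp

end SmoothCompact

/-- A piecewise linear function of the distance to F is smoothed by convolution, which preserves its
Lipschitz constant. The ratio 5 between the two distances makes cutoffs at the scales 5⁻ʲ nested. -/
lemma exists_cutoff {n : ℕ} (F : Set (Euc n)) {ε : ℝ} (hε : 0 < ε) :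
    ∃ η : Euc n → ℝ, ContDiff ℝ ∞ η ∧ (∀ x, 0 ≤ η x) ∧ (∀ x, η x ≤ 1) ∧
      (∀ x, Metric.infDist x F ≤ ε / 5 → η x = 1) ∧ (∀ x, ε ≤ Metric.infDist x F → η x = 0) ∧
      ∀ x, ‖gradient η x‖ ≤ 5 / ε := by
  -- The profile is 1 up to distance 2ε/5 and 0 from distance 4ε/5 on, with slope 5/(2ε) in between.
  -- The convolution kernel has radius ε/5, so the result is 1 up to ε/5 and 0 from ε on.
  set h : Euc n → ℝ := fun x => max (min (2 - 5 * Metric.infDist x F / (2 * ε)) 1) 0 with hh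
  have hlip : ∀ x y, |h x - h y| ≤ 5 / ε * dist x y := by
    intro x y
    have h1 : |Metric.infDist x F - Metric.infDist y F| ≤ dist x y := by
      have := (Metric.lipschitz_infDist_pt F).dist_le_mul x y
      rwa [NNReal.coe_one, one_mul, Real.dist_eq] at this
    have h2 : |h x - h y| ≤ |(2 - 5 * Metric.infDist x F / (2 * ε)) -
        (2 - 5 * Metric.infDist y F / (2 * ε))| :=
      (abs_max_sub_max_le_abs _ _ 0).trans ((abs_min_sub_min_le_max _ 1 _ 1).trans_eq
        (by rw [sub_self, abs_zero, max_eq_left (abs_nonneg _)]))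
    refine h2.trans ?_
    have : (2 - 5 * Metric.infDist x F / (2 * ε)) - (2 - 5 * Metric.infDist y F / (2 * ε)) =
        5 / (2 * ε) * -(Metric.infDist x F - Metric.infDist y F) := by ring
    rw [this, abs_mul, abs_neg, abs_of_pos (by positivity : 0 < 5 / (2 * ε))]
    calc _ ≤ 5 / (2 * ε) * dist x y := by gcongr
      _ ≤ _ := by
        gcongr
        linarith
  have hcont : Continuous h := by
    have := Metric.continuous_infDist_pt F
    fun_prop
  have h0 : ∀ x, 0 ≤ h x := fun x => le_max_right _ _
  have h1 : ∀ x, h x ≤ 1 := fun x => max_le (min_le_right _ _) zero_le_one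
  let ρ : ContDiffBump (0 : Euc n) := ⟨ε / 10, ε / 5, by positivity, by linarith⟩
  set k := ρ.normed volume with hk
  have hk0 : ∀ x, 0 ≤ k x := fun x => ρ.nonneg_normed x
  have hkint : Integrable k := ρ.integrable_normed
  have hk1 : ∫ x, k x = 1 := ρ.integral_normed
  set η := MeasureTheory.convolution k h (ContinuousLinearMap.lsmul ℝ ℝ) volume with hη
  have hint : ∀ x, Integrable (fun t => k t * h (x - t)) := fun x =>
    hkint.mul_bdd (c := 1) (hcont.comp (continuous_const.sub continuous_id)).aestronglyMeasurable
      (Eventually.of_forall fun t => by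
        rw [Real.norm_eq_abs, abs_of_nonneg (h0 _)]; exact h1 _)
  have hηx : ∀ x, η x = ∫ t, k t * h (x - t) := fun x => rfl
  have hηlip : LipschitzWith (5 / ε).toNNReal η := by
    refine LipschitzWith.of_dist_le_mul fun x y => ?_
    rw [Real.dist_eq, hηx, hηx, ← integral_sub (hint x) (hint y),
      Real.coe_toNNReal _ (by positivity), ← Real.norm_eq_abs]
    have : 5 / ε * dist x y = ∫ t, k t * (5 / ε * dist x y) := by
      rw [integral_mul_const, hk1, one_mul]
    rw [this]
    refine norm_integral_le_of_norm_le (hkint.mul_const _) (Eventually.of_forall fun t => ?_)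
    rw [← mul_sub, norm_mul, Real.norm_of_nonneg (hk0 t), Real.norm_eq_abs]
    refine mul_le_mul_of_nonneg_left ?_ (hk0 t)
    simpa using hlip (x - t) (y - t)
  have hmem : ∀ x y, y ∈ Metric.ball x ρ.rOut →
      |Metric.infDist y F - Metric.infDist x F| < ε / 5 := by
    intro x y hy
    have := (Metric.lipschitz_infDist_pt F).dist_le_mul y x
    rw [NNReal.coe_one, one_mul, Real.dist_eq] at this
    exact this.trans_lt hy
  refine ⟨η, ?_, ?_, ?_, ?_, ?_, ?_⟩
  · exact ρ.hasCompactSupport_normed.contDiff_convolution_left _ (n := ⊤) ρ.contDiff_normed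
      hcont.locallyIntegrable
  · exact fun x => integral_nonneg fun t => mul_nonneg (hk0 t) (h0 _)
  · intro x
    rw [hηx, ← hk1]
    exact integral_mono (hint x) hkint fun t => mul_le_of_le_one_right (hk0 t) (h1 _)
  · intro x hx
    have hone : ∀ y, Metric.infDist y F ≤ 2 * ε / 5 → h y = 1 := by
      intro y hy
      have : 5 * Metric.infDist y F / (2 * ε) ≤ 1 := by
        rw [div_le_one (by positivity)]; linarith
      simp only [hh]
      rw [min_eq_right (by linarith), max_eq_left zero_le_one]
    rw [hη, ρ.normed_convolution_eq_right, hone x (by linarith)]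
    intro y hy
    have := abs_lt.1 (hmem x y hy)
    rw [hone x (by linarith), hone y (by linarith)]
  · intro x hx
    have hzero : ∀ y, 4 * ε / 5 ≤ Metric.infDist y F → h y = 0 := by
      intro y hy
      have : 2 ≤ 5 * Metric.infDist y F / (2 * ε) := by
        rw [le_div_iff₀ (by positivity)]; linarith
      simp only [hh]
      rw [max_eq_right]
      exact (min_le_left _ _).trans (by linarith)
    rw [hη, ρ.normed_convolution_eq_right, hzero x (by linarith)]
    intro y hy
    have := abs_lt.1 (hmem x y hy)
    rw [hzero x (by linarith), hzero y (by linarith)]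
  · intro x
    rw [norm_gradient]
    refine (norm_fderiv_le_of_lipschitz ℝ hηlip).trans ?_
    rw [Real.coe_toNNReal _ (by positivity)]

/-- A decreasing sequence of smooth functions equal to `1` near `F`, the `j`-th one supported in the
`5⁻ʲ`-neighbourhood of `F`. -/
lemma exists_cutoff_seq {n : ℕ} (F : Set (Euc n)) :
    ∃ η : ℕ → Euc n → ℝ, (∀ j, ContDiff ℝ ∞ (η j)) ∧ (∀ j x, 0 ≤ η j x) ∧ (∀ j x, η j x ≤ 1) ∧
      (∀ j, ∀ x ∈ F, η j x = 1) ∧ (∀ j x, (1 / 5 : ℝ) ^ j ≤ Metric.infDist x F → η j x = 0) ∧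
      (∀ j x, ‖gradient (η j) x‖ ≤ 5 / (1 / 5 : ℝ) ^ j) ∧
      (∀ j x, (1 / 5 : ℝ) ^ j ≤ Metric.infDist x F → gradient (η j) x = 0) ∧
      ∀ x, Antitone fun j => η j x := by
  choose η h1 h2 h3 h4 h5 h6 using fun j : ℕ =>
    exists_cutoff F (ε := (1 / 5 : ℝ) ^ j) (by positivity)
  refine ⟨η, h1, h2, h3, fun j x hx => h4 j x ?_, h5, h6, ?_, ?_⟩
  · rw [Metric.infDist_zero_of_mem hx]; positivity
  · intro j x hx
    -- The point may lie on the edge of the zero set, so local constancy is not available; but 0 is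
    -- the minimum of the cutoff, so the derivative vanishes wherever it is attained.
    have hmin : IsLocalMin (η j) x := Eventually.of_forall fun y => by
      rw [h5 j x hx]; exact h2 j y
    rw [gradient, hmin.fderiv_eq_zero, map_zero]
  · refine fun x => antitone_nat_of_succ_le fun j => ?_
    -- Up to distance 5⁻ʲ/5 the j-th cutoff is already 1; from that distance on the next one is 0,
    -- its own scale being 5⁻ʲ/5.
    rcases le_total (Metric.infDist x F) ((1 / 5 : ℝ) ^ j / 5) with h | h
    · rw [h4 j x h]; exact h3 _ _
    · rw [h5 (j + 1) x (by rw [pow_succ]; linarith)]; exact h2 _ _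

end TraceL1

/-! ### Extending boundary data by a series of cutoff functions -/

namespace TraceL1

/-- `L^p` bounds pass to `L¹` limits. -/
lemma eLpNorm_le_of_tendsto_eLpNorm_one {α E : Type*} [MeasurableSpace α] {μ : Measure α}
    [NormedAddCommGroup E] {f : ℕ → α → E} {g : α → E} (hf : ∀ k, AEStronglyMeasurable (f k) μ)
    (hg : AEStronglyMeasurable g μ)
    (h : Tendsto (fun k => eLpNorm (fun x => f k x - g x) 1 μ) atTop (𝓝 0))
    {p R : ℝ≥0∞} (hR : ∀ k, eLpNorm (f k) p μ ≤ R) : eLpNorm g p μ ≤ R := by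
  obtain ⟨ns, -, hns⟩ :=
    (tendstoInMeasure_of_tendsto_eLpNorm one_ne_zero hf hg h).exists_seq_tendsto_ae
  refine (Lp.eLpNorm_lim_le_liminf_eLpNorm (p := p) (fun k => hf (ns k)) g hns).trans ?_
  exact liminf_le_of_frequently_le' (Frequently.of_forall fun k => hR (ns k))

lemma exists_Lp_limit {α E : Type*} [MeasurableSpace α] {μ : Measure α}
    [NormedAddCommGroup E] [CompleteSpace E] {f : ℕ → α → E} (hf : ∀ k, MemLp (f k) 1 μ)
    {r : ℕ → ℝ≥0∞} (h : ∀ k, eLpNorm (f (k + 1) - f k) 1 μ ≤ r k) (hr : ∑' k, r k ≠ ⊤) :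
    ∃ g : Lp E 1 μ, Tendsto (fun k => eLpNorm (fun x => f k x - g x) 1 μ) atTop (𝓝 0) := by
  have hc : CauchySeq fun k => (hf k).toLp (f k) :=
    cauchySeq_of_edist_le_of_tsum_ne_top r
      (fun k => by rw [edist_comm, Lp.edist_toLp_toLp]; exact h k) hr
  obtain ⟨g, hg⟩ := cauchySeq_tendsto_of_complete hc
  refine ⟨g, ?_⟩
  rw [Lp.tendsto_Lp_iff_tendsto_eLpNorm'] at hg
  refine hg.congr fun k => eLpNorm_congr_ae ?_
  filter_upwards [(hf k).coeFn_toLp] with x hx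
  rw [Pi.sub_apply, hx]

/-- Partial sums of products of increments of a bounded sequence with a decreasing sequence in
`[0, 1]` satisfy the same bound. -/
lemma abs_sum_mul_sub_le {a η : ℕ → ℝ} {M : ℝ} (ha : ∀ k, |a k| ≤ M) (ha0 : a 0 = 0)
    (hη : Antitone η) (h0 : ∀ k, 0 ≤ η k) (h1 : ∀ k, η k ≤ 1) (N : ℕ) :
    |∑ k ∈ Finset.range N, η k * (a (k + 1) - a k)| ≤ M := by
  have hM : 0 ≤ M := (abs_nonneg _).trans (ha 0)
  -- Abel summation: after removal of the boundary term η N * a N, the sum is a combination of the a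
  -- (k + 1) with nonnegative weights η k - η (k + 1), whose total is η 0 - η N.
  have key : ∀ N, |(∑ k ∈ Finset.range N, η k * (a (k + 1) - a k)) - η N * a N| ≤
      M * (η 0 - η N) := by
    intro N
    induction N with
    | zero => simp [ha0]
    | succ N ih =>
      rw [Finset.sum_range_succ]
      have e : (∑ k ∈ Finset.range N, η k * (a (k + 1) - a k)) + η N * (a (N + 1) - a N) -
          η (N + 1) * a (N + 1) = ((∑ k ∈ Finset.range N, η k * (a (k + 1) - a k)) - η N * a N) +
          (η N - η (N + 1)) * a (N + 1) := by ring
      rw [e]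
      refine (abs_add_le _ _).trans ?_
      rw [abs_mul, abs_of_nonneg (sub_nonneg.2 (hη (Nat.le_succ N)))]
      have := mul_le_mul_of_nonneg_left (ha (N + 1)) (sub_nonneg.2 (hη (Nat.le_succ N)))
      linarith
  have h2 := key N
  have h3 : |η N * a N| ≤ η N * M := by
    rw [abs_mul, abs_of_nonneg (h0 N)]
    exact mul_le_mul_of_nonneg_left (ha N) (h0 N)
  calc _ = |((∑ k ∈ Finset.range N, η k * (a (k + 1) - a k)) - η N * a N) + η N * a N| := by
        rw [sub_add_cancel]
    _ ≤ M * (η 0 - η N) + η N * M := (abs_add_le _ _).trans (add_le_add h2 h3)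
    _ = M * η 0 := by ring
    _ ≤ M := mul_le_of_le_one_right hM (h1 0)

section Layer

variable {n : ℕ} {B : Type*} [MeasurableSpace B]

/-- The integral of a continuous function over thin layers in `U` around `F` is controlled by the
thickness times its integral along `ι` with respect to `σ`. -/
def HasLayerBound (U F : Set (Euc n)) (σ : Measure B) (ι : B → Euc n) : Prop :=
  ∃ C : ℝ≥0, ∀ h : Euc n → ℝ, Continuous h → HasCompactSupport h → ∀ δ : ℝ≥0∞, δ ≠ 0 →
    ∀ᶠ ε : ℝ in 𝓝[>] 0, ∫⁻ x in U ∩ {x | Metric.infDist x F < ε}, ‖h x‖ₑ ≤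
      ENNReal.ofReal ε * (C * ∫⁻ b, ‖h (ι b)‖ₑ ∂σ + δ)

/-- Smooth compactly supported functions composed with `ι` are dense in `L¹(σ)`. -/
def HasDenseRestrictions (σ : Measure B) (ι : B → Euc n) : Prop :=
  ∀ f : B → ℝ, MemLp f 1 σ → ∀ δ : ℝ≥0∞, δ ≠ 0 → ∃ g : Euc n → ℝ, IsSmoothCompact g ∧
    eLpNorm (fun b => f b - g (ι b)) 1 σ ≤ δ

variable {U F : Set (Euc n)} {σ : Measure B} {ι : B → Euc n}

/-- Bounded functions can be approximated by uniformly bounded smooth functions. -/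
lemma HasDenseRestrictions.exists_bounded (hd : HasDenseRestrictions σ ι) {f : B → ℝ}
    (hf : MemLp f 1 σ) (hf' : MemLp f ⊤ σ) :
    ∃ M : ℝ, ∀ δ : ℝ≥0∞, δ ≠ 0 → ∃ g : Euc n → ℝ, IsSmoothCompact g ∧ (∀ x, |g x| ≤ M) ∧
      eLpNorm (fun b => f b - g (ι b)) 1 σ ≤ δ := by
  set M : ℝ := (eLpNorm f ⊤ σ).toReal + 1 with hM
  have hMpos : 0 < M := by positivity
  have hfM : ∀ᵐ b ∂σ, |f b| ≤ M := by
    have := ae_le_eLpNormEssSup (f := f) (μ := σ)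
    filter_upwards [this] with b hb
    rw [← eLpNorm_exponent_top] at hb
    have h2 := ENNReal.toReal_mono hf'.2.ne hb
    rw [toReal_enorm, Real.norm_eq_abs] at h2
    linarith
  let β : ContDiffBump (0 : ℝ) := ⟨M, M + 1, hMpos, by linarith⟩
  -- A smooth truncation: it is the identity on [-M, M], hence fixes f almost everywhere; it is
  -- bounded and Lipschitz; and it vanishes at 0, so composition with it preserves compact support.
  set T : ℝ → ℝ := fun s => s * β s with hT
  have hTd : ContDiff ℝ ∞ T := contDiff_id.mul β.contDiff
  have hTc : HasCompactSupport T := β.hasCompactSupport.mul_left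
  obtain ⟨K, hK⟩ := ContDiff.lipschitzWith_of_hasCompactSupport (𝕂 := ℝ) hTc hTd (by simp)
  have hT1 : ∀ s, |s| ≤ M → T s = s := fun s hs => by
    have : β s = 1 := β.one_of_mem_closedBall (by simpa [Real.dist_eq] using hs)
    simp [hT, this]
  obtain ⟨R, hR⟩ := hTc.exists_bound_of_continuous hTd.continuous
  refine ⟨R, fun δ hδ => ?_⟩
  -- Truncation multiplies the error by at most K; dividing by K + 1 rather than K also covers K =
  -- 0.
  obtain ⟨g, hg, hgδ⟩ := hd f hf (δ / (K + 1)) (ENNReal.div_ne_zero.2 ⟨hδ, by simp⟩)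
  refine ⟨T ∘ g, ⟨hTd.comp hg.1, hg.2.comp_left (by simp [hT])⟩, fun x => hR _, ?_⟩
  have h1 : eLpNorm (fun b => f b - T (g (ι b))) 1 σ ≤
      K • eLpNorm (fun b => f b - g (ι b)) 1 σ := by
    refine eLpNorm_le_nnreal_smul_eLpNorm_of_ae_le_mul ?_ 1
    filter_upwards [hfM] with b hb
    have := hK.dist_le_mul (f b) (g (ι b))
    rwa [hT1 _ hb, dist_eq_norm, dist_eq_norm] at this
  refine h1.trans ((mul_le_mul_right hgδ (K : ℝ≥0∞)).trans ?_)
  rw [ENNReal.div_eq_inv_mul, ← mul_assoc]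
  refine mul_le_of_le_one_left' ?_
  rw [← div_eq_mul_inv]
  exact ENNReal.div_le_of_le_mul (by rw [one_mul]; exact le_self_add)

variable {η : ℕ → Euc n → ℝ}

lemma tendsto_lintegral_layer (hl : HasLayerBound U F σ ι)
    (hfin : ∀ h : Euc n → ℝ, Continuous h → HasCompactSupport h → ∫⁻ b, ‖h (ι b)‖ₑ ∂σ ≠ ⊤)
    {h : Euc n → ℝ} (hc : Continuous h) (hs : HasCompactSupport h) :
    Tendsto (fun j : ℕ => ∫⁻ x in U ∩ {x | Metric.infDist x F < (1 / 5 : ℝ) ^ j}, ‖h x‖ₑ)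
      atTop (𝓝 0) := by
  obtain ⟨C, hC⟩ := hl
  have ht : Tendsto (fun j : ℕ => (1 / 5 : ℝ) ^ j) atTop (𝓝[>] 0) :=
    tendsto_pow_atTop_nhdsWithin_zero_of_lt_one (by norm_num) (by norm_num)
  have h1 := ht.eventually (hC h hc hs 1 one_ne_zero)
  have h2 : Tendsto (fun j : ℕ => ENNReal.ofReal ((1 / 5 : ℝ) ^ j) *
      (C * ∫⁻ b, ‖h (ι b)‖ₑ ∂σ + 1)) atTop (𝓝 0) := by
    have h3 := ENNReal.tendsto_ofReal (ht.mono_right nhdsWithin_le_nhds)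
    rw [ENNReal.ofReal_zero] at h3
    have := ENNReal.Tendsto.mul_const h3 (b := (C * ∫⁻ b, ‖h (ι b)‖ₑ ∂σ + 1)) (Or.inr ?_)
    · rwa [zero_mul] at this
    · exact ENNReal.add_ne_top.2 ⟨ENNReal.mul_ne_top ENNReal.coe_ne_top (hfin h hc hs),
        ENNReal.one_ne_top⟩
  exact tendsto_of_tendsto_of_tendsto_of_le_of_le' tendsto_const_nhds h2
    (Eventually.of_forall fun _ => bot_le) h1

lemma lintegral_le_of_le_indicator_layer {G H : Euc n → ℝ≥0∞} {ε : ℝ}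
    (h : ∀ x, Metric.infDist x F < ε → G x ≤ H x) (h0 : ∀ x, ε ≤ Metric.infDist x F → G x = 0) :
    ∫⁻ x in U, G x ≤ ∫⁻ x in U ∩ {x | Metric.infDist x F < ε}, H x := by
  have hm : MeasurableSet {x : Euc n | Metric.infDist x F < ε} :=
    measurableSet_lt (Metric.continuous_infDist_pt F).measurable measurable_const
  rw [inter_comm, ← Measure.restrict_restrict hm, ← lintegral_indicator hm]
  refine lintegral_mono fun x => ?_
  by_cases hx : Metric.infDist x F < ε
  · rw [indicator_of_mem (by exact hx)]; exact h x hx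
  · rw [h0 x (not_lt.1 hx)]; exact bot_le

/-- For finite q, |h|^q is again continuous with compact support, and its integral over the
shrinking layers tends to 0. No rate is needed, since the layers are chosen after h. -/
lemma tendsto_eLpNorm_cutoff_mul (hl : HasLayerBound U F σ ι)
    (hfin : ∀ h : Euc n → ℝ, Continuous h → HasCompactSupport h → ∫⁻ b, ‖h (ι b)‖ₑ ∂σ ≠ ⊤)
    (h0 : ∀ j x, 0 ≤ η j x) (h1 : ∀ j x, η j x ≤ 1)
    (hz : ∀ j x, (1 / 5 : ℝ) ^ j ≤ Metric.infDist x F → η j x = 0)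
    {h : Euc n → ℝ} (hc : Continuous h) (hs : HasCompactSupport h) {q : ℝ≥0∞} (hq : 1 ≤ q)
    (hq' : q ≠ ⊤) :
    Tendsto (fun j : ℕ => eLpNorm (η j * h) q (vol U)) atTop (𝓝 0) := by
  have hq0 : q ≠ 0 := (one_pos.trans_le hq).ne'
  have hqr : 0 < q.toReal := ENNReal.toReal_pos hq0 hq'
  have hc' : Continuous fun x => |h x| ^ q.toReal :=
    hc.abs.rpow_const fun x => Or.inr hqr.le
  have hs' : HasCompactSupport fun x => |h x| ^ q.toReal :=
    hs.comp_left (g := fun s : ℝ => |s| ^ q.toReal) (by simp [hqr.ne'])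
  have ht := tendsto_lintegral_layer hl hfin hc' hs'
  have ht2 := (ENNReal.continuous_rpow_const (y := 1 / q.toReal)).tendsto 0 |>.comp ht
  rw [ENNReal.zero_rpow_of_pos (by positivity)] at ht2
  refine tendsto_of_tendsto_of_tendsto_of_le_of_le tendsto_const_nhds ht2
    (fun _ => bot_le) fun j => ?_
  simp only [eLpNorm_eq_lintegral_rpow_enorm_toReal hq0 hq', Function.comp_apply]
  refine ENNReal.rpow_le_rpow (lintegral_le_of_le_indicator_layer (fun x _ => ?_) fun x hx => ?_)
    (by positivity)
  · rw [Real.enorm_rpow_of_nonneg (abs_nonneg _) hqr.le, Real.enorm_abs]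
    refine ENNReal.rpow_le_rpow (enorm_le_iff_norm_le.2 ?_) hqr.le
    rw [Pi.mul_apply, norm_mul, Real.norm_of_nonneg (h0 j x)]
    exact mul_le_of_le_one_left (norm_nonneg _) (h1 j x)
  · rw [Pi.mul_apply, hz j x hx, zero_mul, enorm_zero, ENNReal.zero_rpow_of_pos hqr]

/-- By the product rule there are two terms. In the one carrying the gradient of the cutoff, the
factor 5·5ʲ cancels the layer thickness 5⁻ʲ, so only the boundary L¹ norm of h survives; the other
is an integral of |∇h| over a shrinking layer. The constant is independent of h, which allows
summation over infinitely many pieces. -/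
lemma HasLayerBound.exists_eLpNorm_gradient_cutoff_mul_le (hl : HasLayerBound U F σ ι)
    (hfin : ∀ h : Euc n → ℝ, Continuous h → HasCompactSupport h → ∫⁻ b, ‖h (ι b)‖ₑ ∂σ ≠ ⊤)
    (hη : ∀ j, ContDiff ℝ ∞ (η j))
    (h0 : ∀ j x, 0 ≤ η j x) (h1 : ∀ j x, η j x ≤ 1)
    (hz : ∀ j x, (1 / 5 : ℝ) ^ j ≤ Metric.infDist x F → η j x = 0)
    (hg : ∀ j x, ‖gradient (η j) x‖ ≤ 5 / (1 / 5 : ℝ) ^ j)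
    (hgz : ∀ j x, (1 / 5 : ℝ) ^ j ≤ Metric.infDist x F → gradient (η j) x = 0) :
    ∃ C : ℝ≥0, ∀ h : Euc n → ℝ, IsSmoothCompact h → ∀ δ : ℝ≥0∞, δ ≠ 0 → ∀ᶠ j in atTop,
      eLpNorm (gradient (η j * h)) 1 (vol U) ≤ C * ∫⁻ b, ‖h (ι b)‖ₑ ∂σ + δ := by
  have hl' := hl
  obtain ⟨C, hC⟩ := hl
  refine ⟨5 * C, fun h hh δ hδ => ?_⟩
  have ht : Tendsto (fun j : ℕ => (1 / 5 : ℝ) ^ j) atTop (𝓝[>] 0) :=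
    tendsto_pow_atTop_nhdsWithin_zero_of_lt_one (by norm_num) (by norm_num)
  -- Half of δ is for the term with ∇h. The other half is divided by 5 in advance, because the
  -- gradient bound of the cutoff times the thickness equals 5.
  have e1 := ht.eventually (hC h hh.1.continuous hh.2 (δ / 2 / 5) (by simp [hδ]))
  have e2 := (tendsto_lintegral_layer hl' hfin hh.continuous_gradient.norm
    (hh.hasCompactSupport_gradient.comp_left norm_zero)).eventually
    (ge_mem_nhds (pos_iff_ne_zero.2 (by simp [hδ] : δ / 2 ≠ 0)))
  filter_upwards [e1, e2] with j h3 h4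
  have hpow : (0 : ℝ) < (1 / 5) ^ j := by positivity
  rw [eLpNorm_one_eq_lintegral_enorm]
  have h5 : ∫⁻ x in U, ‖gradient (η j * h) x‖ₑ ≤
      ∫⁻ x in U ∩ {x | Metric.infDist x F < (1 / 5 : ℝ) ^ j},
        (‖gradient h x‖ₑ + ENNReal.ofReal (5 / (1 / 5 : ℝ) ^ j) * ‖h x‖ₑ) := by
    refine lintegral_le_of_le_indicator_layer (fun x _ => ?_) fun x hx => ?_
    · rw [gradient_mul ((hη j).differentiable (by simp)) hh.differentiable]
      refine (enorm_add_le _ _).trans ?_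
      rw [enorm_smul, enorm_smul]
      refine add_le_add ?_ ?_
      · refine mul_le_of_le_one_left' ?_
        rw [Real.enorm_of_nonneg (h0 j x)]
        exact ENNReal.ofReal_le_one.2 (h1 j x)
      · rw [mul_comm]
        gcongr
        rw [← ofReal_norm]
        exact ENNReal.ofReal_le_ofReal (hg j x)
    · rw [gradient_mul ((hη j).differentiable (by simp)) hh.differentiable, hz j x hx, hgz j x hx]
      simp
  refine h5.trans ?_
  rw [lintegral_add_left hh.continuous_gradient.measurable.enorm,
    lintegral_const_mul' _ _ ENNReal.ofReal_ne_top]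
  have h6 : ENNReal.ofReal (5 / (1 / 5 : ℝ) ^ j) * ENNReal.ofReal ((1 / 5 : ℝ) ^ j) = 5 := by
    rw [← ENNReal.ofReal_mul (by positivity), div_mul_cancel₀ _ hpow.ne']
    simp
  have h7 : ∫⁻ x in U ∩ {x | Metric.infDist x F < (1 / 5 : ℝ) ^ j}, ‖gradient h x‖ₑ ≤ δ / 2 := by
    simpa using h4
  calc _ ≤ δ / 2 + ENNReal.ofReal (5 / (1 / 5 : ℝ) ^ j) * (ENNReal.ofReal ((1 / 5 : ℝ) ^ j) *
        (C * ∫⁻ b, ‖h (ι b)‖ₑ ∂σ + δ / 2 / 5)) := by gcongr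
    _ = δ / 2 + (5 * C * ∫⁻ b, ‖h (ι b)‖ₑ ∂σ + 5 * (δ / 2 / 5)) := by
        rw [← mul_assoc, h6, mul_add, mul_assoc]
    _ = 5 * C * ∫⁻ b, ‖h (ι b)‖ₑ ∂σ + (δ / 2 + δ / 2) := by
        rw [ENNReal.mul_div_cancel (by simp) (by simp)]; ring
    _ = _ := by rw [ENNReal.add_halves]; simp

/-- Every `f ∈ L¹(σ)` is the trace of a limit of smooth functions in `W^{1,1}(U) ∩ L^q(U)`, which is
bounded if `f` is. -/
theorem HasLayerBound.exists_extension (hl : HasLayerBound U F σ ι)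
    (hfin : ∀ h : Euc n → ℝ, Continuous h → HasCompactSupport h → ∫⁻ b, ‖h (ι b)‖ₑ ∂σ ≠ ⊤)
    (hd : HasDenseRestrictions σ ι) (hι : Measurable ι) (hιF : ∀ᵐ b ∂σ, ι b ∈ F)
    {f : B → ℝ} (hf : MemLp f 1 σ) {q : ℝ≥0∞} (hq : 1 ≤ q) (hq' : q ≠ ⊤) :
    ∃ φ : ℕ → Euc n → ℝ, (∀ k, IsSmoothCompact (φ k)) ∧
      ∃ (u : Lp ℝ 1 (vol U)) (G : Lp (Euc n) 1 (vol U)),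
        Tendsto (fun k => eLpNorm (fun x => φ k x - u x) 1 (vol U)) atTop (𝓝 0) ∧
        Tendsto (fun k => eLpNorm (fun x => gradient (φ k) x - G x) 1 (vol U)) atTop (𝓝 0) ∧
        Tendsto (fun k => eLpNorm (fun b => φ k (ι b) - f b) 1 σ) atTop (𝓝 0) ∧
        MemLp u q (vol U) ∧ (MemLp f ⊤ σ → MemLp u ⊤ (vol U)) := by
  obtain ⟨η, hη, h0, h1, hF, hz, hg, hgz, hanti⟩ := exists_cutoff_seq F
  obtain ⟨C, hC⟩ := hl.exists_eLpNorm_gradient_cutoff_mul_le hfin hη h0 h1 hz hg hgz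
  -- uniformly bounded if possible
  have happ : ∃ M : ℝ, ∀ δ : ℝ≥0∞, δ ≠ 0 → ∃ g : Euc n → ℝ, IsSmoothCompact g ∧
      (MemLp f ⊤ σ → ∀ x, |g x| ≤ M) ∧ eLpNorm (fun b => f b - g (ι b)) 1 σ ≤ δ := by
    by_cases hb : MemLp f ⊤ σ
    · obtain ⟨M, hM⟩ := hd.exists_bounded hf hb
      exact ⟨M, fun δ hδ => (hM δ hδ).imp fun g hg => ⟨hg.1, fun _ => hg.2.1, hg.2.2⟩⟩
    · exact ⟨0, fun δ hδ => (hd f hf δ hδ).imp fun g hg => ⟨hg.1, fun h => (hb h).elim, hg.2⟩⟩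
  obtain ⟨M, hM⟩ := happ
  set r : ℕ → ℝ≥0∞ := fun k => 2⁻¹ ^ k with hr
  have hr0 : ∀ k, r k ≠ 0 := fun k => pow_ne_zero _ (by simp)
  have hrsum : ∑' k, r k ≠ ⊤ := by
    rw [hr, ENNReal.tsum_geometric]; simp
  have hrt : Tendsto r atTop (𝓝 0) := ENNReal.tendsto_pow_atTop_nhds_zero_of_lt_one (by simp)
  choose g' hg1 hg2 hg3 using fun k => hM (r k) (hr0 k)
  -- Starting from 0 makes the sum of increments telescope to g N itself, and supplies the vanishing
  -- initial value required by Abel summation.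
  set g : ℕ → Euc n → ℝ := fun k => if k = 0 then 0 else g' k with hgdef
  have g0 : g 0 = 0 := by simp [hgdef]
  have gS : ∀ k, IsSmoothCompact (g k) := fun k => by
    by_cases hk : k = 0
    · simp only [hgdef, hk, if_true]; exact IsSmoothCompact.zero
    · simp only [hgdef, hk, if_false]; exact hg1 k
  have gb : MemLp f ⊤ σ → ∀ k x, |g k x| ≤ |M| := fun hb k x => by
    by_cases hk : k = 0
    · simp [hgdef, hk]
    · simp only [hgdef, hk, if_false]; exact (hg2 k hb x).trans (le_abs_self M)
  have ga : ∀ k, k ≠ 0 → eLpNorm (fun b => f b - g k (ι b)) 1 σ ≤ r k := fun k hk => by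
    simp only [hgdef, hk, if_false]; exact hg3 k
  set h : ℕ → Euc n → ℝ := fun k => g (k + 1) - g k with hhdef
  have hS : ∀ k, IsSmoothCompact (h k) := fun k => (gS (k + 1)).sub (gS k)
  set I : ℕ → ℝ≥0∞ := fun k => ∫⁻ b, ‖h k (ι b)‖ₑ ∂σ with hI
  have hIfin : ∀ k, I k ≠ ⊤ := fun k => hfin _ (hS k).1.continuous (hS k).2
  have hIle : ∀ k, I (k + 1) ≤ 2 * r k := by
    intro k
    have hm : ∀ k, AEStronglyMeasurable (fun b => f b - g k (ι b)) σ := fun k =>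
      hf.1.sub ((gS k).1.continuous.measurable.comp hι).aestronglyMeasurable
    have h2 := eLpNorm_sub_le (p := 1) (hm (k + 1)) (hm (k + 2)) le_rfl
    rw [two_mul]
    have h3 : r (k + 1) ≤ r k := pow_le_pow_right_of_le_one' (by simp) (Nat.le_succ k)
    have h4 : r (k + 2) ≤ r k := pow_le_pow_right_of_le_one' (by simp) (by omega)
    refine le_trans (le_of_eq ?_) (h2.trans (add_le_add ((ga _ (by simp)).trans h3)
      ((ga _ (by simp)).trans h4)))
    rw [eLpNorm_one_eq_lintegral_enorm]
    refine lintegral_congr fun b => ?_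
    simp [hhdef]
  have hIsum : ∑' k, I k ≠ ⊤ := by
    -- The first increment compares g 1 with 0, so its norm is merely finite; geometric decay starts
    -- with the next one.
    rw [tsum_eq_zero_add' ENNReal.summable]
    refine ENNReal.add_ne_top.2 ⟨hIfin 0, ne_top_of_le_ne_top ?_ (ENNReal.tsum_le_tsum hIle)⟩
    rw [ENNReal.tsum_mul_left]
    exact ENNReal.mul_ne_top (by simp) hrsum
  -- The indices are chosen strictly increasing, so that the cutoffs in the series decrease in k at
  -- each point.
  obtain ⟨j, hj, hjP⟩ := extraction_forall_of_eventually
    (P := fun k i => eLpNorm (gradient (η i * h k)) 1 (vol U) ≤ C * I k + r k ∧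
      eLpNorm (η i * h k) 1 (vol U) ≤ r k ∧ eLpNorm (η i * h k) q (vol U) ≤ r k) (by
    intro k
    have t1 := (tendsto_eLpNorm_cutoff_mul hl hfin h0 h1 hz (hS k).1.continuous (hS k).2
      le_rfl ENNReal.one_ne_top).eventually (ge_mem_nhds (pos_iff_ne_zero.2 (hr0 k)))
    have t2 := (tendsto_eLpNorm_cutoff_mul hl hfin h0 h1 hz (hS k).1.continuous (hS k).2
      hq hq').eventually (ge_mem_nhds (pos_iff_ne_zero.2 (hr0 k)))
    exact (hC (h k) (hS k) (r k) (hr0 k)).and (t1.and t2))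
  set T : ℕ → Euc n → ℝ := fun k => η (j k) * h k with hT
  have hTS : ∀ k, IsSmoothCompact (T k) := fun k => (hS k).mul_left (hη _)
  set φ : ℕ → Euc n → ℝ := fun N => ∑ k ∈ Finset.range N, T k with hφ
  have hφS : ∀ N, IsSmoothCompact (φ N) := fun N => IsSmoothCompact.sum fun k _ => hTS k
  have hstep : ∀ N, φ (N + 1) - φ N = T N := fun N => by
    simp [hφ, Finset.sum_range_succ]
  obtain ⟨u, hu⟩ := exists_Lp_limit (μ := vol U) (fun N => (hφS N).memLp 1 _) (r := r)
    (fun N => by rw [hstep]; exact (hjP N).2.1) hrsum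
  obtain ⟨G, hG⟩ := exists_Lp_limit (μ := vol U) (fun N => (hφS N).memLp_gradient 1 _)
    (r := fun k => C * I k + r k) (fun N => by
      have : gradient (φ (N + 1)) - gradient (φ N) = gradient (T N) := by
        funext x
        rw [← hstep, gradient_sub (hφS _).differentiable (hφS _).differentiable]; rfl
      rw [this]; exact (hjP N).1) (by
      rw [ENNReal.tsum_add, ENNReal.tsum_mul_left]
      exact ENNReal.add_ne_top.2 ⟨ENNReal.mul_ne_top ENNReal.coe_ne_top hIsum, hrsum⟩)
  refine ⟨φ, hφS, u, G, hu, hG, ?_, ?_, fun hb => ?_⟩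
  -- On F all cutoffs equal 1, so the partial sums telescope to the approximants of f.
  · have e : ∀ N, ∀ᵐ b ∂σ, φ N (ι b) = g N (ι b) := by
      intro N
      filter_upwards [hιF] with b hb
      have : ∀ k, T k (ι b) = g (k + 1) (ι b) - g k (ι b) := fun k => by
        simp [hT, hhdef, hF _ _ hb]
      simp only [hφ, Finset.sum_apply, this]
      rw [Finset.sum_range_sub (fun k => g k (ι b)), g0]
      simp
    refine tendsto_of_tendsto_of_tendsto_of_le_of_le' tendsto_const_nhds hrt
      (Eventually.of_forall fun _ => bot_le) ?_
    filter_upwards [eventually_ne_atTop 0] with N hN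
    refine le_trans (le_of_eq ?_) (ga N hN)
    rw [eLpNorm_congr_ae (g := fun b => g N (ι b) - f b)
      (by filter_upwards [e N] with b hb; rw [hb])]
    exact eLpNorm_sub_comm (fun b => g N (ι b)) f 1 σ
  · refine ⟨Lp.aestronglyMeasurable u, lt_of_le_of_lt ?_ hrsum.lt_top⟩
    refine eLpNorm_le_of_tendsto_eLpNorm_one
      (fun N => (hφS N).1.continuous.aestronglyMeasurable) (Lp.aestronglyMeasurable u) hu
      fun N => ?_
    refine (eLpNorm_sum_le (fun k _ => (hTS k).1.continuous.aestronglyMeasurable) hq).trans ?_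
    exact (Finset.sum_le_sum fun k _ => (hjP k).2.2).trans (ENNReal.sum_le_tsum _)
  · refine ⟨Lp.aestronglyMeasurable u, lt_of_le_of_lt ?_ (ENNReal.ofReal_lt_top (r := |M|))⟩
    refine eLpNorm_le_of_tendsto_eLpNorm_one
      (fun N => (hφS N).1.continuous.aestronglyMeasurable) (Lp.aestronglyMeasurable u) hu
      fun N => ?_
    rw [eLpNorm_exponent_top]
    refine eLpNormEssSup_le_of_ae_bound (Eventually.of_forall fun x => ?_)
    have := abs_sum_mul_sub_le (a := fun k => g k x) (η := fun k => η (j k) x)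
      (fun k => gb hb k x) (by simp [g0]) ((hanti x).comp_monotone hj.monotone)
      (fun k => h0 _ _) (fun k => h1 _ _) N
    rw [Real.norm_eq_abs]
    refine le_trans (le_of_eq ?_) this
    simp [hφ, hT, hhdef]

end Layer

end TraceL1

/-! ### Layer bound, dense restrictions and trace inequality in the half-space -/

namespace TraceL1

variable {d : ℕ}

/-- In a thin layer, uniform continuity replaces h by its value on the graph up to an error τ,
chosen so that τ times L times the volume of D is below δ. The smallness of ε is required before A
is chosen, hence is independent of it. -/
lemma eventually_setLIntegral_le_of_layer (e : Euc (d + 1) ≃ₗᵢ[ℝ] Euc (d + 1)) {ψ : Euc d → ℝ}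
    (hψ : Continuous ψ) {D : Set (Euc d)} (hD : MeasurableSet D) (hDfin : volume D ≠ ⊤) {L : ℝ}
    (hL : 0 < L) {h : Euc (d + 1) → ℝ} (hc : Continuous h) (hs : HasCompactSupport h) {δ : ℝ≥0∞}
    (hδ : δ ≠ 0) :
    ∀ᶠ ε : ℝ in 𝓝[>] 0, ∀ A : Set (Euc (d + 1)), MeasurableSet A →
      (∀ x t, graphMap e ψ x t ∈ A → x ∈ D ∧ t ∈ Ioc 0 (L * ε)) →
      ∫⁻ y in A, ‖h y‖ₑ ≤ ENNReal.ofReal ε *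
        (ENNReal.ofReal L * (∫⁻ x in D, ‖h (graphMap e ψ x 0)‖ₑ) + δ) := by
  obtain ⟨τ, hτ, hτδ⟩ := ENNReal.exists_nnreal_pos_mul_lt
    (ENNReal.mul_ne_top (ENNReal.ofReal_ne_top (r := L)) hDfin) hδ
  obtain ⟨r, hr, hrτ⟩ := Metric.uniformContinuous_iff.1 (hs.uniformContinuous_of_continuous hc)
    τ hτ
  have hev : ∀ᶠ ε : ℝ in 𝓝[>] 0, ε < r / L :=
    mem_nhdsWithin_of_mem_nhds (gt_mem_nhds (by positivity))
  filter_upwards [hev, self_mem_nhdsWithin] with ε hε hε0 A hA hAD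
  have hε0' : (0 : ℝ) < ε := hε0
  refine (setLIntegral_le_of_layer (τ := (τ : ℝ≥0∞)) e hψ hD hA hAD hc.measurable.enorm
    fun x _ t ht => ?_).trans ?_
  · have hd : dist (graphMap e ψ x t) (graphMap e ψ x 0) < r := by
      rw [graphMap_eq, dist_eq_norm, add_sub_cancel_left, norm_smul, norm_upDir, mul_one,
        Real.norm_of_nonneg ht.1.le]
      refine ht.2.trans_lt ?_
      rw [lt_div_iff₀ hL] at hε
      linarith
    have h1 := hrτ hd
    rw [dist_eq_norm] at h1
    have h2 : h (graphMap e ψ x t) =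
      h (graphMap e ψ x 0) + (h (graphMap e ψ x t) - h (graphMap e ψ x 0)) := by ring
    rw [h2]
    refine (enorm_add_le _ _).trans (add_le_add le_rfl ?_)
    rw [← ofReal_norm, ← ENNReal.ofReal_coe_nnreal]
    exact ENNReal.ofReal_le_ofReal h1.le
  · rw [mul_comm L ε, ENNReal.ofReal_mul hε0'.le, mul_assoc, mul_add]
    gcongr
    refine le_trans (le_of_eq ?_) hτδ.le
    ring

lemma isBounded_support_withLast {h : Euc (d + 1) → ℝ} (hs : HasCompactSupport h) :
    ∃ R : ℝ, 0 < R ∧ ∀ y, R ≤ ‖y‖ → h y = 0 := by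
  obtain ⟨R, hR⟩ := hs.isCompact.isBounded.subset_ball 0
  refine ⟨max R 1, by positivity, fun y hy => ?_⟩
  by_contra hne
  have := hR (subset_tsupport h hne)
  rw [mem_ball_zero_iff] at this
  linarith [le_max_left R 1]

lemma graphMap_refl_zero (x : Euc d) (t : ℝ) :
    graphMap (LinearIsometryEquiv.refl ℝ (Euc (d + 1))) 0 x t = withLast x t := by
  simp only [graphMap, Pi.zero_apply, zero_add]
  rfl

lemma norm_withLast_zero (x : Euc d) : ‖withLast x 0‖ = ‖x‖ := by
  have := norm_withLast_sq x 0
  rw [sq (0 : ℝ), mul_zero, add_zero] at this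
  exact (pow_left_inj₀ (norm_nonneg _) (norm_nonneg _) two_ne_zero).1 this

lemma continuous_withLast : Continuous fun z : Euc d × ℝ => withLast z.1 z.2 := by
  have := continuous_graphMap (LinearIsometryEquiv.refl ℝ (Euc (d + 1)))
    (ψ := (0 : Euc d → ℝ)) continuous_const
  simpa only [graphMap_refl_zero] using this

lemma continuous_withLast_zero : Continuous fun x : Euc d => withLast x 0 :=
  continuous_withLast.comp (continuous_id.prodMk continuous_const)

lemma HasCompactSupport.comp_withLast_zero {h : Euc (d + 1) → ℝ} (hs : HasCompactSupport h) :
    HasCompactSupport fun x : Euc d => h (withLast x 0) := by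
  obtain ⟨R, -, hR⟩ := isBounded_support_withLast hs
  refine HasCompactSupport.of_support_subset_isCompact (isCompact_closedBall 0 R) fun x hx => ?_
  rw [mem_closedBall_zero_iff]
  by_contra hlt
  exact hx (hR _ (by rw [norm_withLast_zero]; linarith))

lemma contDiff_withLast_zero : ContDiff ℝ ∞ fun x : Euc d => withLast x 0 := by
  unfold withLast
  refine (PiLp.contDiff_toLp (𝕜 := ℝ) (n := ∞) (p := 2)).comp (contDiff_pi.2 fun i => ?_)
  refine Fin.lastCases ?_ (fun j => ?_) i
  · simpa using contDiff_const
  · simp only [Fin.snoc_castSucc]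
    fun_prop

lemma IsSmoothCompact.comp_withLast_zero {φ : Euc (d + 1) → ℝ} (hφ : IsSmoothCompact φ) :
    IsSmoothCompact fun x : Euc d => φ (withLast x 0) :=
  ⟨hφ.1.comp contDiff_withLast_zero, HasCompactSupport.comp_withLast_zero hφ.2⟩

lemma lintegral_comp_withLast_zero_ne_top {h : Euc (d + 1) → ℝ} (hc : Continuous h)
    (hs : HasCompactSupport h) : ∫⁻ x : Euc d, ‖h (withLast x 0)‖ₑ ≠ ⊤ := by
  have := ((hc.comp continuous_withLast_zero).integrable_of_hasCompactSupport (μ := volume)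
    (HasCompactSupport.comp_withLast_zero hs)).2
  exact this.ne

lemma continuous_last : Continuous fun y : Euc (d + 1) => y (Fin.last d) := by fun_prop

lemma measurableSet_halfSpace : MeasurableSet (halfSpace d) :=
  measurableSet_lt measurable_const continuous_last.measurable

/-- The graph function is 0, so height equals distance to the boundary and the constant is 1. Since
the boundary has infinite measure, the layer is first cut to a ball outside which h vanishes. -/
lemma hasLayerBound_halfSpace :
    HasLayerBound (halfSpace d) {y | y (Fin.last d) = 0} volume
      (fun x : Euc d => withLast x 0) := by
  refine ⟨1, fun h hc hs δ hδ => ?_⟩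
  obtain ⟨R, hR0, hR⟩ := isBounded_support_withLast hs
  have hev := eventually_setLIntegral_le_of_layer (LinearIsometryEquiv.refl ℝ (Euc (d + 1)))
    (ψ := (0 : Euc d → ℝ)) continuous_const (D := Metric.closedBall 0 R)
    Metric.isClosed_closedBall.measurableSet measure_closedBall_lt_top.ne one_pos hc hs hδ
  filter_upwards [hev, self_mem_nhdsWithin] with ε hε hε0
  have hA : MeasurableSet (halfSpace d ∩ {y | Metric.infDist y {y : Euc (d + 1) | y (Fin.last d) = 0}
      < ε}) := measurableSet_halfSpace.inter
    (measurableSet_lt (Metric.continuous_infDist_pt _).measurable measurable_const)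
  have h1 := hε _ (hA.inter (Metric.isClosed_closedBall (x := 0) (ε := R)).measurableSet) ?_
  · have h2 : ∫⁻ y in halfSpace d ∩
        {y | Metric.infDist y {y : Euc (d + 1) | y (Fin.last d) = 0} < ε}, ‖h y‖ₑ =
        ∫⁻ y in (halfSpace d ∩ {y | Metric.infDist y {y : Euc (d + 1) | y (Fin.last d) = 0} < ε}) ∩
          Metric.closedBall 0 R, ‖h y‖ₑ := by
      rw [inter_comm _ (Metric.closedBall 0 R),
        ← Measure.restrict_restrict Metric.isClosed_closedBall.measurableSet,
        ← lintegral_indicator Metric.isClosed_closedBall.measurableSet]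
      refine lintegral_congr fun y => ?_
      by_cases hy : y ∈ Metric.closedBall 0 R
      · rw [indicator_of_mem hy]
      · rw [indicator_of_notMem hy, hR y (by rw [mem_closedBall_zero_iff] at hy; linarith),
          enorm_zero]
    rw [h2]
    refine h1.trans ?_
    simp only [graphMap_refl_zero, ENNReal.ofReal_one, ENNReal.coe_one]
    gcongr
    exact Measure.restrict_le_self
  · intro x t hx
    rw [graphMap_refl_zero] at hx
    obtain ⟨⟨hx1, hx2⟩, hx3⟩ := hx
    have hne : ({y : Euc (d + 1) | y (Fin.last d) = 0}).Nonempty := ⟨0, by simp⟩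
    obtain ⟨y, hy, hyx⟩ := (Metric.infDist_lt_iff hne).1 hx2
    simp only [halfSpace, mem_ofPred_eq, withLast_last] at hx1 hy
    refine ⟨?_, hx1, ?_⟩
    · rw [mem_closedBall_zero_iff] at hx3 ⊢
      have := norm_firstCoords_le (withLast x t)
      rw [firstCoords_withLast] at this
      linarith
    · have := abs_last_le (withLast x t - y)
      rw [PiLp.sub_apply, withLast_last, hy, sub_zero, ← dist_eq_norm] at this
      linarith [le_abs_self t]

/-- A smooth approximant on the boundary is extended by multiplying it with a bump in the last
variable that equals 1 at height 0. -/
lemma hasDenseRestrictions_halfSpace :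
    HasDenseRestrictions (volume : Measure (Euc d)) (fun x : Euc d => withLast x 0) := by
  intro f hf δ hδ
  obtain ⟨r, hr, hrδ⟩ : ∃ r : ℝ, 0 < r ∧ ENNReal.ofReal r ≤ δ := by
    obtain ⟨r, hr, hrδ⟩ := ENNReal.lt_iff_exists_nnreal_btwn.1 (pos_iff_ne_zero.2 hδ)
    exact ⟨r, by exact_mod_cast hr, by rw [ENNReal.ofReal_coe_nnreal]; exact hrδ.le⟩
  obtain ⟨g, hg1, hg2, hg3⟩ := hf.exist_eLpNorm_sub_le ENNReal.one_ne_top le_rfl hr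
  let β : ContDiffBump (0 : ℝ) := ⟨1, 2, one_pos, one_lt_two⟩
  obtain ⟨R, hR⟩ := hg1.isCompact.isBounded.subset_closedBall 0
  have hfc : ContDiff ℝ ∞ (firstCoords : Euc (d + 1) → Euc d) := by
    unfold firstCoords
    refine (PiLp.contDiff_toLp (𝕜 := ℝ) (n := ∞) (p := 2)).comp (contDiff_pi.2 fun i => ?_)
    fun_prop
  refine ⟨fun y => g (firstCoords y) * β (y (Fin.last d)), ⟨?_, ?_⟩, ?_⟩
  · exact (hg2.comp hfc).mul (β.contDiff.comp (by fun_prop))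
  · refine HasCompactSupport.of_support_subset_isCompact (isCompact_closedBall 0 (R + 2))
      fun y hy => ?_
    have hy1 : firstCoords y ∈ Metric.closedBall 0 R :=
      hR (subset_tsupport g (left_ne_zero_of_mul hy))
    have hy2 : y (Fin.last d) ∈ Metric.ball (0 : ℝ) 2 := by
      have : y (Fin.last d) ∈ Function.support β := right_ne_zero_of_mul hy
      rwa [β.support_eq] at this
    rw [mem_closedBall_zero_iff] at hy1 ⊢
    rw [mem_ball_zero_iff, Real.norm_eq_abs] at hy2
    have := norm_withLast_le (firstCoords y) (y (Fin.last d))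
    rw [withLast_firstCoords] at this
    linarith
  · refine le_trans (le_of_eq ?_) (hg3.trans hrδ)
    congr 1
    funext x
    have : β 0 = 1 := β.one_of_mem_closedBall (by simp [β.rIn_pos.le])
    simp [firstCoords_withLast, withLast_last, this]

/-- The trace inequality in the half-space. -/
lemma IsSmoothCompact.lintegral_withLast_zero_le {φ : Euc (d + 1) → ℝ} (hφ : IsSmoothCompact φ) :
    ∫⁻ x : Euc d, ‖φ (withLast x 0)‖ₑ ≤ ∫⁻ y in halfSpace d, ‖gradient φ y‖ₑ := by
  obtain ⟨R, hR0, hR⟩ := isBounded_support_withLast hφ.2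
  have hm : MeasurableSet {y : Euc (d + 1) | R ≤ y (Fin.last d)} :=
    measurableSet_le measurable_const continuous_last.measurable
  -- The averaging segment is placed at heights between R and R + 1, above the support of φ, so only
  -- the gradient term remains.
  have h := hφ.lintegral_graphMap_zero_le (LinearIsometryEquiv.refl ℝ (Euc (d + 1)))
    (ψ := (0 : Euc d → ℝ)) continuous_const (D := univ) (a := R) (b := R + 1) hR0.le hm
    measurableSet_halfSpace
    (fun x _ t ht => by rw [graphMap_refl_zero, mem_ofPred_eq, withLast_last]; exact ht.1.le)
    (fun x _ t ht => by rw [graphMap_refl_zero, halfSpace, mem_ofPred_eq, withLast_last]; exact ht.1)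
  have h0 : ∫⁻ y in {y : Euc (d + 1) | R ≤ y (Fin.last d)}, ‖φ y‖ₑ = 0 := by
    rw [setLIntegral_congr_fun (g := fun _ => 0) hm fun y hy => ?_]
    · simp
    · have : φ y = 0 := hR y (le_trans hy ((le_abs_self _).trans (abs_last_le y)))
      simp [this]
  simpa [h0, graphMap_refl_zero] using h

end TraceL1

/-! ### The trace operator of the half-space -/

namespace TraceL1

/-- The space of smooth compactly supported functions. -/
def smoothCompact (n : ℕ) : Submodule ℝ (Euc n → ℝ) where
  carrier := {φ | IsSmoothCompact φ}
  zero_mem' := IsSmoothCompact.zero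
  add_mem' := IsSmoothCompact.add
  smul_mem' c _ h := h.const_smul c

/-- The gradient of a smooth compactly supported function, in `L¹(U)`. -/
noncomputable def gradLp {n : ℕ} (U : Set (Euc n)) :
    smoothCompact n →ₗ[ℝ] Lp (Euc n) 1 (vol U) where
  toFun φ := (φ.2.memLp_gradient 1 (vol U)).toLp
  map_add' φ χ := by
    rw [← MemLp.toLp_add]
    exact MemLp.toLp_congr _ _ (Eventually.of_forall fun x =>
      gradient_add φ.2.differentiable χ.2.differentiable x)
  map_smul' c φ := by
    rw [RingHom.id_apply, ← MemLp.toLp_const_smul]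
    exact MemLp.toLp_congr _ _ (Eventually.of_forall fun x =>
      gradient_const_smul φ.2.differentiable c x)

/-- The restriction of smooth compactly supported functions along `ι`, in `L¹(σ)`. -/
noncomputable def restrictLp {n : ℕ} {B : Type*} [MeasurableSpace B] (σ : Measure B)
    (ι : B → Euc n) (h : ∀ φ : Euc n → ℝ, IsSmoothCompact φ → MemLp (fun b => φ (ι b)) 1 σ) :
    smoothCompact n →ₗ[ℝ] Lp ℝ 1 σ where
  toFun φ := (h φ.1 φ.2).toLp
  map_add' φ χ := by
    rw [← MemLp.toLp_add]
    rfl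
  map_smul' c φ := by
    rw [RingHom.id_apply, ← MemLp.toLp_const_smul]
    rfl

lemma tendsto_toLp_iff {α E : Type*} [MeasurableSpace α] {μ : Measure α} [NormedAddCommGroup E]
    {f : ℕ → α → E} (hf : ∀ k, MemLp (f k) 1 μ) (g : Lp E 1 μ) :
    Tendsto (fun k => (hf k).toLp (f k)) atTop (𝓝 g) ↔
      Tendsto (fun k => eLpNorm (fun x => f k x - g x) 1 μ) atTop (𝓝 0) := by
  rw [Lp.tendsto_Lp_iff_tendsto_eLpNorm']
  refine tendsto_congr fun k => eLpNorm_congr_ae ?_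
  filter_upwards [(hf k).coeFn_toLp] with x hx
  rw [Pi.sub_apply, hx]

lemma ae_eq_of_tendsto_eLpNorm_one {α E : Type*} [MeasurableSpace α] {μ : Measure α}
    [NormedAddCommGroup E] {f : ℕ → α → E} {g h : α → E} (hf : ∀ k, AEStronglyMeasurable (f k) μ)
    (hg : AEStronglyMeasurable g μ) (hh : AEStronglyMeasurable h μ)
    (h1 : Tendsto (fun k => eLpNorm (fun x => f k x - g x) 1 μ) atTop (𝓝 0))
    (h2 : Tendsto (fun k => eLpNorm (fun x => f k x - h x) 1 μ) atTop (𝓝 0)) : g =ᵐ[μ] h := by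
  have h3 : eLpNorm (g - h) 1 μ ≤ 0 := by
    have h4 := h1.add h2
    rw [add_zero] at h4
    refine ge_of_tendsto' h4 fun k => ?_
    have h5 := eLpNorm_sub_le (p := 1) ((hf k).sub hh) ((hf k).sub hg) le_rfl
    rw [add_comm]
    refine le_trans (le_of_eq ?_) h5
    congr 1
    funext x
    simp
  have := (eLpNorm_eq_zero_iff (hg.sub hh) one_ne_zero).1 (le_antisymm h3 bot_le)
  filter_upwards [this] with x hx
  exact sub_eq_zero.1 hx

section HalfSpace

variable {d : ℕ}

/-- The restriction of smooth compactly supported functions to the boundary of the half-space. -/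
noncomputable def halfSpaceRestrict (d : ℕ) :
    smoothCompact (d + 1) →ₗ[ℝ] Lp ℝ 1 (volume : Measure (Euc d)) :=
  restrictLp volume (fun x => withLast x 0) fun _ hφ => hφ.comp_withLast_zero.memLp 1 _

/-- The gradient as a map into the closure of its range. -/
noncomputable def gradClosure (d : ℕ) :
    smoothCompact (d + 1) →ₗ[ℝ] (LinearMap.range (gradLp (halfSpace d))).topologicalClosure :=
  (gradLp (halfSpace d)).codRestrict _ fun φ =>
    Submodule.le_topologicalClosure _ (LinearMap.mem_range_self _ φ)

lemma denseRange_gradClosure : DenseRange (gradClosure d) := by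
  intro x
  obtain ⟨y, hy, hyx⟩ := mem_closure_iff_seq_limit.1 x.2
  choose φ hφ using hy
  refine mem_closure_iff_seq_limit.2 ⟨fun k => gradClosure d (φ k), fun k => ⟨φ k, rfl⟩, ?_⟩
  refine tendsto_subtype_rng.2 ?_
  refine hyx.congr fun k => ?_
  rw [← hφ k]; rfl

/-- The trace inequality in operator form: boundary values depend only on the gradient, and
continuously so. It lets the restriction extend to the closure of the gradients. -/
lemma norm_halfSpaceRestrict_le (φ : smoothCompact (d + 1)) :
    ‖halfSpaceRestrict d φ‖ ≤ 1 * ‖gradClosure d φ‖ := by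
  rw [one_mul]
  have h1 : ‖halfSpaceRestrict d φ‖ =
      (eLpNorm (fun x => φ.1 (withLast x 0)) 1 volume).toReal :=
    Lp.norm_toLp _ (φ.2.comp_withLast_zero.memLp 1 _)
  have h2 : ‖gradClosure d φ‖ = (eLpNorm (gradient φ.1) 1 (vol (halfSpace d))).toReal :=
    Lp.norm_toLp _ (φ.2.memLp_gradient 1 _)
  rw [h1, h2]
  refine ENNReal.toReal_mono (φ.2.memLp_gradient 1 _).2.ne ?_
  rw [eLpNorm_one_eq_lintegral_enorm, eLpNorm_one_eq_lintegral_enorm]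
  exact φ.2.lintegral_withLast_zero_le

lemma tendsto_gradLp {U : Set (Euc (d + 1))} {φ : ℕ → Euc (d + 1) → ℝ}
    (hφ : ∀ k, IsSmoothCompact (φ k)) {G : Lp (Euc (d + 1)) 1 (vol U)}
    (h : Tendsto (fun k => eLpNorm (fun x => gradient (φ k) x - G x) 1 (vol U)) atTop (𝓝 0)) :
    Tendsto (fun k => gradLp U ⟨φ k, hφ k⟩) atTop (𝓝 G) :=
  (tendsto_toLp_iff (fun k => (hφ k).memLp_gradient 1 (vol U)) G).2 h

/-- Gradients of elements of `HomW11` lie in the domain of the extended restriction, so the trace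
can be defined from the gradient component alone. -/
lemma homW11grad_mem (w : HomW11 d) :
    homW11grad w ∈ (LinearMap.range (gradLp (halfSpace d))).topologicalClosure := by
  obtain ⟨φ, hφ, -, h⟩ := w.2
  exact mem_closure_iff_seq_limit.2 ⟨_, fun k => ⟨⟨φ k, hφ k⟩, rfl⟩, tendsto_gradLp hφ h⟩

/-- The trace operator of the half-space. -/
noncomputable def halfSpaceTrace (d : ℕ) :
    HomW11 d →ₗ[ℝ] Lp ℝ 1 (volume : Measure (Euc d)) :=
  ((halfSpaceRestrict d).extendOfNorm (gradClosure d)).toLinearMap ∘ₗ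
    (LinearMap.codRestrict _ ((LinearMap.snd ℝ _ _) ∘ₗ (HomW11 d).subtype) homW11grad_mem)

lemma isHalfSpaceTraceOperator_halfSpaceTrace : IsHalfSpaceTraceOperator (halfSpaceTrace d) := by
  refine ⟨⟨1, fun w => LinearMap.norm_extendOfNorm_apply_le denseRange_gradClosure 1
    norm_halfSpaceRestrict_le _⟩, fun w φ hφ h => ?_⟩
  rw [← tendsto_toLp_iff fun k => (hφ k).comp_withLast_zero.memLp 1 _]
  have h1 : Tendsto (fun k => gradClosure d ⟨φ k, hφ k⟩) atTop
      (𝓝 ⟨homW11grad w, homW11grad_mem w⟩) := tendsto_subtype_rng.2 (tendsto_gradLp hφ h)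
  have h2 := (((halfSpaceRestrict d).extendOfNorm (gradClosure d)).continuous.tendsto _).comp h1
  refine h2.congr fun k => ?_
  exact LinearMap.extendOfNorm_eq denseRange_gradClosure ⟨1, norm_halfSpaceRestrict_le⟩ _

lemma IsHalfSpaceTraceOperator.unique {γ γ' : HomW11 d →ₗ[ℝ] Lp ℝ 1 (volume : Measure (Euc d))}
    (h : IsHalfSpaceTraceOperator γ) (h' : IsHalfSpaceTraceOperator γ') : γ' = γ := by
  ext1 w
  obtain ⟨φ, hφ, -, hG⟩ := w.2
  exact Lp.ext (ae_eq_of_tendsto_eLpNorm_one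
    (fun k => (hφ k).comp_withLast_zero.1.continuous.aestronglyMeasurable)
    (Lp.aestronglyMeasurable _) (Lp.aestronglyMeasurable _) (h'.2 w φ hφ hG) (h.2 w φ hφ hG))

lemma IsHalfSpaceTraceOperator.exists_extension
    {γ : HomW11 d →ₗ[ℝ] Lp ℝ 1 (volume : Measure (Euc d))} (h : IsHalfSpaceTraceOperator γ)
    {f : Euc d → ℝ} (hf : MemLp f 1 volume) {q : ℝ≥0∞} (hq : 1 ≤ q) (hq' : q ≠ ⊤) :
    ∃ w : HomW11 d, MemLp (homW11fun w) q (vol (halfSpace d)) ∧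
      (MemLp f ⊤ volume → MemLp (homW11fun w) ⊤ (vol (halfSpace d))) ∧ γ w =ᵐ[volume] f := by
  obtain ⟨φ, hφ, u, G, hu, hG, hf1, hq1, hb⟩ := hasLayerBound_halfSpace.exists_extension
    (fun _ hc hs => lintegral_comp_withLast_zero_ne_top hc hs) hasDenseRestrictions_halfSpace
    continuous_withLast_zero.measurable (Eventually.of_forall fun x => withLast_last x 0) hf hq hq'
  refine ⟨⟨(u.1, G), φ, hφ, fun K _ hKs => ?_, hG⟩, hq1, hb, ?_⟩
  · refine tendsto_of_tendsto_of_tendsto_of_le_of_le tendsto_const_nhds hu (fun _ => bot_le)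
      fun k => ?_
    exact eLpNorm_mono_measure _ (Measure.restrict_mono hKs le_rfl)
  · exact ae_eq_of_tendsto_eLpNorm_one
      (fun k => (hφ k).comp_withLast_zero.1.continuous.aestronglyMeasurable)
      (Lp.aestronglyMeasurable _) hf.1 (h.2 _ φ hφ hG) hf1

lemma volume_firstCoords_mem_last_mem {D : Set (Euc d)} (hD : MeasurableSet D) {I : Set ℝ}
    (hI : MeasurableSet I) :
    volume {y : Euc (d + 1) | firstCoords y ∈ D ∧ y (Fin.last d) ∈ I} =
      volume D * volume I := by
  have hm : MeasurableSet {y : Euc (d + 1) | firstCoords y ∈ D ∧ y (Fin.last d) ∈ I} :=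
    (lipschitzWith_firstCoords.continuous.measurable hD).inter (continuous_last.measurable hI)
  rw [← measurePreserving_withLast.measure_preimage hm.nullMeasurableSet, ← Measure.prod_prod]
  congr 1
  ext z
  simp [firstCoords_withLast, withLast_last]

lemma lintegral_enorm_le_add_eLpNorm {α E : Type*} [MeasurableSpace α] {μ : Measure α}
    [NormedAddCommGroup E] {f g : α → E} (hg : AEStronglyMeasurable g μ)
    (s : Set α) :
    ∫⁻ x in s, ‖f x‖ₑ ∂μ ≤ ∫⁻ x in s, ‖g x‖ₑ ∂μ + eLpNorm (fun x => f x - g x) 1 μ := by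
  rw [eLpNorm_one_eq_lintegral_enorm]
  refine le_trans ?_ (add_le_add le_rfl (setLIntegral_le_lintegral s _))
  rw [← lintegral_add_left' (hg.enorm.mono_measure Measure.restrict_le_self)]
  refine lintegral_mono fun x => ?_
  calc ‖f x‖ₑ = ‖g x + (f x - g x)‖ₑ := by rw [add_sub_cancel]
    _ ≤ _ := enorm_add_le _ _

/-- The points over the closed ball of radius `R` at height between `ε` and `2 ε`. -/
def slab (d : ℕ) (R ε : ℝ) : Set (Euc (d + 1)) :=
  {y | firstCoords y ∈ Metric.closedBall (0 : Euc d) R ∧ y (Fin.last d) ∈ Icc ε (2 * ε)}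

lemma isCompact_slab (R : ℝ) {ε : ℝ} (hε : 0 < ε) : IsCompact (slab d R ε) := by
  refine Metric.isCompact_of_isClosed_isBounded ?_ ?_
  · exact (Metric.isClosed_closedBall.preimage lipschitzWith_firstCoords.continuous).inter
      (isClosed_Icc.preimage continuous_last)
  · refine (Metric.isBounded_closedBall (x := 0) (r := R + 2 * ε)).subset fun y hy => ?_
    have h1 := norm_withLast_le (firstCoords y) (y (Fin.last d))
    rw [withLast_firstCoords] at h1
    have h2 := mem_closedBall_zero_iff.1 hy.1
    rw [mem_closedBall_zero_iff]
    have h3 : |y (Fin.last d)| ≤ 2 * ε := by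
      rw [abs_of_nonneg (hε.le.trans hy.2.1)]; exact hy.2.2
    linarith

lemma slab_subset_halfSpace (R : ℝ) {ε : ℝ} (hε : 0 < ε) : slab d R ε ⊆ halfSpace d :=
  fun _ hy => hε.trans_le hy.2.1

/-- The trace inequality over D, averaged over heights in (ε, 2ε], with φ, its gradient and its
boundary values replaced by u, G and g at the cost of three errors. The slab stays at positive
height because in `HomW11` functions converge only on compact subsets of the open half-space. -/
lemma IsSmoothCompact.lintegral_trace_le {φ : Euc (d + 1) → ℝ} (hφ : IsSmoothCompact φ)
    {u : Euc (d + 1) → ℝ} {G : Euc (d + 1) → Euc (d + 1)} {g : Euc d → ℝ}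
    (hu : AEStronglyMeasurable u (vol (halfSpace d)))
    (hG : AEStronglyMeasurable G (vol (halfSpace d))) {M : ℝ≥0∞}
    (hM : ∀ᵐ y ∂(vol (halfSpace d)), ‖u y‖ₑ ≤ M) {D : Set (Euc d)} (hD : MeasurableSet D) {R : ℝ}
    (hR : D ⊆ Metric.closedBall 0 R) {ε : ℝ} (hε : 0 < ε) :
    ENNReal.ofReal ε * ∫⁻ x in D, ‖g x‖ₑ ≤
      (ENNReal.ofReal ε * (M * volume D) + eLpNorm (fun x => φ x - u x) 1 (vol (slab d R ε))) +
      (ENNReal.ofReal ε * ((∫⁻ y in {y | y (Fin.last d) ∈ Ioc 0 (2 * ε)}, ‖G y‖ₑ) +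
        eLpNorm (fun x => gradient φ x - G x) 1 (vol (halfSpace d))) +
      ENNReal.ofReal ε * eLpNorm (fun x' => φ (withLast x' 0) - g x') 1 volume) := by
  have hKs := slab_subset_halfSpace (d := d) R hε
  set A : Set (Euc (d + 1)) := {y | firstCoords y ∈ D ∧ y (Fin.last d) ∈ Ioc ε (2 * ε)} with hA
  have hAm : MeasurableSet A :=
    (lipschitzWith_firstCoords.continuous.measurable hD).inter
      (continuous_last.measurable measurableSet_Ioc)
  have hAK : A ⊆ slab d R ε := fun y hy => ⟨hR hy.1, Ioc_subset_Icc_self hy.2⟩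
  set S : Set (Euc (d + 1)) := {y | y (Fin.last d) ∈ Ioc 0 (2 * ε)} with hS
  have hSm : MeasurableSet S := continuous_last.measurable measurableSet_Ioc
  have hSsub : S ⊆ halfSpace d := fun y hy => hy.1
  have hrS : (vol (halfSpace d)).restrict S = vol S := by
    rw [Measure.restrict_restrict hSm, inter_eq_left.2 hSsub]
  have hrA : (vol (slab d R ε)).restrict A = vol A := by
    rw [Measure.restrict_restrict hAm, inter_eq_left.2 hAK]
  have hae : ∀ᵐ y ∂(vol A), ‖u y‖ₑ ≤ M :=
    ae_mono (Measure.restrict_mono (hAK.trans hKs) le_rfl) hM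
  have hAu : ∫⁻ y in A, ‖u y‖ₑ ≤ ENNReal.ofReal ε * (M * volume D) := by
    refine (lintegral_mono_ae hae).trans (le_of_eq ?_)
    rw [lintegral_const, Measure.restrict_apply_univ, hA,
      volume_firstCoords_mem_last_mem hD measurableSet_Ioc, Real.volume_Ioc]
    rw [show 2 * ε - ε = ε by ring]
    ring
  have h1 := hφ.lintegral_graphMap_zero_le (LinearIsometryEquiv.refl ℝ (Euc (d + 1)))
    (ψ := (0 : Euc d → ℝ)) continuous_const (D := D) (a := ε) (b := 2 * ε) hε.le hAm hSm
    (fun x hx t ht => by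
      rw [graphMap_refl_zero]
      exact ⟨by rwa [firstCoords_withLast], by rwa [withLast_last]⟩)
    (fun x hx t ht => by
      rw [graphMap_refl_zero, hS, mem_ofPred_eq, withLast_last]; exact ht)
  rw [show 2 * ε - ε = ε by ring] at h1
  simp only [graphMap_refl_zero] at h1
  have h2 := lintegral_enorm_le_add_eLpNorm (μ := vol (slab d R ε)) (f := φ)
    (hu.mono_measure (Measure.restrict_mono hKs le_rfl)) A
  rw [hrA] at h2
  have h3 := lintegral_enorm_le_add_eLpNorm (μ := vol (halfSpace d)) (f := gradient φ) hG S
  rw [hrS] at h3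
  have h4 := lintegral_enorm_le_add_eLpNorm (μ := volume) (f := g)
    hφ.comp_withLast_zero.1.continuous.aestronglyMeasurable D
  have h5 : eLpNorm (fun x => g x - φ (withLast x 0)) 1 volume =
    eLpNorm (fun x => φ (withLast x 0) - g x) 1 volume := eLpNorm_sub_comm _ _ _ _
  rw [h5] at h4
  calc _ ≤ ENNReal.ofReal ε * ((∫⁻ x in D, ‖φ (withLast x 0)‖ₑ) +
        eLpNorm (fun x => φ (withLast x 0) - g x) 1 volume) := by gcongr
    _ ≤ ((∫⁻ y in A, ‖φ y‖ₑ) + ENNReal.ofReal ε * ∫⁻ y in S, ‖gradient φ y‖ₑ) +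
        ENNReal.ofReal ε * eLpNorm (fun x => φ (withLast x 0) - g x) 1 volume := by
      rw [mul_add]; gcongr
    _ ≤ _ := by
      rw [add_assoc]
      exact add_le_add (h2.trans (add_le_add hAu le_rfl)) (by gcongr)

/-- The trace of a bounded function over a bounded set of the boundary, up to the gradient in a
strip. -/
lemma IsHalfSpaceTraceOperator.lintegral_le_strip
    {γ : HomW11 d →ₗ[ℝ] Lp ℝ 1 (volume : Measure (Euc d))} (h : IsHalfSpaceTraceOperator γ)
    (w : HomW11 d) {M : ℝ≥0∞} (hM : ∀ᵐ y ∂(vol (halfSpace d)), ‖homW11fun w y‖ₑ ≤ M)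
    {D : Set (Euc d)} (hD : MeasurableSet D) (hDb : Bornology.IsBounded D) {ε : ℝ} (hε : 0 < ε) :
    ∫⁻ x in D, ‖γ w x‖ₑ ≤ M * volume D +
      ∫⁻ y in {y | y (Fin.last d) ∈ Ioc 0 (2 * ε)}, ‖homW11grad w y‖ₑ := by
  obtain ⟨φ, hφ, hu, hG⟩ := w.2
  have ht := h.2 w φ hφ hG
  obtain ⟨R, hR⟩ := hDb.subset_closedBall 0
  have hk := fun k => (hφ k).lintegral_trace_le (g := γ w) w.1.1.aestronglyMeasurable
    (Lp.aestronglyMeasurable (homW11grad w)) hM hD hR hε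
  have hε0 : ENNReal.ofReal ε ≠ 0 := by simpa using hε
  have t1 := (hu _ (isCompact_slab R hε) (slab_subset_halfSpace R hε)).const_add
    (ENNReal.ofReal ε * (M * volume D))
  have t2 := ENNReal.Tendsto.const_mul (a := ENNReal.ofReal ε)
    (hG.const_add (∫⁻ y in {y | y (Fin.last d) ∈ Ioc 0 (2 * ε)}, ‖homW11grad w y‖ₑ))
    (Or.inr ENNReal.ofReal_ne_top)
  have t3 := ENNReal.Tendsto.const_mul (a := ENNReal.ofReal ε) ht (Or.inr ENNReal.ofReal_ne_top)
  -- As k grows with ε fixed the three approximation errors vanish; then the common factor ε is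
  -- cancelled.
  have hlim := ge_of_tendsto' (t1.add (t2.add t3)) hk
  rw [add_zero, add_zero, mul_zero, add_zero, ← mul_add] at hlim
  exact (ENNReal.mul_le_mul_iff_right hε0 ENNReal.ofReal_ne_top).1 hlim

/-- As the strip shrinks, its gradient integral tends to 0 by dominated convergence. Thus the
integral of |γ w| over any bounded measurable D is at most M times the volume of D, which forces |γ
w| ≤ M almost everywhere. -/
lemma IsHalfSpaceTraceOperator.memLp_top
    {γ : HomW11 d →ₗ[ℝ] Lp ℝ 1 (volume : Measure (Euc d))} (h : IsHalfSpaceTraceOperator γ)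
    (w : HomW11 d) (hw : MemLp (homW11fun w) ⊤ (vol (halfSpace d))) : MemLp (γ w) ⊤ volume := by
  set M := eLpNorm (homW11fun w) ⊤ (vol (halfSpace d)) with hMdef
  have hM : ∀ᵐ y ∂(vol (halfSpace d)), ‖homW11fun w y‖ₑ ≤ M := by
    rw [hMdef, eLpNorm_exponent_top]; exact ae_le_eLpNormEssSup
  have hstrip : Tendsto (fun k : ℕ => ∫⁻ y in {y | y (Fin.last d) ∈ Ioc 0 (2 * (1 / ((k : ℝ) + 1)))},
      ‖homW11grad w y‖ₑ) atTop (𝓝 0) := by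
    have hm : ∀ k : ℕ, MeasurableSet {y : Euc (d + 1) | y (Fin.last d) ∈
        Ioc (0 : ℝ) (2 * (1 / ((k : ℝ) + 1)))} := fun k =>
      continuous_last.measurable measurableSet_Ioc
    have hr : ∀ k : ℕ, vol {y : Euc (d + 1) | y (Fin.last d) ∈ Ioc (0 : ℝ) (2 * (1 / ((k : ℝ) + 1)))}
        = (vol (halfSpace d)).restrict {y : Euc (d + 1) | y (Fin.last d) ∈
          Ioc (0 : ℝ) (2 * (1 / ((k : ℝ) + 1)))} := fun k => by
      rw [Measure.restrict_restrict (hm k), inter_eq_left.2 fun y hy => hy.1]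
    simp only [hr, ← lintegral_indicator (hm _)]
    rw [← lintegral_zero (μ := vol (halfSpace d))]
    refine tendsto_lintegral_of_dominated_convergence' (fun y => ‖homW11grad w y‖ₑ)
      (fun k => (Lp.aestronglyMeasurable (homW11grad w)).enorm.indicator (hm k))
      (fun k => Eventually.of_forall fun y => indicator_le_self _ _ _)
      (L1.integrable_coeFn (homW11grad w)).2.ne (Eventually.of_forall fun y => ?_)
    refine tendsto_const_nhds.congr' ?_
    have ht : Tendsto (fun k : ℕ => 2 * (1 / ((k : ℝ) + 1))) atTop (𝓝 0) := by
      simpa using tendsto_one_div_add_atTop_nhds_zero_nat.const_mul (2 : ℝ)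
    by_cases hy : 0 < y (Fin.last d)
    · filter_upwards [ht.eventually (gt_mem_nhds hy)] with k hk
      rw [indicator_of_notMem]
      exact fun hmem => absurd hmem.2 (not_le.2 hk)
    · refine Eventually.of_forall fun k => ?_
      dsimp only
      rw [indicator_of_notMem]
      exact fun hmem => hy hmem.1
  have key : ∀ D : Set (Euc d), MeasurableSet D → Bornology.IsBounded D →
      ∫⁻ x in D, ‖γ w x‖ₑ ≤ ∫⁻ _ in D, M := by
    intro D hD hDb
    rw [lintegral_const, Measure.restrict_apply_univ]
    have := ge_of_tendsto' (hstrip.const_add (M * volume D)) fun k =>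
      h.lintegral_le_strip w hM hD hDb (ε := 1 / ((k : ℝ) + 1)) (by positivity)
    rwa [add_zero] at this
  -- The integral comparison is available on bounded sets only, so the pointwise bound is derived
  -- ball by ball.
  have hae : ∀ k : ℕ, ∀ᵐ x ∂(volume.restrict (Metric.closedBall (0 : Euc d) k)), ‖γ w x‖ₑ ≤ M := by
    intro k
    refine ae_le_of_forall_setLIntegral_le_of_sigmaFinite
      (Lp.stronglyMeasurable (γ w)).measurable.enorm fun s hs _ => ?_
    rw [Measure.restrict_restrict hs]
    exact key _ (hs.inter Metric.isClosed_closedBall.measurableSet)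
      (Metric.isBounded_closedBall.subset inter_subset_right)
  have hall : ∀ᵐ x : Euc d, ‖γ w x‖ₑ ≤ M := by
    have := fun k => (ae_restrict_iff' Metric.isClosed_closedBall.measurableSet).1 (hae k)
    filter_upwards [ae_all_iff.2 this] with x hx
    obtain ⟨k, hk⟩ := exists_nat_ge ‖x‖
    exact hx k (by rwa [mem_closedBall_zero_iff])
  refine ⟨Lp.aestronglyMeasurable _, ?_⟩
  rw [eLpNorm_exponent_top]
  exact (essSup_le_of_ae_le M hall).trans_lt hw.2

theorem halfSpace_trace (d : ℕ) :
    ∃ γ : HomW11 d →ₗ[ℝ] Lp ℝ 1 (volume : Measure (Euc d)),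
      IsHalfSpaceTraceOperator γ ∧
      (∀ γ', IsHalfSpaceTraceOperator γ' → γ' = γ) ∧
      (∀ q : ℝ≥0∞, 1 ≤ q → q < ⊤ → halfSpaceTraceSpace γ q = {f | MemLp f 1 volume}) ∧
      halfSpaceTraceSpace γ ⊤ = {f | MemLp f 1 volume ∧ MemLp f ⊤ volume} := by
  have hγ := isHalfSpaceTraceOperator_halfSpaceTrace (d := d)
  refine ⟨halfSpaceTrace d, hγ, fun γ' h => hγ.unique h, fun q hq hq' => ?_, ?_⟩
  · ext f
    constructor
    · rintro ⟨w, -, hw⟩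
      exact (memLp_congr_ae hw).1 (Lp.memLp _)
    · intro hf
      obtain ⟨w, hw, -, hwf⟩ := hγ.exists_extension hf hq hq'.ne
      exact ⟨w, hw, hwf⟩
  · ext f
    constructor
    · rintro ⟨w, hw, hwf⟩
      exact ⟨(memLp_congr_ae hwf).1 (Lp.memLp _), (memLp_congr_ae hwf).1 (hγ.memLp_top w hw)⟩
    · rintro ⟨hf, hb⟩
      obtain ⟨w, -, hw, hwf⟩ := hγ.exists_extension hf le_rfl ENNReal.one_ne_top
      exact ⟨w, hw hb, hwf⟩

end HalfSpace

end TraceL1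

/-! ### Charts of a Lipschitz boundary -/

namespace TraceL1

variable {d : ℕ}

/-- The signed height of `y` over the graph of `ψ`, in the coordinates `e`. -/
noncomputable def graphHeight (e : Euc (d + 1) ≃ₗᵢ[ℝ] Euc (d + 1)) (ψ : Euc d → ℝ) (y : Euc (d + 1)) : ℝ :=
  e y (Fin.last d) - ψ (firstCoords (e y))

lemma graphMap_graphHeight (e : Euc (d + 1) ≃ₗᵢ[ℝ] Euc (d + 1)) (ψ : Euc d → ℝ)
    (y : Euc (d + 1)) : graphMap e ψ (firstCoords (e y)) (graphHeight e ψ y) = y :=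
  graphMap_surj e ψ y

lemma graphHeight_graphMap (e : Euc (d + 1) ≃ₗᵢ[ℝ] Euc (d + 1)) (ψ : Euc d → ℝ) (x : Euc d)
    (t : ℝ) : graphHeight e ψ (graphMap e ψ x t) = t := by
  rw [graphHeight, last_graphMap, firstCoords_graphMap, add_sub_cancel_left]

lemma dist_graphMap (e : Euc (d + 1) ≃ₗᵢ[ℝ] Euc (d + 1)) (ψ : Euc d → ℝ) (x : Euc d) (t : ℝ) :
    dist (graphMap e ψ x t) (graphMap e ψ x 0) = |t| := by
  rw [graphMap_eq, dist_eq_norm, add_sub_cancel_left, norm_smul, norm_upDir, mul_one,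
    Real.norm_eq_abs]

lemma graphHeight_add_smul (e : Euc (d + 1) ≃ₗᵢ[ℝ] Euc (d + 1)) (ψ : Euc d → ℝ)
    (y : Euc (d + 1)) (t : ℝ) : graphHeight e ψ (y + t • upDir e) = graphHeight e ψ y + t := by
  have h : y + t • upDir e = graphMap e ψ (firstCoords (e y)) (graphHeight e ψ y + t) := by
    rw [graphMap_eq e ψ _ (graphHeight e ψ y + t), add_smul, ← add_assoc, ← graphMap_eq,
      graphMap_graphHeight]
  rw [h, graphHeight_graphMap]

/-- Height over the graph is (1 + K)-Lipschitz. This turns distance to the boundary into height,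
both for the layer bound and for pushing inward. -/
lemma abs_graphHeight_sub_le (e : Euc (d + 1) ≃ₗᵢ[ℝ] Euc (d + 1)) {ψ : Euc d → ℝ} {K : ℝ≥0}
    (hψ : LipschitzWith K ψ) (y z : Euc (d + 1)) :
    |graphHeight e ψ y - graphHeight e ψ z| ≤ (1 + K) * dist y z := by
  have h1 := abs_last_le (e y - e z)
  rw [PiLp.sub_apply, ← dist_eq_norm, LinearIsometryEquiv.dist_map] at h1
  have h2 := hψ.dist_le_mul (firstCoords (e y)) (firstCoords (e z))
  have h3 := lipschitzWith_firstCoords.dist_le_mul (e y) (e z)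
  rw [LinearIsometryEquiv.dist_map, NNReal.coe_one, one_mul] at h3
  rw [Real.dist_eq] at h2
  have h4 : graphHeight e ψ y - graphHeight e ψ z = (e y (Fin.last d) - e z (Fin.last d)) -
      (ψ (firstCoords (e y)) - ψ (firstCoords (e z))) := by
    rw [graphHeight, graphHeight]; ring
  rw [h4]
  refine (abs_sub _ _).trans ?_
  have h5 : (K : ℝ) * dist (firstCoords (e y)) (firstCoords (e z)) ≤ K * dist y z := by gcongr
  linarith

/-- In the ball `B(x₀, r)`, the set `Ω` is the region above the graph of a Lipschitz function and
its boundary is the graph. -/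
structure IsGraphChart (Ω : Set (Euc (d + 1))) (x₀ : Euc (d + 1))
    (e : Euc (d + 1) ≃ₗᵢ[ℝ] Euc (d + 1)) (ψ : Euc d → ℝ) (K : ℝ≥0) (r : ℝ) : Prop where
  lipschitz : LipschitzWith K ψ
  mem : x₀ ∈ frontier Ω
  pos : 0 < r
  mem_iff : ∀ y ∈ Metric.ball x₀ r, y ∈ Ω ↔ 0 < graphHeight e ψ y
  mem_frontier_iff : ∀ y ∈ Metric.ball x₀ r, y ∈ frontier Ω ↔ graphHeight e ψ y = 0

variable {Ω : Set (Euc (d + 1))}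

/-- The frontier is the zero set of the height: negative height is an open condition that excludes
Ω, and a point of height zero is a limit of points of Ω obtained by moving up. -/
lemma HasLipschitzBoundary.exists_chart (hL : HasLipschitzBoundary Ω) (hΩ : IsOpen Ω)
    {x₀ : Euc (d + 1)} (hx₀ : x₀ ∈ frontier Ω) : ∃ e ψ K r, IsGraphChart Ω x₀ e ψ K r := by
  obtain ⟨e, ψ, K, r, hψ, hr, hmem⟩ := hL x₀ hx₀
  have hmem' : ∀ y ∈ Metric.ball x₀ r, y ∈ Ω ↔ 0 < graphHeight e ψ y := fun y hy => by
    rw [hmem y hy, graphHeight, sub_pos]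
  have hcont : Continuous (graphHeight e ψ) := by
    have h1 := (lipschitzWith_firstCoords (d := d)).continuous.comp e.continuous
    exact ((continuous_last.comp e.continuous)).sub (hψ.continuous.comp h1)
  refine ⟨e, ψ, K, r, hψ, hx₀, hr, hmem', fun y hy => ?_⟩
  rw [frontier, hΩ.interior_eq, Set.mem_sdiff]
  constructor
  · rintro ⟨hcl, hnot⟩
    rw [hmem' y hy, not_lt] at hnot
    refine le_antisymm hnot (not_lt.1 fun hlt => ?_)
    obtain ⟨z, ⟨hz1, hz2⟩, hz3⟩ := mem_closure_iff.1 hcl _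
      ((isOpen_lt hcont continuous_const).inter Metric.isOpen_ball) ⟨hlt, hy⟩
    exact absurd ((hmem' z hz2).1 hz3) (not_lt.2 (le_of_lt hz1))
  · intro h0
    refine ⟨?_, fun h => ((hmem' y hy).1 h).ne' h0⟩
    have ht : Tendsto (fun t : ℝ => y + t • upDir e) (𝓝[>] 0) (𝓝 y) := by
      have : Continuous fun t : ℝ => y + t • upDir e := by fun_prop
      simpa using (this.tendsto 0).mono_left nhdsWithin_le_nhds
    refine mem_closure_of_tendsto ht ?_
    filter_upwards [ht.eventually (Metric.isOpen_ball.mem_nhds hy), self_mem_nhdsWithin]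
      with t h1 h2
    rw [hmem' _ h1, graphHeight_add_smul, h0, zero_add]
    exact h2

section Chart

variable {x₀ : Euc (d + 1)} {e : Euc (d + 1) ≃ₗᵢ[ℝ] Euc (d + 1)} {ψ : Euc d → ℝ} {K : ℝ≥0} {r : ℝ}

lemma IsGraphChart.subset_range (hc : IsGraphChart Ω x₀ e ψ K r) :
    frontier Ω ∩ Metric.ball x₀ r ⊆ range fun x => graphMap e ψ x 0 := by
  rintro y ⟨hy1, hy2⟩
  refine ⟨firstCoords (e y), ?_⟩
  have := graphMap_graphHeight e ψ y
  rwa [(hc.mem_frontier_iff y hy2).1 hy1] at this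

lemma IsGraphChart.graphMap_mem_frontier (hc : IsGraphChart Ω x₀ e ψ K r) {x : Euc d}
    (hx : graphMap e ψ x 0 ∈ Metric.ball x₀ r) : graphMap e ψ x 0 ∈ frontier Ω :=
  (hc.mem_frontier_iff _ hx).2 (graphHeight_graphMap e ψ x 0)

lemma volume_preimage_ball_lt_top (e : Euc (d + 1) ≃ₗᵢ[ℝ] Euc (d + 1)) (ψ : Euc d → ℝ)
    (x₀ : Euc (d + 1)) (r : ℝ) :
    volume ((fun x => graphMap e ψ x 0) ⁻¹' Metric.ball x₀ r) < ⊤ := by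
  refine (measure_mono fun x hx => ?_).trans_lt
    (measure_ball_lt_top (x := firstCoords (e x₀)) (r := r))
  have h := lipschitzWith_firstCoords.dist_le_mul (e (graphMap e ψ x 0)) (e x₀)
  rw [firstCoords_graphMap, LinearIsometryEquiv.dist_map, NNReal.coe_one, one_mul] at h
  exact h.trans_lt hx

lemma IsGraphChart.measure_lt_top (hc : IsGraphChart Ω x₀ e ψ K r) :
    Measure.euclideanHausdorffMeasure d (frontier Ω ∩ Metric.ball x₀ r) < ⊤ := by
  refine (euclideanHausdorffMeasure_le_volume_preimage e hc.lipschitz hc.subset_range).trans_lt ?_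
  refine ENNReal.mul_lt_top (ENNReal.pow_lt_top ENNReal.coe_lt_top) ?_
  exact (measure_mono fun x hx => hx.2).trans_lt (volume_preimage_ball_lt_top e ψ x₀ r)

/-- From a boundary point within r/2 of the centre, segments of length r/2 in the direction `upDir
e` stay in the chart ball, hence in Ω. Averaging over them costs the factor (r/2)⁻¹, and passing to
surface measure costs (1 + K)^d. -/
lemma IsGraphChart.trace_le (hc : IsGraphChart Ω x₀ e ψ K r) (hΩ : MeasurableSet Ω) :
    ∃ C : ℝ≥0, ∀ φ : Euc (d + 1) → ℝ, IsSmoothCompact φ →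
      ∫⁻ y in frontier Ω ∩ Metric.ball x₀ (r / 2), ‖φ y‖ₑ ∂Measure.euclideanHausdorffMeasure d ≤
        C * ((∫⁻ y in Ω, ‖φ y‖ₑ) + ∫⁻ y in Ω, ‖gradient φ y‖ₑ) := by
  have hr := hc.pos
  set T := frontier Ω ∩ Metric.ball x₀ (r / 2) with hT
  have hTr : T ⊆ range fun x => graphMap e ψ x 0 :=
    (inter_subset_inter_right _ (Metric.ball_subset_ball (by linarith))).trans hc.subset_range
  have hb : (0 : ℝ) < r / 2 := by linarith
  refine ⟨(1 + K) ^ d * ((r / 2).toNNReal⁻¹ + 1), fun φ hφ => ?_⟩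
  have hmem : ∀ x ∈ (fun x => graphMap e ψ x 0) ⁻¹' T, ∀ t ∈ Ioc 0 (r / 2),
      graphMap e ψ x t ∈ Ω := by
    intro x hx t ht
    rw [hc.mem_iff, graphHeight_graphMap]
    · exact ht.1
    · have h1 := dist_graphMap e ψ x t
      rw [abs_of_pos ht.1] at h1
      have h2 : dist (graphMap e ψ x 0) x₀ < r / 2 := hx.2
      rw [Metric.mem_ball]
      linarith [dist_triangle (graphMap e ψ x t) (graphMap e ψ x 0) x₀, ht.2]
  have h1 := hφ.lintegral_graphMap_zero_le e hc.lipschitz.continuous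
    (D := (fun x => graphMap e ψ x 0) ⁻¹' T) (a := 0) (b := r / 2) le_rfl hΩ hΩ hmem hmem
  rw [sub_zero] at h1
  have h2 := lintegral_le_lintegral_graphMap_zero e hc.lipschitz hTr Subset.rfl
    hφ.1.continuous.measurable.enorm
  refine h2.trans ?_
  have hb0 : ENNReal.ofReal (r / 2) ≠ 0 := by simpa using hb
  have h3 : ∫⁻ x in (fun x => graphMap e ψ x 0) ⁻¹' T, ‖φ (graphMap e ψ x 0)‖ₑ ≤
      (ENNReal.ofReal (r / 2))⁻¹ * (∫⁻ y in Ω, ‖φ y‖ₑ) + ∫⁻ y in Ω, ‖gradient φ y‖ₑ := by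
    rw [← ENNReal.mul_le_mul_iff_right hb0 ENNReal.ofReal_ne_top, mul_add, ← mul_assoc,
      ENNReal.mul_inv_cancel hb0 ENNReal.ofReal_ne_top, one_mul]
    exact h1
  have hcoe : (((r / 2).toNNReal⁻¹ : ℝ≥0) : ℝ≥0∞) = (ENNReal.ofReal (r / 2))⁻¹ :=
    ENNReal.coe_inv (by simpa using hb)
  rw [ENNReal.coe_mul, ENNReal.coe_pow, ENNReal.coe_add _ 1, hcoe, mul_assoc, ENNReal.coe_one]
  gcongr
  refine h3.trans ?_
  rw [add_mul, one_mul, mul_add]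
  gcongr
  · exact le_self_add
  · exact le_add_self

/-- For small ε, a point of the half-size ball closer than ε to the frontier is that close to a
frontier point of the chart, where the height is 0. Its own height is therefore at most (1 + K)ε,
and it lies in a thin layer above the graph. -/
lemma IsGraphChart.layer_le (hc : IsGraphChart Ω x₀ e ψ K r) (hΩ : MeasurableSet Ω)
    {h : Euc (d + 1) → ℝ} (hcont : Continuous h) (hs : HasCompactSupport h) {δ : ℝ≥0∞}
    (hδ : δ ≠ 0) :
    ∀ᶠ ε : ℝ in 𝓝[>] 0,
      ∫⁻ x in (Ω ∩ {x | Metric.infDist x (frontier Ω) < ε}) ∩ Metric.ball x₀ (r / 2), ‖h x‖ₑ ≤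
        ENNReal.ofReal ε * (ENNReal.ofReal (1 + K) * ∫⁻ b, ‖h b‖ₑ ∂(surfaceMeasure Ω) + δ) := by
  have hr := hc.pos
  have hLpos : (0 : ℝ) < 1 + K := by positivity
  have hpc : Continuous fun x => graphMap e ψ x 0 :=
    (lipschitzWith_graphMap_zero e hc.lipschitz).continuous
  set D := (fun x => graphMap e ψ x 0) ⁻¹' Metric.ball x₀ r with hD
  have hev := eventually_setLIntegral_le_of_layer e hc.lipschitz.continuous (D := D)
    (hpc.measurable Metric.isOpen_ball.measurableSet)
    (volume_preimage_ball_lt_top e ψ x₀ r).ne hLpos hcont hs hδ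
  have hev2 : ∀ᶠ ε : ℝ in 𝓝[>] 0, (1 + K : ℝ) * ε < r / 2 := by
    have : Continuous fun ε : ℝ => (1 + K : ℝ) * ε := by fun_prop
    have h2 := this.tendsto 0
    rw [mul_zero] at h2
    exact (h2.mono_left nhdsWithin_le_nhds).eventually (gt_mem_nhds (by linarith))
  filter_upwards [hev, hev2, self_mem_nhdsWithin] with ε h1 h2 hε
  have hε0 : (0 : ℝ) < ε := hε
  have hA : MeasurableSet ((Ω ∩ {x | Metric.infDist x (frontier Ω) < ε}) ∩
      Metric.ball x₀ (r / 2)) :=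
    (hΩ.inter (measurableSet_lt (Metric.continuous_infDist_pt _).measurable
      measurable_const)).inter Metric.isOpen_ball.measurableSet
  refine (h1 _ hA ?_).trans ?_
  · rintro x t ⟨⟨hx1, hx2⟩, hx3⟩
    have hxr : graphMap e ψ x t ∈ Metric.ball x₀ r :=
      Metric.ball_subset_ball (by linarith) hx3
    have ht0 := (hc.mem_iff _ hxr).1 hx1
    rw [graphHeight_graphMap] at ht0
    have hεr : ε ≤ (1 + K) * ε := by nlinarith [K.2]
    have hne : (frontier Ω).Nonempty := ⟨x₀, hc.mem⟩
    obtain ⟨y, hy, hyx⟩ := (Metric.infDist_lt_iff hne).1 hx2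
    have hyr : y ∈ Metric.ball x₀ r := by
      rw [Metric.mem_ball] at hx3 ⊢
      rw [dist_comm] at hyx
      linarith [dist_triangle y (graphMap e ψ x t) x₀]
    have h3 := abs_graphHeight_sub_le e hc.lipschitz (graphMap e ψ x t) y
    rw [graphHeight_graphMap, (hc.mem_frontier_iff y hyr).1 hy, sub_zero, abs_of_pos ht0] at h3
    have h4 : t ≤ (1 + K) * ε := h3.trans (by gcongr)
    refine ⟨?_, ht0, h4⟩
    have h5 := dist_graphMap e ψ x t
    rw [abs_of_pos ht0, dist_comm] at h5
    rw [Metric.mem_ball] at hx3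
    rw [hD, mem_preimage, Metric.mem_ball]
    linarith [dist_triangle (graphMap e ψ x 0) (graphMap e ψ x t) x₀]
  · gcongr
    exact lintegral_graphMap_zero_le e hc.lipschitz.continuous
      (fun x hx => hc.graphMap_mem_frontier hx) hcont.measurable.enorm

/-- Moving `closure Ω` slightly in the direction `upDir e` brings it into `Ω`, with room to spare. -/
lemma IsGraphChart.exists_push (hc : IsGraphChart Ω x₀ e ψ K r) :
    ∃ c t₀ : ℝ, 0 < c ∧ 0 < t₀ ∧ ∀ t ∈ Ioo 0 t₀, ∀ x ∈ closure Ω,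
      ∀ z ∈ Metric.ball x₀ (r / 2), dist z (x + t • upDir e) ≤ c * t → z ∈ Ω := by
  have hr := hc.pos
  have hLpos : (0 : ℝ) < 1 + K := by positivity
  -- The translation raises the height by t, and straying by at most c t lowers it by at most t/2.
  -- The bound r/4 keeps the original point x in the chart ball, since t + c t ≤ 2t < r/2.
  refine ⟨1 / (2 * (1 + K)), r / 4, by positivity, by positivity, fun t ht x hx z hz hd => ?_⟩
  have hc1 : 1 / (2 * (1 + K : ℝ)) * t ≤ t := by
    have : 1 / (2 * (1 + K : ℝ)) ≤ 1 := by
      rw [div_le_one (by positivity)]; nlinarith [K.2]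
    nlinarith [ht.1]
  have hxd : dist x (x + t • upDir e) = t := by
    rw [dist_eq_norm, sub_add_cancel_left, norm_neg, norm_smul, norm_upDir, mul_one,
      Real.norm_of_nonneg ht.1.le]
  have hxr : x ∈ Metric.ball x₀ r := by
    rw [Metric.mem_ball] at hz ⊢
    rw [dist_comm] at hd
    linarith [dist_triangle4 x (x + t • upDir e) z x₀, ht.2]
  have hx0 : 0 ≤ graphHeight e ψ x := by
    rw [closure_eq_self_union_frontier] at hx
    rcases hx with hx | hx
    · exact ((hc.mem_iff x hxr).1 hx).le
    · exact ((hc.mem_frontier_iff x hxr).1 hx).ge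
  rw [hc.mem_iff z (Metric.ball_subset_ball (by linarith) hz)]
  have h1 := abs_graphHeight_sub_le e hc.lipschitz z (x + t • upDir e)
  rw [graphHeight_add_smul] at h1
  have h2 : (1 + K : ℝ) * dist z (x + t • upDir e) ≤ t / 2 := by
    calc _ ≤ (1 + K : ℝ) * (1 / (2 * (1 + K)) * t) := by gcongr
      _ = t / 2 := by field_simp
  have h3 := (abs_le.1 (h1.trans h2)).1
  linarith [ht.1]

end Chart

/-! ### From charts to the whole boundary -/

section Global

lemma isCompact_frontier_of_isBounded (hb : Bornology.IsBounded Ω) : IsCompact (frontier Ω) :=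
  Metric.isCompact_of_isClosed_isBounded isClosed_frontier
    (hb.closure.subset frontier_subset_closure)

/-- A set with empty frontier is clopen in a connected space, and the whole space is unbounded. -/
lemma eq_empty_of_frontier_eq_empty (hb : Bornology.IsBounded Ω) (h : frontier Ω = ∅) : Ω = ∅ := by
  rcases isClopen_iff.1 (isClopen_iff_frontier_eq_empty.2 h) with h | h
  · exact h
  · rw [h] at hb
    exact absurd hb (NormedSpace.unbounded_univ ℝ (Euc (d + 1)))

lemma isFiniteMeasure_surfaceMeasure (hΩ : IsOpen Ω) (hb : Bornology.IsBounded Ω)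
    (hL : HasLipschitzBoundary Ω) : IsFiniteMeasure (surfaceMeasure Ω) := by
  refine ⟨?_⟩
  rw [surfaceMeasure, Measure.restrict_apply_univ]
  refine (isCompact_frontier_of_isBounded hb).measure_lt_top_of_nhdsWithin fun x hx => ?_
  obtain ⟨e, ψ, K, r, hc⟩ := hL.exists_chart hΩ hx
  exact ⟨_, inter_mem_nhdsWithin _ (Metric.ball_mem_nhds x hc.pos), hc.measure_lt_top⟩

/-- The trace inequality in a Lipschitz domain. -/
lemma HasLipschitzBoundary.exists_trace_le (hL : HasLipschitzBoundary Ω) (hΩ : IsOpen Ω)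
    (hb : Bornology.IsBounded Ω) :
    ∃ C : ℝ≥0, ∀ φ : Euc (d + 1) → ℝ, IsSmoothCompact φ →
      ∫⁻ y, ‖φ y‖ₑ ∂(surfaceMeasure Ω) ≤
        C * ((∫⁻ y in Ω, ‖φ y‖ₑ) + ∫⁻ y in Ω, ‖gradient φ y‖ₑ) := by
  refine (isCompact_frontier_of_isBounded hb).induction_on
    (p := fun s => ∃ C : ℝ≥0, ∀ φ : Euc (d + 1) → ℝ, IsSmoothCompact φ →
      ∫⁻ y in s, ‖φ y‖ₑ ∂Measure.euclideanHausdorffMeasure d ≤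
        C * ((∫⁻ y in Ω, ‖φ y‖ₑ) + ∫⁻ y in Ω, ‖gradient φ y‖ₑ)) ?_ ?_ ?_ ?_
  · exact ⟨0, fun φ _ => by simp⟩
  · rintro s t hst ⟨C, hC⟩
    exact ⟨C, fun φ hφ => (lintegral_mono_set hst).trans (hC φ hφ)⟩
  · rintro s t ⟨C, hC⟩ ⟨C', hC'⟩
    refine ⟨C + C', fun φ hφ => (lintegral_union_le _ s t).trans ?_⟩
    rw [ENNReal.coe_add, add_mul]
    exact add_le_add (hC φ hφ) (hC' φ hφ)
  · intro x hx
    obtain ⟨e, ψ, K, r, hc⟩ := hL.exists_chart hΩ hx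
    exact ⟨_, inter_mem_nhdsWithin _ (Metric.ball_mem_nhds x (half_pos hc.pos)),
      hc.trace_le hΩ.measurableSet⟩

lemma HasLipschitzBoundary.hasLayerBound (hL : HasLipschitzBoundary Ω) (hΩ : IsOpen Ω)
    (hb : Bornology.IsBounded Ω) :
    HasLayerBound Ω (frontier Ω) (surfaceMeasure Ω) (fun y => y) := by
  have hcomp := isCompact_frontier_of_isBounded hb
  -- The distance to the empty set is 0 by convention, so with an empty frontier the layers would be
  -- all of Ω; in that case Ω is itself empty.
  rcases (frontier Ω).eq_empty_or_nonempty with hemp | hne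
  · refine ⟨0, fun h _ _ δ _ => Eventually.of_forall fun ε => ?_⟩
    rw [eq_empty_of_frontier_eq_empty hb hemp]
    simp
  -- The induction carries an open neighbourhood V, because the layers are not contained in the
  -- frontier. Sufficiently thin layers lie in the final V by compactness.
  obtain ⟨V, hVo, hV, C, hC⟩ := hcomp.induction_on
    (p := fun s => ∃ V, IsOpen V ∧ s ⊆ V ∧ ∃ C : ℝ≥0, ∀ h : Euc (d + 1) → ℝ, Continuous h →
      HasCompactSupport h → ∀ δ : ℝ≥0∞, δ ≠ 0 → ∀ᶠ ε : ℝ in 𝓝[>] 0,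
        ∫⁻ x in (Ω ∩ {x | Metric.infDist x (frontier Ω) < ε}) ∩ V, ‖h x‖ₑ ≤
          ENNReal.ofReal ε * (C * ∫⁻ b, ‖h b‖ₑ ∂(surfaceMeasure Ω) + δ))
    ⟨∅, isOpen_empty, Subset.rfl, 0, fun h _ _ δ _ => by simp⟩
    (fun s t hst ⟨V, hVo, hV, hC⟩ => ⟨V, hVo, hst.trans hV, hC⟩)
    (fun s t ⟨V, hVo, hV, C, hC⟩ ⟨V', hVo', hV', C', hC'⟩ => by
      refine ⟨V ∪ V', hVo.union hVo', union_subset_union hV hV', C + C',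
        fun h hc hs δ hδ => ?_⟩
      have hδ2 : δ / 2 ≠ 0 := by simp [hδ]
      filter_upwards [hC h hc hs _ hδ2, hC' h hc hs _ hδ2] with ε h1 h2
      rw [inter_union_distrib_left]
      refine (lintegral_union_le _ _ _).trans ((add_le_add h1 h2).trans (le_of_eq ?_))
      rw [ENNReal.coe_add]
      conv_rhs => rw [← ENNReal.add_halves δ]
      ring)
    (fun x hx => by
      obtain ⟨e, ψ, K, r, hc⟩ := hL.exists_chart hΩ hx
      refine ⟨_, mem_nhdsWithin_of_mem_nhds (Metric.ball_mem_nhds x (half_pos hc.pos)),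
        Metric.ball x (r / 2), Metric.isOpen_ball, Subset.rfl, 1 + K, fun h hcont hs δ hδ => ?_⟩
      have := hc.layer_le hΩ.measurableSet hcont hs hδ
      have hK : ENNReal.ofReal (1 + K) = ((1 + K : ℝ≥0) : ℝ≥0∞) := by
        rw [← ENNReal.ofReal_coe_nnreal]; simp
      rwa [hK] at this)
  obtain ⟨ε₀, hε₀, hsub⟩ := hcomp.exists_thickening_subset_open hVo hV
  refine ⟨C, fun h hc hs δ hδ => ?_⟩
  filter_upwards [hC h hc hs δ hδ, mem_nhdsWithin_of_mem_nhds (gt_mem_nhds hε₀)] with ε h1 h2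
  refine (lintegral_mono_set (t := (Ω ∩ {x | Metric.infDist x (frontier Ω) < ε}) ∩ V)
    fun x hx => ⟨hx, hsub ?_⟩).trans h1
  obtain ⟨y, hy, hxy⟩ := (Metric.infDist_lt_iff hne).1 hx.2
  exact Metric.mem_thickening_iff.2 ⟨y, hy, hxy.trans h2⟩

end Global

end TraceL1

/-! ### Mollification -/

namespace TraceL1

section Mollify

variable {n : ℕ} {E' : Type*} [NormedAddCommGroup E']

/-- Translations are continuous in `L¹`. -/
lemma exists_lintegral_translate_sub_le {F : Euc n → E'} (hF : Integrable F) {δ : ℝ≥0∞}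
    (hδ : δ ≠ 0) : ∃ r > 0, ∀ y : Euc n, ‖y‖ < r → ∫⁻ x, ‖F (x - y) - F x‖ₑ ≤ δ := by
  have : Fact ((1 : ℝ≥0∞) ≠ ⊤) := ⟨ENNReal.one_ne_top⟩
  have hm := memLp_one_iff_integrable.2 hF
  set f := hm.toLp F
  -- Translations act continuously on `Lp` for finite exponents; `DomAddAct.mk (-y)` is the
  -- translation x ↦ F (x - y).
  have hc : Continuous fun y : Euc n => DomAddAct.mk (-y) +ᵥ f :=
    (DomAddAct.continuous_mk.comp continuous_neg).vadd continuous_const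
  have h0 : DomAddAct.mk (-(0 : Euc n)) +ᵥ f = f := by
    rw [neg_zero, DomAddAct.mk_zero, zero_vadd]
  have hev : ∀ᶠ y : Euc n in 𝓝 0, edist (DomAddAct.mk (-y) +ᵥ f) f < δ := by
    have := hc.tendsto 0
    rw [h0] at this
    exact this.eventually (Metric.eball_mem_nhds f (pos_iff_ne_zero.2 hδ))
  obtain ⟨r, hr, hball⟩ := Metric.eventually_nhds_iff.1 hev
  refine ⟨r, hr, fun y hy => ?_⟩
  have h1 := (hball (y := y) (by rwa [dist_zero_right])).le
  rw [DomAddAct.mk_vadd_toLp, Lp.edist_toLp_toLp, eLpNorm_one_eq_lintegral_enorm] at h1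
  refine le_trans (le_of_eq (lintegral_congr fun x => ?_)) h1
  simp only [Pi.sub_apply, vadd_eq_add]
  rw [neg_add_eq_sub]

variable [NormedSpace ℝ E']

/-- A smooth probability density. -/
structure IsMollifier (k : Euc n → ℝ) : Prop where
  smooth : IsSmoothCompact k
  nonneg : ∀ x, 0 ≤ k x
  integral_eq_one : ∫ x, k x = 1

variable {k : Euc n → ℝ}

lemma IsMollifier.lintegral_enorm (hk : IsMollifier k) : ∫⁻ x, ‖k x‖ₑ = 1 := by
  have hi : Integrable k := integrable_of_integral_eq_one hk.integral_eq_one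
  rw [← ENNReal.toReal_eq_one_iff, ← integral_norm_eq_lintegral_enorm hi.1,
    ← hk.integral_eq_one]
  exact integral_congr_ae (Eventually.of_forall fun x => Real.norm_of_nonneg (hk.nonneg x))

lemma IsMollifier.smooth_comp_sub (hk : IsMollifier k) (x : Euc n) :
    IsSmoothCompact fun z => k (x - z) :=
  ⟨hk.smooth.1.comp (contDiff_const.sub contDiff_id),
    hk.smooth.2.comp_homeomorph (Homeomorph.subLeft x)⟩

lemma IsSmoothCompact.integrable_smul_left {φ : Euc n → ℝ} (hφ : IsSmoothCompact φ)
    {μ : Measure (Euc n)} {F : Euc n → E'} (hF : Integrable F μ) :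
    Integrable (fun x => φ x • F x) μ := by
  obtain ⟨C, hC⟩ := hφ.2.exists_bound_of_continuous hφ.1.continuous
  exact hF.bdd_smul C hφ.1.continuous.aestronglyMeasurable (Eventually.of_forall hC)

lemma IsMollifier.integral_comp_sub (hk : IsMollifier k) (x : Euc n) : ∫ z, k (x - z) = 1 := by
  rw [integral_sub_left_eq_self k volume x, hk.integral_eq_one]

/-- Mollification converges in `L¹`, uniformly in the mollifier. -/
lemma exists_mollify_sub_le [CompleteSpace E'] {F : Euc n → E'} (hF : Integrable F) {δ : ℝ≥0∞}
    (hδ : δ ≠ 0) : ∃ r > 0, ∀ k : Euc n → ℝ, IsMollifier k → (∀ y, r ≤ ‖y‖ → k y = 0) →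
      ∫⁻ x, ‖(∫ z, k (x - z) • F z) - F x‖ₑ ≤ δ := by
  obtain ⟨r, hr, h⟩ := exists_lintegral_translate_sub_le hF hδ
  refine ⟨r, hr, fun k hk hkr => ?_⟩
  have hki : Integrable k := integrable_of_integral_eq_one hk.integral_eq_one
  have h1 : ∀ x, (∫ z, k (x - z) • F z) - F x = ∫ y, k y • (F (x - y) - F x) := by
    intro x
    have e1 : ∫ z, k (x - z) • F z = ∫ y, k y • F (x - y) := by
      rw [← integral_sub_left_eq_self (fun z => k (x - z) • F z) volume x]
      simp
    have e2 : F x = ∫ y, k y • F x := by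
      rw [integral_smul_const, hk.integral_eq_one, one_smul]
    have i1 : Integrable fun y => k y • F (x - y) := by
      refine hk.smooth.integrable_smul_left ?_
      exact hF.comp_sub_left x
    rw [e1]
    conv_lhs => rw [e2]
    rw [← integral_sub i1 (hki.smul_const _)]
    simp only [smul_sub]
  have hmeas : AEMeasurable (fun p : Euc n × Euc n => ‖k p.2‖ₑ * ‖F (p.1 - p.2) - F p.1‖ₑ)
      (volume.prod volume) := by
    refine AEMeasurable.mul (M := ℝ≥0∞) ?_ ?_
    · exact (hk.smooth.1.continuous.measurable.comp measurable_snd).enorm.aemeasurable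
    · refine (AEStronglyMeasurable.sub ?_ hF.1.comp_fst).enorm
      exact hF.1.comp_quasiMeasurePreserving
        (quasiMeasurePreserving_sub_of_right_invariant (G := Euc n) volume volume)
  calc ∫⁻ x, ‖(∫ z, k (x - z) • F z) - F x‖ₑ
      ≤ ∫⁻ x, ∫⁻ y, ‖k y‖ₑ * ‖F (x - y) - F x‖ₑ := by
        refine lintegral_mono fun x => ?_
        rw [h1]
        refine (enorm_integral_le_lintegral_enorm _).trans (le_of_eq ?_)
        simp only [enorm_smul]
    _ = ∫⁻ y, ∫⁻ x, ‖k y‖ₑ * ‖F (x - y) - F x‖ₑ := lintegral_lintegral_swap hmeas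
    _ ≤ ∫⁻ y, ‖k y‖ₑ * δ := by
        refine lintegral_mono fun y => ?_
        dsimp only
        rw [lintegral_const_mul' _ _ enorm_ne_top]
        by_cases hy : ‖y‖ < r
        · gcongr
          exact h y hy
        · rw [hkr y (not_lt.1 hy)]; simp
    _ = δ := by
        rw [lintegral_mul_const _ hk.smooth.1.continuous.measurable.enorm, hk.lintegral_enorm,
          one_mul]

/-- Mollification of an integrable function. -/
noncomputable def mollify (k V : Euc n → ℝ) (x : Euc n) : ℝ := ∫ z, k (x - z) * V z

lemma mollify_eq_convolution (k V : Euc n → ℝ) :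
    mollify k V = MeasureTheory.convolution V k (ContinuousLinearMap.lsmul ℝ ℝ) volume := by
  funext x
  rw [mollify, convolution_def]
  simp [mul_comm]

lemma IsMollifier.isSmoothCompact_mollify (hk : IsMollifier k) {V : Euc n → ℝ}
    (hV : Integrable V) (hVs : HasCompactSupport V) : IsSmoothCompact (mollify k V) := by
  rw [mollify_eq_convolution]
  exact ⟨hk.smooth.2.contDiff_convolution_right _ hV.locallyIntegrable (n := ⊤) hk.smooth.1,
    hVs.convolution _ hk.smooth.2⟩

lemma IsMollifier.gradient_mollify (hk : IsMollifier k) {V : Euc n → ℝ}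
    (hV : Integrable V) (x : Euc n) :
    gradient (mollify k V) x = ∫ z, V z • gradient k (x - z) := by
  have hd := hk.smooth.2.hasFDerivAt_convolution_right (ContinuousLinearMap.lsmul ℝ ℝ)
    (μ := volume) hV.locallyIntegrable (hk.smooth.1.of_le (by simp)) x
  rw [← mollify_eq_convolution] at hd
  have hgi : Integrable fun z => V z • gradient k (x - z) := by
    obtain ⟨C, hC⟩ := hk.smooth.hasCompactSupport_gradient.exists_bound_of_continuous
      hk.smooth.continuous_gradient
    exact hV.smul_bdd C (hk.smooth.continuous_gradient.comp
      (continuous_const.sub continuous_id)).aestronglyMeasurable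
      (Eventually.of_forall fun z => hC (x - z))
  refine ext_inner_right ℝ fun w => ?_
  rw [inner_gradient_left, hd.fderiv, ← real_inner_comm, ← integral_inner hgi,
    convolution_precompR_apply _ hV.locallyIntegrable (hk.smooth.2.fderiv ℝ)
      (hk.smooth.1.continuous_fderiv (by simp)), convolution_def]
  refine integral_congr_ae (Eventually.of_forall fun z => ?_)
  simp only [ContinuousLinearMap.lsmul_apply, smul_eq_mul, inner_smul_right]
  rw [real_inner_comm, inner_gradient_left]

lemma IsMollifier.abs_mollify_le (hk : IsMollifier k) {V : Euc n → ℝ} {M : ℝ}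
    (hM : ∀ᵐ x, |V x| ≤ M) (x : Euc n) : |mollify k V x| ≤ M := by
  have hM' : M = ∫ z, k (x - z) * M := by
    rw [integral_mul_const, hk.integral_comp_sub, one_mul]
  rw [mollify, ← Real.norm_eq_abs]
  conv_rhs => rw [hM']
  refine norm_integral_le_of_norm_le
    (((hk.smooth_comp_sub x).1.continuous.integrable_of_hasCompactSupport
      (hk.smooth_comp_sub x).2).mul_const M) ?_
  filter_upwards [hM] with z hz
  rw [norm_mul, Real.norm_of_nonneg (hk.nonneg _), Real.norm_eq_abs]
  exact mul_le_mul_of_nonneg_left hz (hk.nonneg _)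

lemma IsMollifier.abs_mollify_sub_le (hk : IsMollifier k) {h : Euc n → ℝ} (hc : Continuous h)
    {x : Euc n} {ε : ℝ} (hε : ∀ z, k (x - z) ≠ 0 → |h z - h x| ≤ ε) :
    |mollify k h x - h x| ≤ ε := by
  have hks := hk.smooth_comp_sub x
  have hki := hks.1.continuous.integrable_of_hasCompactSupport (μ := volume) hks.2
  have i1 : Integrable fun z => k (x - z) * h z :=
    (hks.1.continuous.mul hc).integrable_of_hasCompactSupport hks.2.mul_right
  have e1 : h x = ∫ z, k (x - z) * h x := by
    rw [integral_mul_const, hk.integral_comp_sub, one_mul]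
  have e2 : ε = ∫ z, k (x - z) * ε := by
    rw [integral_mul_const, hk.integral_comp_sub, one_mul]
  conv_lhs => rw [mollify, e1, ← integral_sub i1 (hki.mul_const _), ← Real.norm_eq_abs]
  conv_rhs => rw [e2]
  refine norm_integral_le_of_norm_le (hki.mul_const ε) (Eventually.of_forall fun z => ?_)
  rw [← mul_sub, norm_mul, Real.norm_of_nonneg (hk.nonneg _), Real.norm_eq_abs]
  by_cases hz : k (x - z) = 0
  · simp [hz]
  · exact mul_le_mul_of_nonneg_left (hε z hz) (hk.nonneg _)

lemma exists_isMollifier (c : Euc n) {r : ℝ} (hr : 0 < r) :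
    ∃ k : Euc n → ℝ, IsMollifier k ∧ tsupport k ⊆ Metric.closedBall c r := by
  let ρ : ContDiffBump c := ⟨r / 2, r, by positivity, by linarith⟩
  refine ⟨ρ.normed volume, ⟨⟨ρ.contDiff_normed, ρ.hasCompactSupport_normed⟩,
    fun x => ρ.nonneg_normed x, ρ.integral_normed⟩, ?_⟩
  rw [ρ.tsupport_normed_eq]

end Mollify

end TraceL1

/-! ### Local approximation up to the boundary -/

namespace TraceL1

section LocalApprox

variable {n : ℕ} {Ω : Set (Euc n)} {u : Euc n → ℝ} {G : Euc n → Euc n} {χ : Euc n → ℝ}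

lemma gradient_comp_sub {k : Euc n → ℝ} (hk : Differentiable ℝ k) (x z : Euc n) :
    gradient (fun z => k (x - z)) z = -gradient k (x - z) := by
  have h : HasFDerivAt (fun z => k (x - z)) (-fderiv ℝ k (x - z)) z := by
    have h1 : HasFDerivAt (fun z => x - z) (-ContinuousLinearMap.id ℝ (Euc n)) z :=
      (hasFDerivAt_id z).const_sub x
    have h2 := (hk (x - z)).hasFDerivAt.comp z h1
    rwa [ContinuousLinearMap.comp_neg, ContinuousLinearMap.comp_id] at h2
  rw [gradient, h.fderiv, map_neg]
  rfl

lemma integrable_cutoff_smul (hχ : IsSmoothCompact χ) (hu : Integrable u (vol Ω))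
    (hG : Integrable G (vol Ω)) :
    Integrable (fun z => u z • gradient χ z + χ z • G z) (vol Ω) :=
  (hχ.integrable_smul_gradient hu).add (hχ.integrable_smul hG)

/-- Localization of the weak gradient, tested against a translated mollifier. -/
lemma HasWeakGradient.gradient_mollify (hΩ : MeasurableSet Ω) (hw : HasWeakGradient Ω u G)
    (hu : Integrable u (vol Ω)) (hG : Integrable G (vol Ω)) (hχ : IsSmoothCompact χ)
    {k : Euc n → ℝ} (hk : IsMollifier k) {x : Euc n}
    (hx : ∀ z ∈ tsupport χ, x - z ∈ tsupport k → z ∈ Ω) :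
    gradient (mollify k (Ω.indicator fun z => χ z * u z)) x =
      ∫ z, k (x - z) • Ω.indicator (fun z => u z • gradient χ z + χ z • G z) z := by
  have hks := hk.smooth_comp_sub x
  -- The weak gradient is tested with χ k(x - ·). Its support lies in Ω by the condition on x, even
  -- though that of χ may cross the boundary.
  have hθ : IsSmoothCompact (χ * fun z => k (x - z)) := hks.mul_left hχ.1
  have hsupp : tsupport (χ * fun z => k (x - z)) ⊆ Ω := by
    have hcl : IsClosed (tsupport χ ∩ (fun z => x - z) ⁻¹' tsupport k) :=
      (isClosed_tsupport χ).inter ((isClosed_tsupport k).preimage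
        (continuous_const.sub continuous_id))
    refine (closure_minimal (fun z hz => ?_) hcl).trans fun z hz => hx z hz.1 hz.2
    exact ⟨subset_tsupport χ (left_ne_zero_of_mul hz), subset_tsupport k (right_ne_zero_of_mul hz)⟩
  have hV : Integrable (Ω.indicator fun z => χ z * u z) :=
    (integrable_indicator_iff hΩ).2 (hχ.integrable_smul_left (μ := vol Ω) hu)
  rw [hk.gradient_mollify hV]
  have hgr : ∀ z, gradient (χ * fun z => k (x - z)) z =
      -(χ z • gradient k (x - z)) + k (x - z) • gradient χ z := fun z => by
    rw [gradient_mul hχ.differentiable hks.differentiable,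
      gradient_comp_sub hk.smooth.differentiable, smul_neg]
  have hbdd : Integrable (fun z => (χ z * u z) • gradient k (x - z)) (vol Ω) := by
    obtain ⟨C, hC⟩ := hk.smooth.hasCompactSupport_gradient.exists_bound_of_continuous
      hk.smooth.continuous_gradient
    exact (hχ.integrable_smul_left (μ := vol Ω) hu).smul_bdd C
      (hk.smooth.continuous_gradient.comp
        (continuous_const.sub continuous_id)).aestronglyMeasurable
      (Eventually.of_forall fun z => hC (x - z))
  have i2 : Integrable (fun z => k (x - z) • (u z • gradient χ z)) (vol Ω) :=
    hks.integrable_smul (hχ.integrable_smul_gradient hu)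
  have i3 : Integrable (fun z => k (x - z) • (χ z • G z)) (vol Ω) :=
    hks.integrable_smul (hχ.integrable_smul hG)
  have e1 := hw _ hθ hsupp
  have e2 : ∫ z in Ω, u z • gradient (χ * fun z => k (x - z)) z =
      -(∫ z in Ω, (χ z * u z) • gradient k (x - z)) +
        ∫ z in Ω, k (x - z) • (u z • gradient χ z) := by
    have hneg : Integrable (fun z => -((χ z * u z) • gradient k (x - z))) (vol Ω) := hbdd.neg
    rw [← integral_neg, ← integral_add hneg i2]
    refine integral_congr_ae (Eventually.of_forall fun z => ?_)
    simp only [hgr]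
    module
  have e3 : ∫ z in Ω, (χ * fun z => k (x - z)) z • G z = ∫ z in Ω, k (x - z) • (χ z • G z) := by
    refine integral_congr_ae (Eventually.of_forall fun z => ?_)
    simp only [Pi.mul_apply]
    module
  have e4 : ∫ z, Ω.indicator (fun z => χ z * u z) z • gradient k (x - z) =
      ∫ z in Ω, (χ z * u z) • gradient k (x - z) := by
    rw [← integral_indicator hΩ]
    refine integral_congr_ae (Eventually.of_forall fun z => ?_)
    by_cases hz : z ∈ Ω <;> simp [hz]
  have e5 : ∫ z, k (x - z) • Ω.indicator (fun z => u z • gradient χ z + χ z • G z) z =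
      ∫ z in Ω, (k (x - z) • (u z • gradient χ z) + k (x - z) • (χ z • G z)) := by
    rw [← integral_indicator hΩ]
    refine integral_congr_ae (Eventually.of_forall fun z => ?_)
    by_cases hz : z ∈ Ω <;> simp [hz]
  rw [e4, e5, integral_add i2 i3]
  rw [e2, e3] at e1
  rw [← sub_eq_zero] at e1 ⊢
  rw [← neg_eq_zero, ← e1]
  abel

/-- Near `x₀`, moving the closure of `Ω` slightly in a fixed direction brings it into `Ω`, with room
to spare proportional to the displacement. -/
def CanPushInside (Ω : Set (Euc n)) (x₀ : Euc n) (ρ : ℝ) : Prop :=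
  ∃ (v : Euc n) (c t₀ : ℝ), 0 < c ∧ 0 < t₀ ∧ ∀ t ∈ Ioo 0 t₀, ∀ x ∈ closure Ω,
    ∀ z ∈ Metric.ball x₀ ρ, dist z (x + t • v) ≤ c * t → z ∈ Ω

/-- The kernel is centred at -t v with radius c t, so x - z lies in its support only if z is within
c t of x + t v. Mollification at a point of the closure thus reads only points z inside Ω. -/
lemma CanPushInside.exists_mollifiers {x₀ : Euc n} {ρ : ℝ} (h : CanPushInside Ω x₀ ρ) :
    ∃ k : ℕ → Euc n → ℝ, (∀ j, IsMollifier (k j)) ∧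
      (∀ j, ∀ x ∈ closure Ω, ∀ z ∈ Metric.ball x₀ ρ, x - z ∈ tsupport (k j) → z ∈ Ω) ∧
      ∀ r > 0, ∀ᶠ j in atTop, ∀ y, r ≤ ‖y‖ → k j y = 0 := by
  obtain ⟨v, c, t₀, hc, ht₀, hpush⟩ := h
  have ht : ∀ j : ℕ, t₀ / ((j : ℝ) + 2) ∈ Ioo 0 t₀ := fun j => by
    refine ⟨by positivity, div_lt_self ht₀ ?_⟩
    have : (0 : ℝ) ≤ j := Nat.cast_nonneg j
    linarith
  -- The + 2 keeps the displacement strictly below t₀ even for j = 0.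
  choose k hk hks using fun j : ℕ => exists_isMollifier (-((t₀ / ((j : ℝ) + 2)) • v))
    (r := c * (t₀ / ((j : ℝ) + 2))) (mul_pos hc (ht j).1)
  refine ⟨k, hk, fun j x hx z hz hxz => hpush _ (ht j) x hx z hz ?_, fun r hr => ?_⟩
  · have := hks j hxz
    rw [mem_closedBall_iff_norm, sub_neg_eq_add] at this
    rw [dist_comm, dist_eq_norm]
    refine le_trans (le_of_eq ?_) this
    congr 1
    abel
  · have hlim : Tendsto (fun j : ℕ => (‖v‖ + c) * (t₀ / ((j : ℝ) + 2))) atTop (𝓝 0) := by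
      rw [← mul_zero (‖v‖ + c)]
      refine Tendsto.const_mul _ ?_
      exact tendsto_const_nhds.div_atTop
        (tendsto_atTop_add_const_right _ _ tendsto_natCast_atTop_atTop)
    filter_upwards [hlim.eventually (gt_mem_nhds hr)] with j hj y hy
    by_contra hne
    have h1 := hks j (subset_tsupport _ hne)
    rw [mem_closedBall_iff_norm, sub_neg_eq_add] at h1
    have h2 : ‖y‖ ≤ ‖y + (t₀ / ((j : ℝ) + 2)) • v‖ + ‖(t₀ / ((j : ℝ) + 2)) • v‖ := by
      have := norm_sub_le (y + (t₀ / ((j : ℝ) + 2)) • v) ((t₀ / ((j : ℝ) + 2)) • v)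
      rwa [add_sub_cancel_right] at this
    rw [norm_smul, Real.norm_of_nonneg (ht j).1.le] at h2
    nlinarith

/-- Extending χ u by zero creates a jump across the boundary, but the displaced kernels do not see
it from the closure of Ω. There the gradient of the mollification is the mollification of the
localized weak gradient. -/
lemma exists_local_approx (hΩ : MeasurableSet Ω) (hw : HasWeakGradient Ω u G)
    (hu : Integrable u (vol Ω)) (hG : Integrable G (vol Ω)) (hχ : IsSmoothCompact χ)
    {x₀ : Euc n} {ρ : ℝ} (hpush : CanPushInside Ω x₀ ρ) (hχs : tsupport χ ⊆ Metric.ball x₀ ρ) :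
    ∃ φ : ℕ → Euc n → ℝ, (∀ j, IsSmoothCompact (φ j)) ∧
      Tendsto (fun j => eLpNorm (fun x => φ j x - χ x * u x) 1 (vol Ω)) atTop (𝓝 0) ∧
      Tendsto (fun j => eLpNorm
        (fun x => gradient (φ j) x - (u x • gradient χ x + χ x • G x)) 1 (vol Ω)) atTop (𝓝 0) ∧
      (∀ g, ContinuousOn g (closure Ω) → u =ᵐ[vol Ω] g →
        TendstoUniformlyOn φ (χ * g) atTop (closure Ω)) ∧
      ∀ M : ℝ, (∀ᵐ x ∂(vol Ω), |u x| ≤ M) → ∃ R : ℝ, ∀ j x, |φ j x| ≤ R := by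
  obtain ⟨k, hk, hkin, hksmall⟩ := hpush.exists_mollifiers
  set V := Ω.indicator fun z => χ z * u z with hVdef
  set H := Ω.indicator fun z => u z • gradient χ z + χ z • G z with hHdef
  have hV : Integrable V :=
    (integrable_indicator_iff hΩ).2 (hχ.integrable_smul_left (μ := vol Ω) hu)
  have hH : Integrable H := (integrable_indicator_iff hΩ).2 (integrable_cutoff_smul hχ hu hG)
  have hVs : HasCompactSupport V := hχ.2.mono fun z hz => by
    rw [Function.mem_support] at hz ⊢
    intro h0
    apply hz
    rw [hVdef]
    by_cases hzΩ : z ∈ Ω <;> simp [hzΩ, h0]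
  refine ⟨fun j => mollify (k j) V, fun j => (hk j).isSmoothCompact_mollify hV hVs, ?_, ?_, ?_, ?_⟩
  · refine ENNReal.tendsto_nhds_zero.2 fun δ hδ => ?_
    obtain ⟨r, hr, h⟩ := exists_mollify_sub_le hV hδ.ne'
    filter_upwards [hksmall r hr] with j hj
    refine le_trans ?_ (h _ (hk j) hj)
    rw [eLpNorm_one_eq_lintegral_enorm]
    refine (setLIntegral_mono' hΩ fun x hx => ?_).trans (setLIntegral_le_lintegral Ω _)
    rw [hVdef, indicator_of_mem hx]
    rfl
  · refine ENNReal.tendsto_nhds_zero.2 fun δ hδ => ?_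
    obtain ⟨r, hr, h⟩ := exists_mollify_sub_le hH hδ.ne'
    filter_upwards [hksmall r hr] with j hj
    refine le_trans ?_ (h _ (hk j) hj)
    rw [eLpNorm_one_eq_lintegral_enorm]
    refine (setLIntegral_mono' hΩ fun x hx => ?_).trans (setLIntegral_le_lintegral Ω _)
    rw [hVdef, hw.gradient_mollify hΩ hu hG hχ (hk j) fun z hz hxz =>
      hkin j x (subset_closure hx) z (hχs hz) hxz, hHdef, indicator_of_mem hx]
  · intro g hg hug
    -- Tietze extension of g from the closure of Ω, so that χ g becomes uniformly continuous on the
    -- whole space.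
    obtain ⟨g', hg'⟩ := ContinuousMap.exists_restrict_eq (isClosed_closure (s := Ω))
      ⟨(closure Ω).domRestrict g, hg.domRestrict⟩
    have hgg : ∀ x ∈ closure Ω, g' x = g x := fun x hx =>
      congrArg (fun f : C(closure Ω, ℝ) => f ⟨x, hx⟩) hg'
    set h : Euc n → ℝ := fun x => χ x * g' x with hh
    have hcont : Continuous h := hχ.1.continuous.mul g'.continuous
    have hunif := HasCompactSupport.uniformContinuous_of_continuous (f := h) hχ.2.mul_right hcont
    -- The two integrands agree almost everywhere in Ω; outside Ω, either χ or the kernel vanishes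
    -- by the choice of the mollifiers.
    have heq : ∀ j, ∀ x ∈ closure Ω, mollify (k j) V x = mollify (k j) h x := by
      intro j x hx
      refine integral_congr_ae ?_
      have hug' := (ae_restrict_iff' hΩ).1 hug
      filter_upwards [hug'] with z hz
      by_cases hzΩ : z ∈ Ω
      · rw [hVdef, indicator_of_mem hzΩ, hz hzΩ, hh]
        simp only [hgg z (subset_closure hzΩ)]
      · rw [hVdef, indicator_of_notMem hzΩ, mul_zero]
        by_contra hne
        refine hzΩ (hkin j x hx z (hχs (subset_tsupport χ ?_)) (subset_tsupport _ ?_))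
        · exact left_ne_zero_of_mul (right_ne_zero_of_mul (Ne.symm hne))
        · exact left_ne_zero_of_mul (Ne.symm hne)
    rw [Metric.tendstoUniformlyOn_iff]
    intro ε hε
    obtain ⟨r, hr, hrε⟩ := Metric.uniformContinuous_iff.1 hunif (ε / 2) (by positivity)
    filter_upwards [hksmall r hr] with j hj x hx
    rw [heq j x hx, Pi.mul_apply, ← hgg x hx, dist_comm, Real.dist_eq]
    refine lt_of_le_of_lt ((hk j).abs_mollify_sub_le hcont (ε := ε / 2) fun z hz => ?_)
      (by linarith)
    have hzx : dist z x < r := by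
      rw [dist_comm, dist_eq_norm]
      by_contra hlt
      exact hz (hj _ (not_lt.1 hlt))
    exact (hrε hzx).le
  · intro M hM
    obtain ⟨C, hC⟩ := hχ.2.exists_bound_of_continuous hχ.1.continuous
    refine ⟨C * |M|, fun j x => (hk j).abs_mollify_le ?_ x⟩
    have hC0 : 0 ≤ C := (norm_nonneg _).trans (hC 0)
    filter_upwards [(ae_restrict_iff' hΩ).1 hM] with z hz
    by_cases hzΩ : z ∈ Ω
    · rw [hVdef, indicator_of_mem hzΩ, abs_mul]
      exact mul_le_mul (hC z) ((hz hzΩ).trans (le_abs_self M)) (abs_nonneg _) hC0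
    · rw [hVdef, indicator_of_notMem hzΩ, abs_zero]
      positivity

/-- A smooth partition of unity on a compact set, subordinate to balls. -/
lemma exists_smooth_partition {K : Set (Euc n)} (hK : IsCompact K) {ρ : Euc n → ℝ}
    (hρ : ∀ x ∈ K, 0 < ρ x) :
    ∃ (s : Finset (Euc n)) (χ : Euc n → Euc n → ℝ), (∀ i ∈ s, i ∈ K) ∧
      (∀ i ∈ s, IsSmoothCompact (χ i)) ∧ (∀ i ∈ s, tsupport (χ i) ⊆ Metric.ball i (ρ i)) ∧
      ∀ x ∈ K, ∑ i ∈ s, χ i x = 1 := by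
  obtain ⟨s, hsK, hs⟩ := hK.elim_nhds_subcover (fun x => Metric.ball x (ρ x))
    fun x hx => Metric.ball_mem_nhds x (hρ x hx)
  obtain ⟨f, hf⟩ := SmoothPartitionOfUnity.exists_isSubordinate (modelWithCornersSelf ℝ (Euc n))
    hK.isClosed (fun i : s => Metric.ball (i : Euc n) (ρ i)) (fun _ => Metric.isOpen_ball)
    (fun x hx => by
      obtain ⟨i, hi, hxi⟩ := mem_iUnion₂.1 (hs hx)
      exact mem_iUnion.2 ⟨⟨i, hi⟩, hxi⟩)
  classical
  have hval : ∀ i : s, (fun x => if h : (i : Euc n) ∈ s then f ⟨i, h⟩ x else 0) = f i := fun i => by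
    funext x
    rw [dif_pos i.2]
  refine ⟨s, fun i x => if h : i ∈ s then f ⟨i, h⟩ x else 0, hsK, fun i hi => ?_, fun i hi => ?_,
    fun x hx => ?_⟩
  · have e := hval ⟨i, hi⟩
    dsimp only at e ⊢
    rw [e]
    refine ⟨contMDiff_iff_contDiff.1 (f ⟨i, hi⟩).contMDiff, ?_⟩
    exact Metric.isCompact_of_isClosed_isBounded (isClosed_tsupport _)
      (Metric.isBounded_ball.subset (hf ⟨i, hi⟩))
  · have e := hval ⟨i, hi⟩
    dsimp only at e ⊢
    rw [e]
    exact hf ⟨i, hi⟩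
  · rw [← Finset.sum_coe_sort]
    have h1 := f.sum_eq_one hx
    rw [finsum_eq_sum_of_fintype] at h1
    rw [← h1]
    exact Finset.sum_congr rfl fun i _ => congrFun (hval i) x

end LocalApprox

end TraceL1

/-! ### Global smooth approximation by a partition of unity -/

namespace TraceL1

section SmoothApprox

variable {n : ℕ} {Ω : Set (Euc n)} {u : Euc n → ℝ} {G : Euc n → Euc n}

lemma gradient_finset_sum {ι : Type*} {s : Finset ι} {φ : ι → Euc n → ℝ}
    (hφ : ∀ i ∈ s, Differentiable ℝ (φ i)) (x : Euc n) :
    gradient (∑ i ∈ s, φ i) x = ∑ i ∈ s, gradient (φ i) x := by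
  simp only [gradient]
  rw [fderiv_sum fun i hi => (hφ i hi) x, map_sum]

lemma tendsto_eLpNorm_sum {α ι E : Type*} [MeasurableSpace α] {μ : Measure α}
    [NormedAddCommGroup E] {s : Finset ι} {f : ι → ℕ → α → E} {g : ι → α → E}
    (hf : ∀ i ∈ s, ∀ j, AEStronglyMeasurable (fun x => f i j x - g i x) μ)
    (h : ∀ i ∈ s, Tendsto (fun j => eLpNorm (fun x => f i j x - g i x) 1 μ) atTop (𝓝 0)) :
    Tendsto (fun j => eLpNorm (fun x => ∑ i ∈ s, f i j x - ∑ i ∈ s, g i x) 1 μ) atTop (𝓝 0) := by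
  have h1 := tendsto_finsetSum s h
  rw [Finset.sum_const_zero] at h1
  refine tendsto_of_tendsto_of_tendsto_of_le_of_le tendsto_const_nhds h1 (fun _ => bot_le)
    fun j => ?_
  refine le_trans (le_of_eq ?_) (eLpNorm_sum_le (fun i hi => hf i hi j) le_rfl)
  congr 1
  funext x
  rw [Finset.sum_apply, Finset.sum_sub_distrib]

lemma tendstoUniformlyOn_sum {α ι : Type*} {s : Finset ι} {f : ι → ℕ → α → ℝ} {g : ι → α → ℝ}
    {K : Set α} (h : ∀ i ∈ s, TendstoUniformlyOn (f i) (g i) atTop K) :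
    TendstoUniformlyOn (fun j => ∑ i ∈ s, f i j) (∑ i ∈ s, g i) atTop K := by
  classical
  induction s using Finset.induction_on with
  | empty => exact fun v hv => Eventually.of_forall fun j x _ => by simpa using refl_mem_uniformity hv
  | insert a s ha ih =>
    simp only [Finset.sum_insert ha]
    exact (h a (by simp)).add (ih fun i hi => h i (by simp [hi]))

/-- Smooth compactly supported functions approximate integrable functions with integrable weak
gradient in bounded open sets into which their closure can be locally pushed. -/
lemma HasWeakGradient.exists_approx (hΩ : IsOpen Ω) (hb : Bornology.IsBounded Ω)
    (hpush : ∀ x ∈ closure Ω, ∃ ρ > 0, CanPushInside Ω x ρ) (hw : HasWeakGradient Ω u G)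
    (hu : Integrable u (vol Ω)) (hG : Integrable G (vol Ω)) :
    ∃ φ : ℕ → Euc n → ℝ, (∀ j, IsSmoothCompact (φ j)) ∧
      Tendsto (fun j => eLpNorm (fun x => φ j x - u x) 1 (vol Ω)) atTop (𝓝 0) ∧
      Tendsto (fun j => eLpNorm (fun x => gradient (φ j) x - G x) 1 (vol Ω)) atTop (𝓝 0) ∧
      (∀ g, ContinuousOn g (closure Ω) → u =ᵐ[vol Ω] g →
        TendstoUniformlyOn φ g atTop (closure Ω)) ∧
      ∀ M : ℝ, (∀ᵐ x ∂(vol Ω), |u x| ≤ M) → ∃ R : ℝ, ∀ j x, |φ j x| ≤ R := by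
  choose! ρ hρ hpush using hpush
  obtain ⟨s, χ, hsK, hχ, hχs, hχ1⟩ := exists_smooth_partition hb.isCompact_closure hρ
  have hloc := fun i (hi : i ∈ s) => exists_local_approx hΩ.measurableSet hw hu hG (hχ i hi)
    (hpush i (hsK i hi)) (hχs i hi)
  choose! φ hφ hφu hφG hφunif hφb using hloc
  -- The partition sums to 1 near every point of the open set Ω, so the terms u ∇χ_i from the
  -- product rule cancel in the sum.
  have hχΩ : ∀ x ∈ Ω, ∑ i ∈ s, gradient (χ i) x = 0 := fun x hx => by
    rw [← gradient_finset_sum fun i hi => (hχ i hi).differentiable]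
    have : (∑ i ∈ s, χ i) =ᶠ[𝓝 x] fun _ => (1 : ℝ) := by
      filter_upwards [hΩ.mem_nhds hx] with y hy
      rw [Finset.sum_apply, hχ1 y (subset_closure hy)]
    rw [gradient, this.fderiv_eq]
    simp
  refine ⟨fun j => ∑ i ∈ s, φ i j, fun j => IsSmoothCompact.sum fun i hi => hφ i hi j,
    ?_, ?_, ?_, ?_⟩
  · refine (tendsto_eLpNorm_sum (fun i hi j => ?_) hφu).congr fun j =>
      eLpNorm_congr_ae ((ae_restrict_iff' hΩ.measurableSet).2 (Eventually.of_forall fun x hx => ?_))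
    · exact (hφ i hi j).1.continuous.aestronglyMeasurable.sub
        ((hχ i hi).1.continuous.aestronglyMeasurable.mul hu.1)
    · dsimp only
      rw [← Finset.sum_mul, hχ1 x (subset_closure hx), one_mul, Finset.sum_apply]
  · refine (tendsto_eLpNorm_sum (fun i hi j => ?_) hφG).congr fun j =>
      eLpNorm_congr_ae ((ae_restrict_iff' hΩ.measurableSet).2 (Eventually.of_forall fun x hx => ?_))
    · exact (hφ i hi j).continuous_gradient.aestronglyMeasurable.sub
        (integrable_cutoff_smul (hχ i hi) hu hG).1
    · dsimp only
      rw [gradient_finset_sum fun i hi => (hφ i hi j).differentiable, Finset.sum_add_distrib,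
        ← Finset.smul_sum, ← Finset.sum_smul, hχΩ x hx, hχ1 x (subset_closure hx), smul_zero,
        zero_add, one_smul]
  · intro g hg hug
    refine (tendstoUniformlyOn_sum fun i hi => hφunif i hi g hg hug).congr_right fun x hx => ?_
    rw [Finset.sum_apply]
    simp only [Pi.mul_apply]
    rw [← Finset.sum_mul, hχ1 x hx, one_mul]
  · intro M hM
    choose! R hR using fun i (hi : i ∈ s) => hφb i hi M hM
    refine ⟨∑ i ∈ s, R i, fun j x => ?_⟩
    dsimp only
    rw [Finset.sum_apply]
    exact (Finset.abs_sum_le_sum_abs _ _).trans (Finset.sum_le_sum fun i hi => hR i hi j x)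

/-- At an interior point any ball contained in Ω works with the zero direction, since z is already
in Ω. At a frontier point the chart supplies the direction. -/
lemma HasLipschitzBoundary.canPushInside {d : ℕ} {Ω : Set (Euc (d + 1))}
    (hL : HasLipschitzBoundary Ω) (hΩ : IsOpen Ω) {x : Euc (d + 1)} (hx : x ∈ closure Ω) :
    ∃ ρ > 0, CanPushInside Ω x ρ := by
  by_cases hxΩ : x ∈ Ω
  · obtain ⟨ρ, hρ, hsub⟩ := Metric.isOpen_iff.1 hΩ x hxΩ
    exact ⟨ρ, hρ, 0, 1, 1, one_pos, one_pos, fun _ _ _ _ z hz _ => hsub hz⟩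
  · have hxf : x ∈ frontier Ω := by rw [hΩ.frontier_eq]; exact ⟨hx, hxΩ⟩
    obtain ⟨e, ψ, K, r, hc⟩ := hL.exists_chart hΩ hxf
    obtain ⟨c, t₀, h⟩ := hc.exists_push
    exact ⟨r / 2, half_pos hc.pos, upDir e, c, t₀, h⟩

end SmoothApprox

section Closure

variable {n : ℕ} {U : Set (Euc n)}

/-- The test function is supported in U, so both integrals extend to the whole space, where
integration by parts produces no boundary term. -/
lemma IsSmoothCompact.hasWeakGradient {χ : Euc n → ℝ} (hχ : IsSmoothCompact χ) :
    HasWeakGradient U χ (gradient χ) := by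
  intro φ hφ hs
  have hi : ∀ {f g : Euc n → ℝ}, IsSmoothCompact f → IsSmoothCompact g → ∀ v : Euc n,
      Integrable fun x => f x * fderiv ℝ g x v := fun hf hg v =>
    (hf.1.continuous.mul ((hg.1.continuous_fderiv (by simp)).clm_apply
      continuous_const)).integrable_of_hasCompactSupport hf.2.mul_right
  have h1 : ∫ x in U, χ x • gradient φ x = ∫ x, χ x • gradient φ x := by
    refine setIntegral_eq_integral_of_forall_compl_eq_zero fun x hx => ?_
    rw [gradient, fderiv_of_notMem_tsupport ℝ fun h => hx (hs h), map_zero, smul_zero]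
  have h2 : ∫ x in U, φ x • gradient χ x = ∫ x, φ x • gradient χ x := by
    refine setIntegral_eq_integral_of_forall_compl_eq_zero fun x hx => ?_
    rw [image_eq_zero_of_notMem_tsupport fun h => hx (hs h), zero_smul]
  have j1 : ∀ {f g : Euc n → ℝ}, IsSmoothCompact f → IsSmoothCompact g →
      Integrable fun x => f x • gradient g x := fun hf hg =>
    (hf.1.continuous.smul hg.continuous_gradient).integrable_of_hasCompactSupport hf.2.smul_right
  rw [h1, h2]
  refine ext_inner_right ℝ fun v => ?_
  rw [inner_neg_left, real_inner_comm, real_inner_comm v, ← integral_inner (j1 hχ hφ),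
    ← integral_inner (j1 hφ hχ)]
  simp only [real_inner_smul_right, inner_gradient_right, conj_trivial]
  rw [integral_mul_fderiv_eq_neg_fderiv_mul_of_integrable (μ := volume) (v := v) ?_
    (hi hχ hφ v) ?_ (fun x _ => hχ.differentiable x)
    fun x _ => hφ.differentiable x]
  · simp only [mul_comm]
  · simpa only [mul_comm] using hi hφ hχ v
  · exact (hχ.1.continuous.mul hφ.1.continuous).integrable_of_hasCompactSupport hχ.2.mul_right

end Closure

end TraceL1

/-! ### Smooth functions in `W11` and stability of weak gradients -/

namespace TraceL1

section WeakGradient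

variable {n : ℕ} {U : Set (Euc n)}

lemma HasWeakGradient.congr {u u' : Euc n → ℝ} {G G' : Euc n → Euc n}
    (h : HasWeakGradient U u G) (hu : u =ᵐ[vol U] u') (hG : G =ᵐ[vol U] G') :
    HasWeakGradient U u' G' := by
  intro φ hφ hs
  rw [← integral_congr_ae (f := fun x => u x • gradient φ x) (by
      filter_upwards [hu] with x hx; rw [hx]), h φ hφ hs,
    integral_congr_ae (f := fun x => φ x • G x) (by filter_upwards [hG] with x hx; rw [hx])]

lemma tendsto_integral_of_norm_sub_le {α E F : Type*} [MeasurableSpace α] {μ : Measure α}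
    [NormedAddCommGroup E] [NormedSpace ℝ E] [NormedAddCommGroup F] {f : ℕ → α → E} {g : α → E}
    {h : ℕ → α → F} (hf : ∀ k, Integrable (f k) μ) (hg : Integrable g μ) {C : ℝ}
    (hC : ∀ k x, ‖f k x - g x‖ ≤ C * ‖h k x‖)
    (hh : Tendsto (fun k => eLpNorm (h k) 1 μ) atTop (𝓝 0)) :
    Tendsto (fun k => ∫ x, f k x ∂μ) atTop (𝓝 (∫ x, g x ∂μ)) := by
  refine tendsto_integral_of_L1' g hg.1 (Eventually.of_forall hf) ?_
  have h1 := ENNReal.Tendsto.const_mul (a := ENNReal.ofReal C) hh (Or.inr ENNReal.ofReal_ne_top)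
  rw [mul_zero] at h1
  exact tendsto_of_tendsto_of_tendsto_of_le_of_le tendsto_const_nhds h1 (fun _ => bot_le)
    fun k => eLpNorm_le_mul_eLpNorm_of_ae_le_mul (Eventually.of_forall (hC k)) 1

/-- Test functions and their gradients are bounded, so both sides of the defining identity pass to
L¹ limits. This places the extension built from the series in `W11`. -/
lemma HasWeakGradient.of_tendsto {φ : ℕ → Euc n → ℝ} (hφ : ∀ k, IsSmoothCompact (φ k))
    {u : Euc n → ℝ} {G : Euc n → Euc n} (hu : Integrable u (vol U)) (hG : Integrable G (vol U))
    (h1 : Tendsto (fun k => eLpNorm (fun x => φ k x - u x) 1 (vol U)) atTop (𝓝 0))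
    (h2 : Tendsto (fun k => eLpNorm (fun x => gradient (φ k) x - G x) 1 (vol U)) atTop (𝓝 0)) :
    HasWeakGradient U u G := by
  intro χ hχ hs
  obtain ⟨C, hC⟩ := hχ.hasCompactSupport_gradient.exists_bound_of_continuous
    hχ.continuous_gradient
  obtain ⟨C', hC'⟩ := hχ.2.exists_bound_of_continuous hχ.1.continuous
  have t1 := tendsto_integral_of_norm_sub_le (f := fun k x => φ k x • gradient χ x) (C := C)
    (fun k => hχ.integrable_smul_gradient (memLp_one_iff_integrable.1 ((hφ k).memLp 1 (vol U))))
    (hχ.integrable_smul_gradient hu) (fun k x => by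
      rw [← sub_smul, norm_smul, mul_comm]
      exact mul_le_mul_of_nonneg_right (hC x) (norm_nonneg _)) h1
  have t2 := tendsto_integral_of_norm_sub_le (f := fun k x => χ x • gradient (φ k) x) (C := C')
    (fun k => hχ.integrable_smul
      (memLp_one_iff_integrable.1 ((hφ k).memLp_gradient 1 (vol U))))
    (hχ.integrable_smul hG) (fun k x => by
      rw [← smul_sub, norm_smul]
      exact mul_le_mul_of_nonneg_right (hC' x) (norm_nonneg _)) h2
  refine tendsto_nhds_unique t1 (t2.neg.congr fun k => ?_)
  exact ((hφ k).hasWeakGradient χ hχ hs).symm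

/-- Smooth compactly supported functions, as elements of `W^{1,1}(U)`. -/
noncomputable def toW11 (U : Set (Euc n)) : smoothCompact n →ₗ[ℝ] W11 U :=
  ((restrictLp (vol U) (fun x => x) fun _ hφ => hφ.memLp 1 _).prod (gradLp U)).codRestrict (W11 U)
    fun φ => φ.2.hasWeakGradient.congr (φ.2.memLp 1 _).coeFn_toLp.symm
      (φ.2.memLp_gradient 1 _).coeFn_toLp.symm

lemma W11fun_toW11 (φ : smoothCompact n) : W11fun (toW11 U φ) =ᵐ[vol U] φ.1 :=
  (φ.2.memLp 1 _).coeFn_toLp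

lemma tendsto_toW11 {φ : ℕ → Euc n → ℝ} (hφ : ∀ k, IsSmoothCompact (φ k)) {w : W11 U}
    (h1 : Tendsto (fun k => eLpNorm (fun x => φ k x - w.1.1 x) 1 (vol U)) atTop (𝓝 0))
    (h2 : Tendsto (fun k => eLpNorm (fun x => gradient (φ k) x - w.1.2 x) 1 (vol U)) atTop (𝓝 0)) :
    Tendsto (fun k => toW11 U ⟨φ k, hφ k⟩) atTop (𝓝 w) :=
  tendsto_subtype_rng.2 <|
    ((tendsto_toLp_iff (fun k => (hφ k).memLp 1 (vol U)) w.1.1).2 h1).prodMk_nhds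
      ((tendsto_toLp_iff (fun k => (hφ k).memLp_gradient 1 (vol U)) w.1.2).2 h2)

end WeakGradient

/-! ### The trace operator of a Lipschitz domain -/

section Domain

variable {d : ℕ} {Ω : Set (Euc (d + 1))}

lemma exists_approx_W11 (hΩ : IsOpen Ω) (hb : Bornology.IsBounded Ω)
    (hL : HasLipschitzBoundary Ω) (w : W11 Ω) :
    ∃ φ : ℕ → Euc (d + 1) → ℝ, ∃ hφ : ∀ j, IsSmoothCompact (φ j),
      Tendsto (fun k => toW11 Ω ⟨φ k, hφ k⟩) atTop (𝓝 w) ∧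
      (∀ g, ContinuousOn g (closure Ω) → W11fun w =ᵐ[vol Ω] g →
        TendstoUniformlyOn φ g atTop (closure Ω)) ∧
      ∀ M : ℝ, (∀ᵐ x ∂(vol Ω), |W11fun w x| ≤ M) → ∃ R : ℝ, ∀ j x, |φ j x| ≤ R := by
  have hw : HasWeakGradient Ω w.1.1 w.1.2 := w.2
  obtain ⟨φ, hφ, h1, h2, h3, h4⟩ := hw.exists_approx hΩ hb
    (fun x hx => hL.canPushInside hΩ hx) (L1.integrable_coeFn _) (L1.integrable_coeFn _)
  exact ⟨φ, hφ, tendsto_toW11 hφ h1 h2, h3, h4⟩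

lemma denseRange_toW11 (hΩ : IsOpen Ω) (hb : Bornology.IsBounded Ω)
    (hL : HasLipschitzBoundary Ω) : DenseRange (toW11 Ω) := fun w => by
  obtain ⟨φ, hφ, h, -⟩ := exists_approx_W11 hΩ hb hL w
  exact mem_closure_iff_seq_limit.2 ⟨_, fun k => ⟨⟨φ k, hφ k⟩, rfl⟩, h⟩

lemma ae_mem_frontier : ∀ᵐ y ∂(surfaceMeasure Ω), y ∈ frontier Ω :=
  ae_restrict_mem isClosed_frontier.measurableSet

variable [IsFiniteMeasure (surfaceMeasure Ω)]

/-- The restriction of smooth compactly supported functions to the boundary of `Ω`. -/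
noncomputable def boundaryRestrict (Ω : Set (Euc (d + 1))) [IsFiniteMeasure (surfaceMeasure Ω)] :
    smoothCompact (d + 1) →ₗ[ℝ] Lp ℝ 1 (surfaceMeasure Ω) :=
  restrictLp (surfaceMeasure Ω) (fun y => y) fun _ hφ => hφ.memLp 1 _

lemma boundaryRestrict_ae_eq (φ : smoothCompact (d + 1)) :
    boundaryRestrict Ω φ =ᵐ[surfaceMeasure Ω] φ.1 :=
  (φ.2.memLp 1 _).coeFn_toLp

lemma exists_norm_boundaryRestrict_le (hΩ : IsOpen Ω) (hb : Bornology.IsBounded Ω)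
    (hL : HasLipschitzBoundary Ω) :
    ∃ C, ∀ φ, ‖boundaryRestrict Ω φ‖ ≤ C * ‖toW11 Ω φ‖ := by
  obtain ⟨C, hC⟩ := hL.exists_trace_le hΩ hb
  -- The norm of `W11` is the maximum of the two component norms, each of which appears once in the
  -- trace inequality.
  refine ⟨2 * C, fun φ => ?_⟩
  have e1 : ‖boundaryRestrict Ω φ‖ = (eLpNorm φ.1 1 (surfaceMeasure Ω)).toReal :=
    Lp.norm_toLp _ (φ.2.memLp 1 _)
  have e2 : ‖(toW11 Ω φ).1.1‖ = (eLpNorm φ.1 1 (vol Ω)).toReal :=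
    Lp.norm_toLp _ (φ.2.memLp 1 _)
  have e3 : ‖(toW11 Ω φ).1.2‖ = (eLpNorm (gradient φ.1) 1 (vol Ω)).toReal :=
    Lp.norm_toLp _ (φ.2.memLp_gradient 1 _)
  have h1 : eLpNorm φ.1 1 (surfaceMeasure Ω) ≤
      C * (eLpNorm φ.1 1 (vol Ω) + eLpNorm (gradient φ.1) 1 (vol Ω)) := by
    simpa only [eLpNorm_one_eq_lintegral_enorm] using hC φ.1 φ.2
  have f1 := (φ.2.memLp 1 (vol Ω)).2.ne
  have f2 := (φ.2.memLp_gradient 1 (vol Ω)).2.ne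
  have h2 := ENNReal.toReal_mono
    (ENNReal.mul_ne_top ENNReal.coe_ne_top (ENNReal.add_ne_top.2 ⟨f1, f2⟩)) h1
  rw [ENNReal.toReal_mul, ENNReal.toReal_add f1 f2, ← e1, ← e2, ← e3, ENNReal.coe_toReal] at h2
  have h3 : ‖(toW11 Ω φ).1.1‖ ≤ ‖toW11 Ω φ‖ := norm_fst_le (toW11 Ω φ).1
  have h4 : ‖(toW11 Ω φ).1.2‖ ≤ ‖toW11 Ω φ‖ := norm_snd_le (toW11 Ω φ).1
  calc _ ≤ C * (‖(toW11 Ω φ).1.1‖ + ‖(toW11 Ω φ).1.2‖) := h2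
    _ ≤ C * (‖toW11 Ω φ‖ + ‖toW11 Ω φ‖) := by gcongr
    _ = _ := by ring

/-- The trace operator of `Ω`. -/
noncomputable def boundaryTrace (Ω : Set (Euc (d + 1))) [IsFiniteMeasure (surfaceMeasure Ω)] :
    W11 Ω →L[ℝ] Lp ℝ 1 (surfaceMeasure Ω) :=
  (boundaryRestrict Ω).extendOfNorm (toW11 Ω)

lemma tendsto_eLpNorm_of_tendstoUniformlyOn {φ : ℕ → Euc (d + 1) → ℝ} {g : Euc (d + 1) → ℝ}
    (h : TendstoUniformlyOn φ g atTop (closure Ω)) :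
    Tendsto (fun k => eLpNorm (fun y => φ k y - g y) 1 (surfaceMeasure Ω)) atTop (𝓝 0) := by
  refine ENNReal.tendsto_nhds_zero.2 fun δ hδ => ?_
  obtain ⟨ε, hε, hεδ⟩ : ∃ ε : ℝ, 0 < ε ∧
      surfaceMeasure Ω univ * ENNReal.ofReal ε ≤ δ := by
    obtain ⟨ε, hε, h⟩ := ENNReal.exists_nnreal_pos_mul_lt (measure_ne_top (surfaceMeasure Ω) univ)
      hδ.ne'
    exact ⟨ε, hε, by rw [ENNReal.ofReal_coe_nnreal, mul_comm]; exact h.le⟩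
  filter_upwards [Metric.tendstoUniformlyOn_iff.1 h ε hε] with k hk
  refine (eLpNorm_le_of_ae_bound (C := ε) ?_).trans (le_trans (le_of_eq ?_) hεδ)
  · filter_upwards [ae_mem_frontier] with y hy
    rw [← dist_eq_norm, dist_comm]
    exact (hk y (frontier_subset_closure hy)).le
  · simp

lemma IsTraceOperator.apply_toW11 {γ : W11 Ω →L[ℝ] Lp ℝ 1 (surfaceMeasure Ω)}
    (h : IsTraceOperator γ) (φ : smoothCompact (d + 1)) :
    γ (toW11 Ω φ) = boundaryRestrict Ω φ :=
  Lp.ext ((h _ φ.1 φ.2.1.continuous.continuousOn (W11fun_toW11 φ)).trans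
    (boundaryRestrict_ae_eq φ).symm)

/-- One sequence of approximants converges to w in `W11` and uniformly to g on the closure. Its
boundary values thus converge in L¹ both to the trace and, the surface measure being finite, to g.
-/
lemma isTraceOperator_boundaryTrace (hΩ : IsOpen Ω) (hb : Bornology.IsBounded Ω)
    (hL : HasLipschitzBoundary Ω) : IsTraceOperator (boundaryTrace Ω) := by
  intro w g hg hwg
  obtain ⟨φ, hφ, h1, h2, -⟩ := exists_approx_W11 hΩ hb hL w
  have h3 := ((boundaryTrace Ω).continuous.tendsto w).comp h1
  have h4 : Tendsto (fun k => boundaryRestrict Ω ⟨φ k, hφ k⟩) atTop (𝓝 (boundaryTrace Ω w)) :=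
    h3.congr fun k => LinearMap.extendOfNorm_eq (denseRange_toW11 hΩ hb hL)
      (exists_norm_boundaryRestrict_le hΩ hb hL) _
  refine ae_eq_of_tendsto_eLpNorm_one (fun k => (hφ k).1.continuous.aestronglyMeasurable)
    (Lp.aestronglyMeasurable _) ?_
    ((tendsto_toLp_iff (fun k => (hφ k).memLp 1 (surfaceMeasure Ω)) _).1 h4)
    (tendsto_eLpNorm_of_tendstoUniformlyOn (h2 g hg hwg))
  exact (hg.mono frontier_subset_closure).aestronglyMeasurable isClosed_frontier.measurableSet

lemma IsTraceOperator.unique (hΩ : IsOpen Ω) (hb : Bornology.IsBounded Ω)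
    (hL : HasLipschitzBoundary Ω) {γ γ' : W11 Ω →L[ℝ] Lp ℝ 1 (surfaceMeasure Ω)}
    (h : IsTraceOperator γ) (h' : IsTraceOperator γ') : γ' = γ := by
  refine DFunLike.coe_injective ((denseRange_toW11 hΩ hb hL).equalizer γ'.continuous γ.continuous ?_)
  funext φ
  exact (h'.apply_toW11 φ).trans (h.apply_toW11 φ).symm

lemma IsTraceOperator.tendsto_eLpNorm {γ : W11 Ω →L[ℝ] Lp ℝ 1 (surfaceMeasure Ω)}
    (h : IsTraceOperator γ) {φ : ℕ → Euc (d + 1) → ℝ} (hφ : ∀ k, IsSmoothCompact (φ k))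
    {w : W11 Ω} (hw : Tendsto (fun k => toW11 Ω ⟨φ k, hφ k⟩) atTop (𝓝 w)) :
    Tendsto (fun k => eLpNorm (fun y => φ k y - γ w y) 1 (surfaceMeasure Ω)) atTop (𝓝 0) :=
  (tendsto_toLp_iff (fun k => (hφ k).memLp 1 (surfaceMeasure Ω)) _).1 <|
    ((γ.continuous.tendsto w).comp hw).congr fun _ => h.apply_toW11 _

lemma hasDenseRestrictions_of_isFiniteMeasure {n : ℕ} (σ : Measure (Euc n)) [IsFiniteMeasure σ] :
    HasDenseRestrictions σ (fun y => y) := by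
  intro f hf δ hδ
  obtain ⟨r, hr, hrδ⟩ : ∃ r : ℝ, 0 < r ∧ ENNReal.ofReal r ≤ δ := by
    obtain ⟨r, hr, hrδ⟩ := ENNReal.lt_iff_exists_nnreal_btwn.1 (pos_iff_ne_zero.2 hδ)
    exact ⟨r, by exact_mod_cast hr, by rw [ENNReal.ofReal_coe_nnreal]; exact hrδ.le⟩
  obtain ⟨g, hg1, hg2, hg3⟩ := hf.exist_eLpNorm_sub_le ENNReal.one_ne_top le_rfl hr
  exact ⟨g, ⟨hg2, hg1⟩, hg3.trans hrδ⟩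

lemma IsTraceOperator.exists_extension (hΩ : IsOpen Ω) (hb : Bornology.IsBounded Ω)
    (hL : HasLipschitzBoundary Ω) {γ : W11 Ω →L[ℝ] Lp ℝ 1 (surfaceMeasure Ω)}
    (h : IsTraceOperator γ) {f : Euc (d + 1) → ℝ} (hf : MemLp f 1 (surfaceMeasure Ω))
    {q : ℝ≥0∞} (hq : 1 ≤ q) (hq' : q ≠ ⊤) :
    ∃ w : W11 Ω, MemLp (W11fun w) q (vol Ω) ∧
      (MemLp f ⊤ (surfaceMeasure Ω) → MemLp (W11fun w) ⊤ (vol Ω)) ∧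
      γ w =ᵐ[surfaceMeasure Ω] f := by
  obtain ⟨φ, hφ, u, G, hu, hG, hf1, hq1, hbd⟩ := (hL.hasLayerBound hΩ hb).exists_extension
    (fun h hc hs => (hc.integrable_of_hasCompactSupport hs).2.ne)
    (hasDenseRestrictions_of_isFiniteMeasure _) measurable_id ae_mem_frontier hf hq hq'
  let w : W11 Ω := ⟨(u, G), HasWeakGradient.of_tendsto hφ (L1.integrable_coeFn u)
    (L1.integrable_coeFn G) hu hG⟩
  exact ⟨w, hq1, hbd, ae_eq_of_tendsto_eLpNorm_one
    (fun k => (hφ k).1.continuous.aestronglyMeasurable) (Lp.aestronglyMeasurable _) hf.1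
    (h.tendsto_eLpNorm hφ (tendsto_toW11 (w := w) hφ hu hG)) hf1⟩

/-- The approximants of a bounded function are uniformly bounded everywhere, in particular on the
frontier, and this bound passes to the L¹ limit of their boundary values. -/
lemma IsTraceOperator.memLp_top (hΩ : IsOpen Ω) (hb : Bornology.IsBounded Ω)
    (hL : HasLipschitzBoundary Ω) {γ : W11 Ω →L[ℝ] Lp ℝ 1 (surfaceMeasure Ω)}
    (h : IsTraceOperator γ) (w : W11 Ω) (hw : MemLp (W11fun w) ⊤ (vol Ω)) :
    MemLp (γ w) ⊤ (surfaceMeasure Ω) := by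
  obtain ⟨φ, hφ, h1, -, h3⟩ := exists_approx_W11 hΩ hb hL w
  obtain ⟨R, hR⟩ := h3 (eLpNorm (W11fun w) ⊤ (vol Ω)).toReal <| by
    filter_upwards [ae_le_eLpNormEssSup (f := W11fun w) (μ := vol Ω)] with x hx
    rw [← eLpNorm_exponent_top] at hx
    simpa using ENNReal.toReal_mono hw.2.ne hx
  refine ⟨Lp.aestronglyMeasurable _, lt_of_le_of_lt (eLpNorm_le_of_tendsto_eLpNorm_one
    (fun k => (hφ k).1.continuous.aestronglyMeasurable) (Lp.aestronglyMeasurable _)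
    (h.tendsto_eLpNorm hφ h1) (R := ENNReal.ofReal R) fun k => ?_) ENNReal.ofReal_lt_top⟩
  rw [eLpNorm_exponent_top]
  exact eLpNormEssSup_le_of_ae_bound (Eventually.of_forall (hR k))

end Domain

theorem lipschitzDomain_trace {d : ℕ} {Ω : Set (Euc (d + 1))} (hΩ : IsOpen Ω)
    (hb : Bornology.IsBounded Ω) (hL : HasLipschitzBoundary Ω) :
    ∃ γ : W11 Ω →L[ℝ] Lp ℝ 1 (surfaceMeasure Ω),
      IsTraceOperator γ ∧ (∀ γ', IsTraceOperator γ' → γ' = γ) ∧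
      (∀ q : ℝ≥0∞, 1 ≤ q → q < ⊤ → traceSpace γ q = {f | MemLp f 1 (surfaceMeasure Ω)}) ∧
      traceSpace γ ⊤ = {f | MemLp f ⊤ (surfaceMeasure Ω)} := by
  have := isFiniteMeasure_surfaceMeasure hΩ hb hL
  have hγ := isTraceOperator_boundaryTrace hΩ hb hL
  refine ⟨boundaryTrace Ω, hγ, fun γ' h => hγ.unique hΩ hb hL h, fun q hq hq' => ?_, ?_⟩
  · ext f
    constructor
    · rintro ⟨w, -, hw⟩
      exact (memLp_congr_ae hw).1 (Lp.memLp _)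
    · intro hf
      obtain ⟨w, hw, -, hwf⟩ := hγ.exists_extension hΩ hb hL hf hq hq'.ne
      exact ⟨w, hw, hwf⟩
  · ext f
    constructor
    · rintro ⟨w, hw, hwf⟩
      exact (memLp_congr_ae hwf).1 (hγ.memLp_top hΩ hb hL w hw)
    · intro hf
      -- The surface measure is finite, so a bounded boundary function is integrable and the L¹
      -- construction applies to it.
      obtain ⟨w, -, hw, hwf⟩ := hγ.exists_extension hΩ hb hL (hf.mono_exponent le_top) le_rfl
        ENNReal.one_ne_top
      exact ⟨w, hw hf, hwf⟩

end TraceL1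
theorem theorem1p2 (d : ℕ) (hd : 1 ≤ d) :
    (∃ γ : TraceL1.HomW11 d →ₗ[ℝ] Lp ℝ 1 (volume : Measure (TraceL1.Euc d)),
      TraceL1.IsHalfSpaceTraceOperator γ ∧
      (∀ γ', TraceL1.IsHalfSpaceTraceOperator γ' → γ' = γ) ∧
      (∀ q : ℝ≥0∞, ((d : ℝ≥0∞) + 1) / (d : ℝ≥0∞) < q → q < ⊤ →
        TraceL1.halfSpaceTraceSpace γ q = {f | MemLp f 1 volume}) ∧
      TraceL1.halfSpaceTraceSpace γ ⊤ = {f | MemLp f 1 volume ∧ MemLp f ⊤ volume}) ∧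
    ∀ Ω : Set (TraceL1.Euc (d + 1)), IsOpen Ω → Bornology.IsBounded Ω →
      TraceL1.HasLipschitzBoundary Ω →
      ∃ γ : TraceL1.W11 Ω →L[ℝ] Lp ℝ 1 (TraceL1.surfaceMeasure Ω),
        TraceL1.IsTraceOperator γ ∧
        (∀ γ', TraceL1.IsTraceOperator γ' → γ' = γ) ∧
        (∀ q : ℝ≥0∞, ((d : ℝ≥0∞) + 1) / (d : ℝ≥0∞) < q → q < ⊤ →
          TraceL1.traceSpace γ q = {f | MemLp f 1 (TraceL1.surfaceMeasure Ω)}) ∧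
        TraceL1.traceSpace γ ⊤ = {f | MemLp f ⊤ (TraceL1.surfaceMeasure Ω)} := by
  -- The threshold (d + 1)/d is at least 1, and 1 ≤ q is what Minkowski's inequality for the series
  -- needs.
  have hq : ∀ q : ℝ≥0∞, ((d : ℝ≥0∞) + 1) / (d : ℝ≥0∞) < q → 1 ≤ q := fun q h =>
    le_trans (by
      rw [ENNReal.le_div_iff_mul_le (Or.inl (by simp; omega)) (Or.inl (by simp)), one_mul]
      exact le_self_add) h.le
  refine ⟨?_, fun Ω hΩ hb hL => ?_⟩
  · obtain ⟨γ, h1, h2, h3, h4⟩ := TraceL1.halfSpace_trace d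
    exact ⟨γ, h1, h2, fun q h => h3 q (hq q h), h4⟩
  · obtain ⟨γ, h1, h2, h3, h4⟩ := TraceL1.lipschitzDomain_trace hΩ hb hL
    exact ⟨γ, h1, h2, fun q h => h3 q (hq q h), h4⟩
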